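/- For a finite measure $\mu$ on $\mathbb{C}$ define the logarithmic potential $$u_\mu(z)=\int_{|\zeta|\le 1}\log|z-\zeta|\,d\mu(\zeta)+\int_{|\zeta|>1}\log|1-z/\zeta|\,d\mu(\zeta)\in[-\infty,\infty).$$ Let $\alpha\in(0,\pi/2)$, let $\operatorname{Arg}$ be the principal argument with values in $(-\pi,\pi]$ (with the convention $\operatorname{Arg}0=0$), and let $$u_\alpha(z)=\begin{cases}\log|z^{\pi/\alpha}+1|,&|\operatorname{Arg} z|<2\alpha,\\ \log(1+|z|^{\pi/\alpha}),&\text{otherwise,}\end{cases}$$ with the principal branch of the power (so $u_\alpha(0)=0$ and $u_\alpha(e^{\pm i\alpha})=-\infty$). Then $u_\alpha$ is subharmonic in $\mathbb{C}$, and $u_\alpha(z)\le u_\alpha(|z|)$ for all $z\in\mathbb{C}$. Its Riesz measure $\lambda_\alpha=\frac1{2\pi}\Delta u_\alpha$ (in the sense of distributions) has the following properties: 1. $\lambda_\alpha(\mathbb{C})=\pi/\alpha$, $\lambda_\alpha\{e^{i\alpha}\}=\lambda_\alpha\{e^{-i\alpha}\}=1$, and $\lambda_\alpha\{z\ne 0:|\operatorname{Arg}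 z|\ge 2\alpha\}=(\pi-2\alpha)/\alpha$. 2. $\lambda_\alpha$ is concentrated on $\{z\neq 0:|\operatorname{Arg} z|\ge 2\alpha\}\cup\{e^{i\alpha},e^{-i\alpha}\}$, and on $\{z\neq 0:|\operatorname{Arg} z|\ge 2\alpha\}$ it is absolutely continuous with respect to plane Lebesgue measure, with density $$\rho_\alpha(z)=\frac{1}{2\alpha r}\,\frac{d}{dr}\left(\frac{r^{\pi/\alpha}}{1+r^{\pi/\alpha}}\right),\qquad r=|z|.$$ The normalized measure $\mu_\alpha=\lambda_\alpha/\lambda_\alpha(\mathbb{C})$ is a probability measure, symmetric with respect to the real axis, whose potential satisfies $u_{\mu_\alpha}(z)\le u_{\mu_\alpha}(|z|)$ for all $z\in\mathbb{C}$. Moreover $$\mu_\alpha\{e^{i\alpha}\}=\mu_\alpha\{e^{-i\alpha}\}=\frac{\alpha}{\pi},\qquad \mu_\alpha\{z\in\mathbb{C}\setminus\{0\}:|\operatorname{Arg} z|\le\alpha\}=\frac{2\alpha}{\pi},$$ so that equality holds in Obrechkoff's inequality $\mu\{z\ne0:|\operatorname{Arg} z|\le\alpha\}\le 2\alpha/\pi$.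 -/

import Mathlib

open Real MeasureTheory
open scoped ContDiff ENNReal

noncomputable section

/-- Integral of an extended-real function: the integral of its positive part minus the integral
of its negative part. Below the positive part always has a finite integral, so this is a value
in `[-∞, ∞)`. -/
def extIntegral {X : Type*} [MeasurableSpace X] (μ : Measure X) (f : X → EReal) : EReal :=
  ((∫⁻ x, (f x).toENNReal ∂μ : ℝ≥0∞) : EReal) - ((∫⁻ x, (-f x).toENNReal ∂μ : ℝ≥0∞) : EReal)

/-- The function `log |w|` with values in `[-∞, ∞)`, so that `log |0| = -∞`. -/
def logAbs (w : ℂ) : EReal := ENNReal.log ‖w‖ₑ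

/-- The logarithmic potential
`∫_{|ζ| ≤ 1} log |z - ζ| dμ(ζ) + ∫_{|ζ| > 1} log |1 - z / ζ| dμ(ζ)`, with values in `[-∞, ∞)`
for a finite measure `μ`. -/
def logPotential (μ : Measure ℂ) (z : ℂ) : EReal :=
  extIntegral (μ.restrict {ζ : ℂ | ‖ζ‖ ≤ 1}) (fun ζ => logAbs (z - ζ)) +
    extIntegral (μ.restrict {ζ : ℂ | 1 < ‖ζ‖}) (fun ζ => logAbs (1 - z / ζ))

/-- Subharmonic functions on the plane that are not identically `-∞`. -/
structure IsSubharmonic (u : ℂ → EReal) : Prop where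
  upperSemicontinuous : UpperSemicontinuous u
  ne_top : ∀ z, u z ≠ ⊤
  exists_ne_bot : ∃ z, u z ≠ ⊥
  submean : ∀ c : ℂ, ∃ R : ℝ, 0 < R ∧ ∀ r ∈ Set.Ioo 0 R,
    u c ≤ (((2 * π)⁻¹ : ℝ) : EReal) *
      extIntegral (volume.restrict (Set.Ioc 0 (2 * π))) (fun θ : ℝ => u (circleMap c r θ))

/-- `ν` is the Riesz measure of `u`: a locally finite measure equal to `(1 / 2π) Δ u` in the sense
of distributions. -/
structure IsRieszMeasure (u : ℂ → EReal) (ν : Measure ℂ) : Prop where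
  locallyFinite : IsLocallyFiniteMeasure ν
  ae_finite : ∀ᵐ z : ℂ, u z ≠ ⊥ ∧ u z ≠ ⊤
  locallyIntegrable : LocallyIntegrable (fun z : ℂ => (u z).toReal) volume
  laplacian_eq : ∀ φ : ℂ → ℝ, ContDiff ℝ ∞ φ → HasCompactSupport φ →
    ∫ z : ℂ, (u z).toReal * Laplacian.laplacian φ z = 2 * π * ∫ z : ℂ, φ z ∂ν

/-- The function `log |z ^ (π / α) + 1|` in the sector `|Arg z| < 2 α` (principal branch),
and `log (1 + |z| ^ (π / α))` outside it. -/
def sectorFun (α : ℝ) (z : ℂ) : EReal :=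
  if |z.arg| < 2 * α then logAbs (z ^ ((π / α : ℝ) : ℂ) + 1)
  else ((Real.log (1 + ‖z‖ ^ (π / α)) : ℝ) : EReal)

/-- The sector `{z : |Arg z| ≥ 2 α}` (for `α > 0` it does not contain `0`, as `arg 0 = 0`). -/
def outerSector (α : ℝ) : Set ℂ := {z : ℂ | 2 * α ≤ |z.arg|}

/-- The radial density `(1 / (2 α r)) d/dr (r ^ (π / α) / (1 + r ^ (π / α)))` at `r = |z|`. -/
def sectorDensity (α : ℝ) (z : ℂ) : ℝ :=
  1 / (2 * α * ‖z‖) * deriv (fun r : ℝ => r ^ (π / α) / (1 + r ^ (π / α))) ‖z‖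

end

open Filter Topology Set

/-! ### Extended integrals -/

/-! Write k = π/α > 2 and r = |z|. Then u_α is the logarithm of N(z) = √(1 + 2 r^k cos(k·min(|Arg
z|, 2α)) + r^{2k}) (`sectorNorm`). Capping the angle at 2α, where k·2α = 2π, joins the two formulas
continuously. The cosine is at most 1, so N(z) ≤ 1 + r^k = N(|z|), which is the inequality for u_α.

Subharmonicity. Away from 0 and the poles e^{±iα}, continue the branch of z^k + 1 analytically from
the centre c. Its modulus equals N where the branch is the prescribed one and is at most 1 + r^k
everywhere, so its log-modulus is a harmonic minorant touching u_α at c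
(`submean_sectorFun_of_ne_zero`). At 0 the circle mean is computed directly: the arc |θ| < 2α is
carried by θ ↦ kθ to two full periods of log|1 + t e^{iy}| and contributes 0, while the remaining
arc contributes a nonnegative amount (`integral_log_sectorNorm_circle_nonneg`).

Riesz measure. Subtract log|z - e^{iα}| and log|z - e^{-iα}| to get `regularPart`, and put z = e^w.
In the inner strip |Im w| ≤ 2α the poles cancel the zeros of 1 + e^{kw}, leaving a harmonic
function. In the outer strip only log(1 + e^{k Re w}) fails to be harmonic, and its Laplacian is the
stated density. Since |1 + e^{kw}| is even about each line |Im w| = 2α, its normal derivative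
vanishes there, as does that of the radial function. Values and normal derivatives thus match and
the rays carry no mass. Green's identity on the two rectangles -S ≤ Re w ≤ S, with cancelling
horizontal edges and vertical edges that vanish as S → ∞, gives
`integral_regularPart_mul_laplacian`. The two logarithms supply the unit atoms
(`integral_log_norm_sub_mul_laplacian`).

Potential. Green's identity is proved for test functions that decay rather than have compact
support. It may therefore be applied to the difference of ½ log(|ζ - z|² + ε²) and ½ log(|ζ|² + ε²).
Letting ε → 0 expresses `regularPart` as a logarithmic potential (`regularPart_eq_integral`). Hence
the potential of μ_α is (α/π) u_α plus a constant off the poles, and -∞ at them, so it inherits the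
inequality. -/

/-- The positive and negative parts are compared separately, and lower integrals are monotone
without any measurability of `f`. A real integrable minorant is all that the submean inequality
needs. -/
theorem le_extIntegral {X : Type*} [MeasurableSpace X] {μ : Measure X} {f : X → EReal} {g : X → ℝ}
    (hg : Integrable g μ) (h : ∀ᵐ x ∂μ, (g x : EReal) ≤ f x) :
    ((∫ x, g x ∂μ : ℝ) : EReal) ≤ extIntegral μ f := by
  have h1 : ∫⁻ x, ENNReal.ofReal (g x) ∂μ ≠ ⊤ := hg.lintegral_lt_top.ne
  have h2 : ∫⁻ x, ENNReal.ofReal (-g x) ∂μ ≠ ⊤ := hg.neg.lintegral_lt_top.ne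
  rw [integral_eq_lintegral_pos_part_sub_lintegral_neg_part hg, EReal.coe_sub,
    EReal.coe_ennreal_toReal h1, EReal.coe_ennreal_toReal h2, extIntegral]
  refine EReal.sub_le_sub ?_ ?_
  · refine EReal.coe_ennreal_le_coe_ennreal_iff.2 (lintegral_mono_ae ?_)
    filter_upwards [h] with x hx
    simpa using EReal.toENNReal_le_toENNReal hx
  · refine EReal.coe_ennreal_le_coe_ennreal_iff.2 (lintegral_mono_ae ?_)
    filter_upwards [h] with x hx
    have := EReal.toENNReal_le_toENNReal (EReal.neg_le_neg_iff.2 hx)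
    rwa [← EReal.coe_neg, EReal.toENNReal_of_ne_top (EReal.coe_ne_top _), EReal.toReal_coe] at this

theorem extIntegral_eq_integral {X : Type*} [MeasurableSpace X] {μ : Measure X} {f : X → EReal}
    {g : X → ℝ} (hg : Integrable g μ) (h : ∀ᵐ x ∂μ, f x = (g x : EReal)) :
    extIntegral μ f = ((∫ x, g x ∂μ : ℝ) : EReal) := by
  have h1 : ∫⁻ x, ENNReal.ofReal (g x) ∂μ ≠ ⊤ := hg.lintegral_lt_top.ne
  have h2 : ∫⁻ x, ENNReal.ofReal (-g x) ∂μ ≠ ⊤ := hg.neg.lintegral_lt_top.ne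
  rw [integral_eq_lintegral_pos_part_sub_lintegral_neg_part hg, EReal.coe_sub,
    EReal.coe_ennreal_toReal h1, EReal.coe_ennreal_toReal h2, extIntegral]
  congr 2
  · refine lintegral_congr_ae ?_
    filter_upwards [h] with x hx
    rw [hx, EReal.toENNReal_of_ne_top (EReal.coe_ne_top _), EReal.toReal_coe]
  · refine lintegral_congr_ae ?_
    filter_upwards [h] with x hx
    rw [hx, ← EReal.coe_neg, EReal.toENNReal_of_ne_top (EReal.coe_ne_top _), EReal.toReal_coe]

/-! ### The modulus of the function in the sector -/

/-- The jump of `arg` across the negative axis disappears in absolute value: |arg w| = arccos(Re w /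
|w|), which is continuous off 0. -/
theorem continuousAt_abs_arg {z : ℂ} (hz : z ≠ 0) : ContinuousAt (fun w : ℂ => |w.arg|) z := by
  have h : ContinuousAt (fun w : ℂ => Real.arccos (w.re / ‖w‖)) z :=
    Real.continuous_arccos.continuousAt.comp
      (Complex.continuous_re.continuousAt.div continuous_norm.continuousAt (norm_ne_zero_iff.2 hz))
  refine h.congr ?_
  filter_upwards [isOpen_ne.mem_nhds hz] with w hw
  rw [← Complex.cos_arg hw, ← Real.cos_abs, Real.arccos_cos (abs_nonneg _) (Complex.abs_arg_le_pi _)]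

/-- The function whose logarithm is `sectorFun α`. -/
noncomputable def sectorNorm (α : ℝ) (z : ℂ) : ℝ :=
  √(1 + 2 * ‖z‖ ^ (π / α) * Real.cos (π / α * min |z.arg| (2 * α)) + (‖z‖ ^ (π / α)) ^ 2)

theorem sectorNorm_nonneg (α : ℝ) (z : ℂ) : 0 ≤ sectorNorm α z := Real.sqrt_nonneg _

/-- The angle is capped exactly where the cosine returns to 1, so the radicand becomes a perfect
square. -/
theorem sectorNorm_of_le {α : ℝ} (hα : 0 < α) {z : ℂ} (h : 2 * α ≤ |z.arg|) :
    sectorNorm α z = 1 + ‖z‖ ^ (π / α) := by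
  have : (0:ℝ) ≤ ‖z‖ ^ (π / α) := by positivity
  have h2 : π / α * (2 * α) = 2 * π := by field_simp
  rw [sectorNorm, min_eq_right h, h2, Real.cos_two_pi, Real.sqrt_eq_iff_mul_self_eq] <;> nlinarith

theorem norm_one_add_mul_exp (t y : ℝ) :
    ‖(t : ℂ) * Complex.exp (y * Complex.I) + 1‖ = √(1 + 2 * t * Real.cos y + t ^ 2) := by
  rw [← Real.sqrt_sq (norm_nonneg _), Complex.sq_norm, Complex.exp_mul_I]
  congr 1
  simp only [Complex.normSq_apply, Complex.add_re, Complex.mul_re, Complex.ofReal_re,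
    Complex.ofReal_im, Complex.one_re, Complex.add_im, Complex.mul_im, Complex.one_im,
    Complex.cos_ofReal_re, Complex.sin_ofReal_re, Complex.I_re, Complex.I_im,
    Complex.cos_ofReal_im, Complex.sin_ofReal_im]
  nlinarith [Real.sin_sq_add_cos_sq y]

theorem cpow_ofReal_eq {z : ℂ} {k : ℝ} (hk : k ≠ 0) :
    z ^ (k : ℂ) = ((‖z‖ ^ k : ℝ) : ℂ) * Complex.exp ((k * z.arg : ℝ) * Complex.I) := by
  rcases eq_or_ne z 0 with rfl | hz
  · rw [Complex.zero_cpow (by exact_mod_cast hk)]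
    simp [Real.zero_rpow hk]
  · rw [Complex.cpow_def_of_ne_zero hz, Complex.log, Real.rpow_def_of_pos (norm_pos_iff.2 hz),
      Complex.ofReal_exp, ← Complex.exp_add]
    push_cast
    congr 1
    ring

theorem norm_cpow_add_one {α : ℝ} (hα : 0 < α) {z : ℂ} (h : |z.arg| ≤ 2 * α) :
    ‖z ^ ((π / α : ℝ) : ℂ) + 1‖ = sectorNorm α z := by
  have : π / α ≠ 0 := by positivity
  rw [cpow_ofReal_eq this, norm_one_add_mul_exp, sectorNorm, min_eq_left h]
  congr 4
  rw [← Real.cos_abs, abs_mul, abs_of_pos (by positivity : 0 < π / α)]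

theorem logAbs_eq (w : ℂ) : logAbs w = ENNReal.log (ENNReal.ofReal ‖w‖) := by
  rw [logAbs, ofReal_norm]

theorem sectorFun_eq {α : ℝ} (hα : 0 < α) (z : ℂ) :
    sectorFun α z = ENNReal.log (ENNReal.ofReal (sectorNorm α z)) := by
  rw [sectorFun]
  split_ifs with h
  · rw [logAbs_eq, norm_cpow_add_one hα h.le]
  · have h' := not_lt.1 h
    have : (0:ℝ) ≤ ‖z‖ ^ (π / α) := by positivity
    rw [sectorNorm_of_le hα h', ENNReal.log_ofReal, if_neg (by linarith)]

theorem sectorFun_eq_coe {α : ℝ} (hα : 0 < α) {z : ℂ} (h : 0 < sectorNorm α z) :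
    sectorFun α z = ((Real.log (sectorNorm α z) : ℝ) : EReal) := by
  rw [sectorFun_eq hα, ENNReal.log_ofReal, if_neg h.not_ge]

/-- True at the poles as well, because `EReal.toReal ⊥` and `Real.log 0` are both 0. -/
theorem toReal_sectorFun {α : ℝ} (hα : 0 < α) (z : ℂ) :
    (sectorFun α z).toReal = Real.log (sectorNorm α z) := by
  rcases (sectorNorm_nonneg α z).eq_or_lt with h | h
  · rw [sectorFun_eq hα, ← h]; simp
  · rw [sectorFun_eq_coe hα h, EReal.toReal_coe]

theorem continuous_sectorNorm {α : ℝ} (hα : 0 < α) : Continuous (sectorNorm α) := by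
  have hk : 0 < π / α := by positivity
  have hpow : Continuous fun z : ℂ => ‖z‖ ^ (π / α) :=
    continuous_norm.rpow_const fun _ => Or.inr hk.le
  refine Real.continuous_sqrt.comp ?_
  refine (continuous_const.add ?_).add (hpow.pow 2)
  rw [continuous_iff_continuousAt]
  intro z
  rcases eq_or_ne z 0 with rfl | hz
  -- The argument is discontinuous at 0, but there the bounded cosine is multiplied by a factor that
  -- tends to 0.
  · have h0 : 2 * ‖(0:ℂ)‖ ^ (π / α) * Real.cos (π / α * min |(0:ℂ).arg| (2 * α)) = 0 := by
      simp [Real.zero_rpow hk.ne']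
    rw [ContinuousAt, h0]
    have h1 : Tendsto (fun z : ℂ => 2 * ‖z‖ ^ (π / α)) (𝓝 0) (𝓝 0) := by
      have := (hpow.const_mul 2).tendsto 0
      simpa [Real.zero_rpow hk.ne'] using this
    refine squeeze_zero_norm (fun w => ?_) h1
    rw [norm_mul, Real.norm_of_nonneg (by positivity), Real.norm_eq_abs]
    exact mul_le_of_le_one_right (by positivity) (Real.abs_cos_le_one _)
  · exact (hpow.const_mul 2).continuousAt.mul (Real.continuous_cos.continuousAt.comp
      (((continuousAt_abs_arg hz).min continuousAt_const).const_mul _))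

theorem continuous_sectorFun {α : ℝ} (hα : 0 < α) : Continuous (sectorFun α) := by
  rw [funext (sectorFun_eq hα)]
  exact ENNReal.continuous_log.comp
    (ENNReal.continuous_ofReal.comp (continuous_sectorNorm hα))

theorem sectorNorm_le (α : ℝ) (z : ℂ) : sectorNorm α z ≤ 1 + ‖z‖ ^ (π / α) := by
  have h : (0:ℝ) ≤ ‖z‖ ^ (π / α) := by positivity
  rw [sectorNorm, Real.sqrt_le_left (by linarith)]
  nlinarith [Real.cos_le_one (π / α * min |z.arg| (2 * α))]

/-- Zeros can occur only on the unit circle; on smaller circles the logarithm is continuous. -/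
theorem le_sectorNorm (α : ℝ) (z : ℂ) : |1 - ‖z‖ ^ (π / α)| ≤ sectorNorm α z := by
  have h : (0:ℝ) ≤ ‖z‖ ^ (π / α) := by positivity
  refine Real.abs_le_sqrt ?_
  nlinarith [Real.neg_one_le_cos (π / α * min |z.arg| (2 * α))]

theorem sectorNorm_norm {α : ℝ} (hα : 0 < α) (z : ℂ) :
    sectorNorm α (‖z‖ : ℂ) = 1 + ‖z‖ ^ (π / α) := by
  have h : (0:ℝ) ≤ ‖z‖ ^ (π / α) := by positivity
  rw [sectorNorm, Complex.arg_ofReal_of_nonneg (norm_nonneg z), abs_zero,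
    min_eq_left (by positivity), mul_zero, Real.cos_zero, Complex.norm_real, norm_norm,
    Real.sqrt_eq_iff_mul_self_eq] <;> nlinarith

theorem sectorFun_le_norm {α : ℝ} (hα : 0 < α) (z : ℂ) :
    sectorFun α z ≤ sectorFun α (‖z‖ : ℂ) := by
  rw [sectorFun_eq hα, sectorFun_eq hα, sectorNorm_norm hα]
  exact ENNReal.log_monotone (ENNReal.ofReal_le_ofReal (sectorNorm_le α z))

theorem sectorNorm_zero {α : ℝ} (hα : 0 < α) : sectorNorm α 0 = 1 := by
  have hk : π / α ≠ 0 := by positivity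
  simp [sectorNorm, Real.zero_rpow hk]

theorem sectorNorm_mul_exp {α r θ : ℝ} (hr : 0 < r) (hθ : θ ∈ Ioc (-π) π) :
    sectorNorm α (r * Complex.exp (θ * Complex.I)) =
      √(1 + 2 * r ^ (π / α) * Real.cos (π / α * min |θ| (2 * α)) + (r ^ (π / α)) ^ 2) := by
  rw [sectorNorm, Complex.exp_mul_I, Complex.arg_mul_cos_add_sin_mul_I hr hθ,
    norm_mul, ← Complex.exp_mul_I, Complex.norm_exp_ofReal_mul_I, Complex.norm_real,
    Real.norm_of_nonneg hr.le, mul_one]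

/-! ### Subharmonicity -/

/-- A function that has a harmonic minorant near `c` touching it at `c` satisfies the submean
inequality at `c`. -/
theorem submean_of_harmonic_minorant {u : ℂ → EReal} {h : ℂ → ℝ} {c : ℂ}
    (hh : InnerProductSpace.HarmonicAt h c) (hc : u c = h c) (hle : ∀ᶠ z in 𝓝 c, (h z : EReal) ≤ u z) :
    ∃ R : ℝ, 0 < R ∧ ∀ r ∈ Ioo 0 R,
    u c ≤ (((2 * π)⁻¹ : ℝ) : EReal) *
      extIntegral (volume.restrict (Ioc 0 (2 * π))) (fun θ : ℝ => u (circleMap c r θ)) := by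
  obtain ⟨R, hR, hball⟩ := Metric.eventually_nhds_iff_ball.1 (hh.eventually.and hle)
  refine ⟨R, hR, fun r hr => ?_⟩
  have hmem : ∀ z ∈ Metric.closedBall c |r|, z ∈ Metric.ball c R := fun z hz => by
    rw [abs_of_pos hr.1] at hz
    exact Metric.closedBall_subset_ball hr.2 hz
  have hharm : InnerProductSpace.HarmonicOnNhd h (Metric.closedBall c |r|) :=
    fun z hz => (hball z (hmem z hz)).1
  have hcirc : ∀ θ, circleMap c r θ ∈ Metric.closedBall c |r| := fun θ =>
    Metric.sphere_subset_closedBall (circleMap_mem_sphere' c r θ)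
  have hcont : Continuous fun θ => h (circleMap c r θ) := by
    have := hharm.continuousOn
    exact this.comp_continuous (continuous_circleMap c r) hcirc
  have hav := hharm.circleAverage_eq
  rw [Real.circleAverage_def, intervalIntegral.integral_of_le (by positivity), smul_eq_mul] at hav
  rw [hc, ← hav, EReal.coe_mul]
  refine mul_le_mul_of_nonneg_left ?_ (by exact_mod_cast (by positivity : (0:ℝ) ≤ (2 * π)⁻¹))
  refine le_extIntegral ?_ (Eventually.of_forall fun θ => (hball _ (hmem _ (hcirc θ))).2)
  exact (hcont.integrableOn_Icc).mono_set Ioc_subset_Icc_self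

/-- The touching minorant is log‖F‖, where F is the branch of z^k + 1 continued holomorphically from
c, even across the rays |arg z| = 2α. Beyond such a ray the branch differs from the definition of u,
but only ‖F‖ ≤ 1 + ‖z‖^k is needed there. -/
theorem submean_sectorFun_of_ne_zero {α : ℝ} (hα : α ∈ Ioo 0 (π / 2)) {c : ℂ} (hc : c ≠ 0) :
    ∃ R : ℝ, 0 < R ∧ ∀ r ∈ Ioo 0 R,
    sectorFun α c ≤ (((2 * π)⁻¹ : ℝ) : EReal) *
      extIntegral (volume.restrict (Ioc 0 (2 * π)))
        (fun θ : ℝ => sectorFun α (circleMap c r θ)) := by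
  obtain ⟨h0, h1⟩ := hα
  have hk : 0 < π / α := by positivity
  rcases (sectorNorm_nonneg α c).eq_or_lt with hN | hN
  · refine ⟨1, one_pos, fun r _ => ?_⟩
    rw [sectorFun_eq h0, ← hN]
    simp
  -- Outside the sector the phase of A is free; a positive A gives F(c) = 1 + ‖c‖^k, which is the
  -- required contact at c.
  set A : ℂ := if |c.arg| ≤ 2 * α then c ^ ((π / α : ℝ) : ℂ) else ((‖c‖ ^ (π / α) : ℝ) : ℂ) with hA
  have hAnorm : ‖A‖ = ‖c‖ ^ (π / α) := by
    rw [hA]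
    split_ifs
    · rw [cpow_ofReal_eq hk.ne', norm_mul, Complex.norm_exp_ofReal_mul_I, mul_one, Complex.norm_real,
        Real.norm_of_nonneg (by positivity)]
    · rw [Complex.norm_real, Real.norm_of_nonneg (by positivity)]
  set F : ℂ → ℂ := fun z => A * (z / c) ^ ((π / α : ℝ) : ℂ) + 1 with hF
  have hFc : ‖F c‖ = sectorNorm α c := by
    simp only [hF, div_self hc, Complex.one_cpow, mul_one]
    rw [hA]
    split_ifs with h
    · exact norm_cpow_add_one h0 h
    · have : (0:ℝ) ≤ ‖c‖ ^ (π / α) := by positivity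
      rw [sectorNorm_of_le h0 (not_le.1 h).le, ← Complex.ofReal_one, ← Complex.ofReal_add,
        Complex.norm_real, Real.norm_of_nonneg (by positivity), add_comm]
  have hFan : AnalyticAt ℂ F c := by
    have : (fun z => z / c) c ∈ Complex.slitPlane := by simp [div_self hc]
    have h1 : AnalyticAt ℂ (fun z => z / c) c := by fun_prop
    exact ((analyticAt_const).mul (h1.cpow analyticAt_const this)).add analyticAt_const
  have hFc0 : F c ≠ 0 := by rw [← norm_ne_zero_iff, hFc]; exact hN.ne'
  refine submean_of_harmonic_minorant (hFan.harmonicAt_log_norm hFc0) ?_ ?_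
  · simp only [hFc]
    exact sectorFun_eq_coe h0 hN
  have hne : ∀ᶠ z in 𝓝 c, F z ≠ 0 := hFan.continuousAt.eventually_ne hFc0
  have key : ∀ᶠ z in 𝓝 c, ‖F z‖ ≤ sectorNorm α z := by
    have hnorm : ∀ z, ‖F z‖ ≤ 1 + ‖z‖ ^ (π / α) := fun z => by
      refine (norm_add_le _ _).trans ?_
      rw [norm_one, add_comm, norm_mul, hAnorm, cpow_ofReal_eq hk.ne', norm_mul,
        Complex.norm_exp_ofReal_mul_I, mul_one, Complex.norm_real,
        Real.norm_of_nonneg (by positivity), norm_div,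
        ← Real.mul_rpow (norm_nonneg _) (by positivity), mul_div_cancel₀ _ (norm_ne_zero_iff.2 hc)]
    by_cases h : |c.arg| ≤ 2 * α
    -- With |arg c| ≤ 2α, this bound keeps arg c + arg(z/c) strictly between -π and π, so the
    -- logarithm is additive and F is the principal branch. The bound is positive because α < π/2.
    · have harg : ∀ᶠ z in 𝓝 c, |(z / c).arg| < π - 2 * α := by
        have : ContinuousAt (fun z : ℂ => |(z / c).arg|) c := by
          refine ContinuousAt.comp (f := fun z : ℂ => z / c) (g := fun w : ℂ => |w.arg|)
            (continuousAt_abs_arg (by simp [hc])) (by fun_prop)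
        refine this.eventually_lt continuousAt_const ?_
        simp [div_self hc]
        linarith
      filter_upwards [harg, isOpen_ne.mem_nhds hc] with z hz hz0
      by_cases hz2 : |z.arg| ≤ 2 * α
      · rw [← norm_cpow_add_one h0 hz2]
        have : F z = z ^ ((π / α : ℝ) : ℂ) + 1 := by
          simp only [hF, hA, if_pos h]
          have hzc : z / c ≠ 0 := div_ne_zero hz0 hc
          have hlog : Complex.log (c * (z / c)) = Complex.log c + Complex.log (z / c) := by
            rw [Complex.log_mul_eq_add_log_iff hc hzc]
            have e1 := abs_le.1 h
            have e2 := abs_lt.1 hz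
            constructor <;> linarith
          rw [mul_div_cancel₀ _ hc] at hlog
          rw [Complex.cpow_def_of_ne_zero hc, Complex.cpow_def_of_ne_zero hzc,
            Complex.cpow_def_of_ne_zero hz0, hlog, ← Complex.exp_add, add_mul]
        rw [this]
      · rw [sectorNorm_of_le h0 (not_le.1 hz2).le]
        exact hnorm z
    · have : ∀ᶠ z in 𝓝 c, 2 * α < |z.arg| :=
        continuousAt_const.eventually_lt (continuousAt_abs_arg hc) (not_le.1 h)
      filter_upwards [this] with z hz
      rw [sectorNorm_of_le h0 hz.le]
      exact hnorm z
  filter_upwards [hne, key] with z hz1 hz2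
  have hp : 0 < ‖F z‖ := norm_pos_iff.2 hz1
  rw [sectorFun_eq_coe h0 (hp.trans_le hz2), EReal.coe_le_coe_iff]
  exact Real.log_le_log hp hz2

/-- The mean value property for log|1 + z|, which is harmonic on the disc of radius t < 1 and
vanishes at its centre. Two periods appear because kθ sweeps [-2π, 2π] as θ runs through [-2α, 2α].
-/
theorem integral_log_norm_one_add_mul_exp {t : ℝ} (ht : t ∈ Ioo 0 1) :
    ∫ y in -(2 * π)..(2 * π), Real.log ‖(t : ℂ) * Complex.exp (y * Complex.I) + 1‖ = 0 := by
  set f : ℝ → ℝ := fun y => Real.log ‖(t : ℂ) * Complex.exp (y * Complex.I) + 1‖ with hf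
  have hper : Function.Periodic f (2 * π) := fun y => by
    simp only [hf]
    congr 4
    push_cast
    rw [add_mul, Complex.exp_add, Complex.exp_two_pi_mul_I, mul_one]
  have hne : ∀ z ∈ Metric.closedBall (0:ℂ) |t|, z + 1 ≠ 0 := fun z hz h => by
    rw [mem_closedBall_zero_iff, eq_neg_of_add_eq_zero_left h, norm_neg, norm_one,
      abs_of_pos ht.1] at hz
    linarith [ht.2]
  have hharm : InnerProductSpace.HarmonicOnNhd (fun z : ℂ => Real.log ‖z + 1‖)
      (Metric.closedBall 0 |t|) := fun z hz =>
    AnalyticAt.harmonicAt_log_norm (f := fun z => z + 1) (by fun_prop) (hne z hz)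
  have hav := hharm.circleAverage_eq
  rw [Real.circleAverage_def] at hav
  simp only [circleMap, zero_add, norm_one, Real.log_one, smul_eq_mul, mul_eq_zero, inv_eq_zero] at hav
  have h0 : ∫ y in (0:ℝ)..(2 * π), f y = 0 := by
    rcases hav with h | h
    · exact absurd h (by simp [Real.pi_ne_zero])
    · exact h
  have h1 : ∫ y in -(2 * π)..0, f y = 0 := by
    have := hper.intervalIntegral_add_eq (-(2 * π)) 0
    rw [neg_add_cancel, zero_add, h0] at this
    exact this
  have hcont : Continuous f := by
    refine Continuous.log (by fun_prop) fun y => norm_ne_zero_iff.2 (hne _ ?_)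
    rw [mem_closedBall_zero_iff, norm_mul, Complex.norm_exp_ofReal_mul_I, mul_one,
      Complex.norm_real, Real.norm_eq_abs]
  rw [← intervalIntegral.integral_add_adjacent_intervals (hcont.intervalIntegrable _ 0)
    (hcont.intervalIntegrable 0 _), h0, h1, add_zero]

/-- The arc |θ| ≤ 2α contributes exactly 0 by the mean value property, and on the rest of the circle
the integrand is log(1 + r^k) ≥ 0. -/
theorem integral_log_sectorNorm_circle_nonneg {α : ℝ} (hα : α ∈ Ioo 0 (π / 2)) {r : ℝ}
    (hr : r ∈ Ioo 0 1) : 0 ≤ ∫ θ in (0:ℝ)..(2 * π), Real.log (sectorNorm α (circleMap 0 r θ)) := by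
  obtain ⟨h0, h1⟩ := hα
  have hk : 0 < π / α := by positivity
  have hr1 : r ^ (π / α) < 1 := Real.rpow_lt_one hr.1.le hr.2 hk
  have hr0 : 0 < r ^ (π / α) := Real.rpow_pos_of_pos hr.1 _
  set f : ℝ → ℝ := fun θ => Real.log (sectorNorm α (circleMap 0 r θ)) with hf
  have hper : Function.Periodic f (2 * π) := fun θ => by
    simp only [hf, periodic_circleMap 0 r θ]
  have hcont : Continuous f := by
    refine ((continuous_sectorNorm h0).comp (continuous_circleMap 0 r)).log fun θ => ?_
    have := le_sectorNorm α (circleMap 0 r θ)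
    rw [norm_circleMap_zero, abs_of_pos hr.1, abs_of_pos (by linarith)] at this
    simp only [Function.comp]
    linarith
  have e1 : ∫ θ in (0:ℝ)..(2 * π), f θ = ∫ θ in (-π)..π, f θ := by
    have := hper.intervalIntegral_add_eq 0 (-π)
    rw [zero_add] at this
    rw [this]; congr 1; ring
  have hval : ∀ θ ∈ Icc (-π) π, f θ = Real.log (√(1 + 2 * r ^ (π / α) *
      Real.cos (π / α * min |θ| (2 * α)) + (r ^ (π / α)) ^ 2)) := by
    intro θ hθ
    rcases hθ.1.eq_or_lt with h | h
    -- The principal argument never equals -π, so this endpoint is moved to π by periodicity.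
    · have e : f θ = f π := by
        have := hper θ
        rw [← this, ← h]; congr 1; ring
      rw [e]
      simp only [hf, circleMap, zero_add]
      rw [sectorNorm_mul_exp hr.1 ⟨by linarith, le_rfl⟩, ← h, abs_neg]
    · simp only [hf, circleMap, zero_add]
      rw [sectorNorm_mul_exp hr.1 ⟨h, hθ.2⟩]
  have houter : ∀ θ ∈ Icc (-π) π, 2 * α ≤ |θ| → 0 ≤ f θ := by
    intro θ hθ h
    rw [hval θ hθ]
    refine Real.log_nonneg (Real.one_le_sqrt.2 ?_)
    have h2 : π / α * (2 * α) = 2 * π := by field_simp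
    rw [min_eq_right h, h2, Real.cos_two_pi]
    nlinarith
  have hinner : ∫ θ in (-(2 * α))..(2 * α), f θ = 0 := by
    have e2 : ∫ θ in (-(2 * α))..(2 * α), f θ = ∫ θ in (-(2 * α))..(2 * α),
        (fun y : ℝ => Real.log ‖((r ^ (π / α) : ℝ) : ℂ) * Complex.exp (y * Complex.I) + 1‖)
          (π / α * θ) := by
      refine intervalIntegral.integral_congr fun θ hθ => ?_
      rw [uIcc_of_le (by linarith)] at hθ
      simp only
      rw [hval θ ⟨by linarith [hθ.1], by linarith [hθ.2]⟩, norm_one_add_mul_exp,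
        min_eq_left (abs_le.2 hθ), ← Real.cos_abs (π / α * θ), abs_mul, abs_of_pos hk]
    rw [e2, intervalIntegral.integral_comp_mul_left (fun y : ℝ =>
      Real.log ‖((r ^ (π / α) : ℝ) : ℂ) * Complex.exp (y * Complex.I) + 1‖) hk.ne']
    have h2 : π / α * (2 * α) = 2 * π := by field_simp
    rw [mul_neg, h2, integral_log_norm_one_add_mul_exp ⟨hr0, hr1⟩, smul_zero]
  rw [e1, ← intervalIntegral.integral_add_adjacent_intervals
    (hcont.intervalIntegrable (-π) (-(2 * α))) (hcont.intervalIntegrable _ _),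
    ← intervalIntegral.integral_add_adjacent_intervals
    (hcont.intervalIntegrable (-(2 * α)) (2 * α)) (hcont.intervalIntegrable _ _), hinner]
  have i1 : 0 ≤ ∫ θ in (-π)..(-(2 * α)), f θ :=
    intervalIntegral.integral_nonneg (by linarith) fun θ hθ =>
      houter θ ⟨hθ.1, by linarith [hθ.2, Real.pi_pos]⟩ (le_abs.2 (Or.inr (by linarith [hθ.2])))
  have i2 : 0 ≤ ∫ θ in (2 * α)..π, f θ :=
    intervalIntegral.integral_nonneg (by linarith) fun θ hθ =>
      houter θ ⟨by linarith [hθ.1, Real.pi_pos], hθ.2⟩ (le_abs.2 (Or.inl hθ.1))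
  linarith

theorem submean_sectorFun_zero {α : ℝ} (hα : α ∈ Ioo 0 (π / 2)) :
    ∃ R : ℝ, 0 < R ∧ ∀ r ∈ Ioo 0 R,
    sectorFun α 0 ≤ (((2 * π)⁻¹ : ℝ) : EReal) *
      extIntegral (volume.restrict (Ioc 0 (2 * π)))
        (fun θ : ℝ => sectorFun α (circleMap 0 r θ)) := by
  refine ⟨1, one_pos, fun r hr => ?_⟩
  have h0 := hα.1
  have hk : 0 < π / α := by positivity
  have hr1 : r ^ (π / α) < 1 := Real.rpow_lt_one hr.1.le hr.2 hk
  have hpos : ∀ θ, 0 < sectorNorm α (circleMap 0 r θ) := fun θ => by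
    have := le_sectorNorm α (circleMap 0 r θ)
    rw [norm_circleMap_zero, abs_of_pos hr.1, abs_of_pos (by linarith)] at this
    linarith
  have hcont : Continuous fun θ => Real.log (sectorNorm α (circleMap 0 r θ)) :=
    ((continuous_sectorNorm h0).comp (continuous_circleMap 0 r)).log fun θ => (hpos θ).ne'
  have hint := integral_log_sectorNorm_circle_nonneg hα hr
  rw [intervalIntegral.integral_of_le (by positivity)] at hint
  have hle := le_extIntegral (μ := volume.restrict (Ioc 0 (2 * π)))
    (f := fun θ : ℝ => sectorFun α (circleMap 0 r θ))
    (hcont.integrableOn_Icc.mono_set Ioc_subset_Icc_self)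
    (Eventually.of_forall fun θ => (sectorFun_eq_coe h0 (hpos θ)).ge)
  have hz : sectorFun α 0 = 0 := by
    rw [sectorFun_eq_coe h0 (by rw [sectorNorm_zero h0]; exact one_pos), sectorNorm_zero h0]; simp
  rw [hz]
  refine mul_nonneg (by exact_mod_cast (by positivity : (0:ℝ) ≤ (2 * π)⁻¹)) (le_trans ?_ hle)
  exact_mod_cast hint

theorem isSubharmonic_sectorFun {α : ℝ} (hα : α ∈ Ioo 0 (π / 2)) :
    IsSubharmonic (sectorFun α) where
  upperSemicontinuous := (continuous_sectorFun hα.1).upperSemicontinuous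
  ne_top z := by
    rw [sectorFun_eq hα.1, ENNReal.log_ofReal]
    split_ifs
    · exact bot_ne_top
    · exact EReal.coe_ne_top _
  exists_ne_bot := ⟨0, by
    rw [sectorFun_eq_coe hα.1 (by rw [sectorNorm_zero hα.1]; exact one_pos)]
    exact EReal.coe_ne_bot _⟩
  submean c := by
    rcases eq_or_ne c 0 with rfl | hc
    · exact submean_sectorFun_zero hα
    · exact submean_sectorFun_of_ne_zero hα hc

/-! ### The change of variables `z = exp w` -/

/-- The period strip `b < Im w ≤ b + 2π` of the exponential function. -/
def periodStrip (b : ℝ) : Set ℂ := {w | w.im ∈ Ioc b (b + 2 * π)}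

theorem measurableSet_periodStrip (b : ℝ) : MeasurableSet (periodStrip b) :=
  Complex.measurable_im measurableSet_Ioc

theorem injOn_exp_periodStrip (b : ℝ) : InjOn Complex.exp (periodStrip b) := by
  intro w hw w' hw' h
  obtain ⟨n, hn⟩ := Complex.exp_eq_exp_iff_exists_int.1 h
  have him := congrArg Complex.im hn
  simp only [Complex.add_im, Complex.mul_im, Complex.intCast_re, Complex.intCast_im,
    Complex.re_ofNat, Complex.im_ofNat, Complex.ofReal_re, Complex.ofReal_im,
    Complex.I_re, Complex.I_im, Complex.mul_re] at him
  ring_nf at him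
  have h1 := hw.1
  have h2 := hw.2
  have h3 := hw'.1
  have h4 := hw'.2
  have hpi := Real.pi_pos
  have hlt : (n : ℝ) < 1 := by by_contra hc; nlinarith
  have hgt : (-1 : ℝ) < n := by by_contra hc; nlinarith
  have hn0 : n = 0 := by
    have h5 : n < 1 := by exact_mod_cast hlt
    have h6 : -1 < n := by exact_mod_cast hgt
    omega
  simpa [hn0] using hn

theorem exp_image_periodStrip (b : ℝ) : Complex.exp '' periodStrip b = {0}ᶜ := by
  ext z
  constructor
  · rintro ⟨w, -, rfl⟩
    exact Complex.exp_ne_zero w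
  · intro hz
    -- The principal logarithm of -z e^{-ib} has imaginary part in (-π, π]; adding i(b + π) restores
    -- z under exp and moves that interval to (b, b + 2π].
    have hz' : -z * Complex.exp (-(b * Complex.I)) ≠ 0 :=
      mul_ne_zero (neg_ne_zero.2 hz) (Complex.exp_ne_zero _)
    refine ⟨Complex.log (-z * Complex.exp (-(b * Complex.I))) + (b * Complex.I + π * Complex.I),
      ?_, ?_⟩
    · simp only [periodStrip, mem_ofPred_eq, Complex.add_im, Complex.log_im, Complex.mul_im,
        Complex.ofReal_re, Complex.ofReal_im, Complex.I_re, Complex.I_im]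
      have h1 := Complex.neg_pi_lt_arg (-z * Complex.exp (-(b * Complex.I)))
      have h2 := Complex.arg_le_pi (-z * Complex.exp (-(b * Complex.I)))
      constructor <;> linarith
    · rw [Complex.exp_add, Complex.exp_log hz', Complex.exp_add, Complex.exp_pi_mul_I,
        Complex.exp_neg]
      field_simp [Complex.exp_ne_zero]

theorem hasFDerivWithinAt_exp_real (s : Set ℂ) (w : ℂ) :
    HasFDerivWithinAt Complex.exp
      ((ContinuousLinearMap.toSpanSingleton ℂ (Complex.exp w)).restrictScalars ℝ) s w :=
  ((Complex.hasDerivAt_exp w).hasFDerivAt.restrictScalars ℝ).hasFDerivWithinAt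

/-- The real determinant of multiplication by c is the field norm of c over ℝ, namely |c|². -/
theorem abs_det_toSpanSingleton (c : ℂ) :
    |((ContinuousLinearMap.toSpanSingleton ℂ c).restrictScalars ℝ).det| = ‖c‖ ^ 2 := by
  have : ((ContinuousLinearMap.toSpanSingleton ℂ c).restrictScalars ℝ : ℂ →ₗ[ℝ] ℂ) =
      LinearMap.mulLeft ℝ c := by
    ext <;> simp [mul_comm]
  have h2 : LinearMap.det (LinearMap.mulLeft ℝ c) = Algebra.norm ℝ c := (Algebra.norm_apply ℝ c).symm
  rw [ContinuousLinearMap.det, this, h2, Algebra.norm_complex_apply, Complex.normSq_eq_norm_sq,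
    abs_of_nonneg (by positivity)]

theorem integral_eq_integral_periodStrip (b : ℝ) (G : ℂ → ℝ) :
    ∫ z, G z = ∫ w in periodStrip b, ‖Complex.exp w‖ ^ 2 * G (Complex.exp w) := by
  have h := integral_image_eq_integral_abs_det_fderiv_smul volume (measurableSet_periodStrip b)
    (fun w _ => hasFDerivWithinAt_exp_real _ w) (injOn_exp_periodStrip b) G
  rw [exp_image_periodStrip] at h
  simp only [abs_det_toSpanSingleton, smul_eq_mul] at h
  rw [← h, ← setIntegral_univ]
  refine setIntegral_congr_set ?_
  exact (ae_eq_univ.2 (by simp)).symm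

theorem integrableOn_periodStrip (b : ℝ) {G : ℂ → ℝ} (hG : Integrable G) :
    IntegrableOn (fun w => ‖Complex.exp w‖ ^ 2 * G (Complex.exp w)) (periodStrip b) := by
  have h := integrableOn_image_iff_integrableOn_abs_det_fderiv_smul volume
    (measurableSet_periodStrip b)
    (fun w _ => hasFDerivWithinAt_exp_real _ w) (injOn_exp_periodStrip b) G
  simp only [abs_det_toSpanSingleton, smul_eq_mul] at h
  exact h.1 hG.integrableOn

/-- Presents a planar integral as a limit of iterated integrals over rectangles in the w-plane, the
form to which Green's identity applies. -/
theorem tendsto_integral_exp (b : ℝ) {G : ℂ → ℝ} (hG : Integrable G) :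
    Tendsto (fun S : ℝ => ∫ s in (-S)..S, ∫ θ in b..(b + 2 * π),
      ‖Complex.exp (s + θ * Complex.I)‖ ^ 2 * G (Complex.exp (s + θ * Complex.I)))
      atTop (𝓝 (∫ z, G z)) := by
  set F : ℂ → ℝ := fun w => ‖Complex.exp w‖ ^ 2 * G (Complex.exp w) with hF
  have hint := integrableOn_periodStrip b hG
  have hmp := Complex.volume_preserving_equiv_real_prod.symm
  have hpre : Complex.measurableEquivRealProd.symm ⁻¹' (periodStrip b) =
      univ ×ˢ Ioc b (b + 2 * π) := by
    ext p
    simp [periodStrip, Complex.measurableEquivRealProd]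
  have hval : ∀ p : ℝ × ℝ, Complex.measurableEquivRealProd.symm p = p.1 + p.2 * Complex.I :=
    fun p => by
      apply Complex.ext <;> simp [Complex.measurableEquivRealProd]
  have hint2 : Integrable (fun p : ℝ × ℝ => F (p.1 + p.2 * Complex.I))
      ((volume : Measure ℝ).prod ((volume : Measure ℝ).restrict (Ioc b (b + 2 * π)))) := by
    have h := (hmp.integrableOn_comp_preimage
      Complex.measurableEquivRealProd.symm.measurableEmbedding (f := F) (s := periodStrip b)).2 hint
    rw [hpre, IntegrableOn, Measure.volume_eq_prod, ← Measure.prod_restrict,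
      Measure.restrict_univ] at h
    refine h.congr (Eventually.of_forall fun p => ?_)
    simp only [Function.comp, hval]
  have hG2 : ∫ z, G z = ∫ s : ℝ, ∫ θ in b..(b + 2 * π), F (s + θ * Complex.I) := by
    rw [integral_eq_integral_periodStrip b, ← hmp.setIntegral_preimage_emb
      Complex.measurableEquivRealProd.symm.measurableEmbedding, hpre, Measure.volume_eq_prod,
      ← Measure.prod_restrict, Measure.restrict_univ]
    simp only [hval]
    rw [integral_prod _ hint2]
    simp only [intervalIntegral.integral_of_le (by linarith [Real.pi_pos] : b ≤ b + 2 * π)]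
  rw [hG2]
  refine intervalIntegral_tendsto_integral ?_ tendsto_neg_atTop_atBot tendsto_id
  have h3 := hint2.integral_prod_left
  refine h3.congr (Eventually.of_forall fun s => ?_)
  simp only [intervalIntegral.integral_of_le (by linarith [Real.pi_pos] : b ≤ b + 2 * π)]
  rfl

/-! ### Integrability of the logarithm against a decaying weight -/

/-- The weight `(1 + |z|²)⁻²`. -/
noncomputable def decayWeight (z : ℂ) : ℝ := ((1 + ‖z‖ ^ 2) ^ 2)⁻¹

theorem decayWeight_nonneg (z : ℂ) : 0 ≤ decayWeight z := by unfold decayWeight; positivity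

theorem continuous_decayWeight : Continuous decayWeight := by
  unfold decayWeight
  exact Continuous.inv₀ (by fun_prop) fun z => by positivity

theorem decayWeight_le_one (z : ℂ) : decayWeight z ≤ 1 := by
  unfold decayWeight
  exact inv_le_one_of_one_le₀ (by nlinarith [sq_nonneg ‖z‖])

/-- The function is O(|z|⁻³), and 3 exceeds the real dimension 2. It serves as majorant whenever a
factor of at most linear growth meets the weight. -/
theorem integrable_one_add_norm_mul_decayWeight :
    Integrable fun z : ℂ => (1 + ‖z‖) * decayWeight z := by
  have h := (integrable_rpow_neg_one_add_norm_sq (E := ℂ) (μ := volume) (r := 3)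
    (by rw [Complex.finrank_real_complex]; norm_num)).const_mul 2
  refine h.mono' ((by fun_prop : Continuous fun z : ℂ => 1 + ‖z‖).mul
    continuous_decayWeight).aestronglyMeasurable (Eventually.of_forall fun z => ?_)
  rw [Real.norm_of_nonneg (mul_nonneg (by positivity) (decayWeight_nonneg z))]
  have hp : 0 < 1 + ‖z‖ ^ 2 := by positivity
  have e : (1 + ‖z‖ ^ 2) ^ (-(3:ℝ) / 2) = √(1 + ‖z‖ ^ 2) * decayWeight z := by
    rw [decayWeight, Real.sqrt_eq_rpow, ← Real.rpow_natCast (1 + ‖z‖ ^ 2) 2, ← Real.rpow_neg hp.le,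
      ← Real.rpow_add hp]
    norm_num
  rw [e, ← mul_assoc]
  refine mul_le_mul_of_nonneg_right ?_ (decayWeight_nonneg z)
  have h1 : ‖z‖ ≤ √(1 + ‖z‖ ^ 2) := Real.le_sqrt_of_sq_le (by linarith)
  have h2 : 1 ≤ √(1 + ‖z‖ ^ 2) := Real.one_le_sqrt.2 (by nlinarith [norm_nonneg z])
  linarith

theorem integrable_decayWeight : Integrable decayWeight := by
  refine integrable_one_add_norm_mul_decayWeight.mono' continuous_decayWeight.aestronglyMeasurable
    (Eventually.of_forall fun z => ?_)
  rw [Real.norm_of_nonneg (decayWeight_nonneg z)]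
  nlinarith [decayWeight_nonneg z, norm_nonneg z]

/-- In polar coordinates the Jacobian r cancels r⁻¹. This majorant absorbs the logarithmic
singularity. -/
theorem integrable_indicator_norm_inv :
    Integrable ((Metric.ball (0:ℂ) 1).indicator fun z => ‖z‖⁻¹) := by
  have h := (integrable_fun_norm_addHaar (E := ℂ) volume
    (f := (Iio (1:ℝ)).indicator fun r : ℝ => r⁻¹)).2 ?_
  · refine h.congr (Eventually.of_forall fun z => ?_)
    simp only [indicator, mem_Iio, mem_ball_zero_iff]
  · rw [Complex.finrank_real_complex]
    have : IntegrableOn ((Iio (1:ℝ)).indicator fun _ => (1:ℝ)) (Ioi 0) := by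
      rw [IntegrableOn, integrable_indicator_iff measurableSet_Iio, IntegrableOn,
        Measure.restrict_restrict measurableSet_Iio]
      refine integrableOn_const (by
        rw [Set.inter_comm, Ioi_inter_Iio]; simp)
    refine this.congr_fun (fun r hr => ?_) measurableSet_Ioi
    have : r ≠ 0 := (mem_Ioi.1 hr).ne'
    by_cases h : r < 1 <;> simp [indicator, h, this]

theorem abs_log_le_add_inv {r : ℝ} (hr : 0 ≤ r) : |Real.log r| ≤ r + r⁻¹ := by
  rcases hr.eq_or_lt with rfl | hr
  · simp
  · rw [abs_le]
    constructor
    · have := Real.log_le_sub_one_of_pos (inv_pos.2 hr)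
      rw [Real.log_inv] at this
      linarith
    · have := Real.log_le_sub_one_of_pos hr
      have := inv_pos.2 hr
      linarith

theorem abs_log_norm_mul_decayWeight_le (a z : ℂ) :
    |Real.log ‖z - a‖| * decayWeight z ≤ (1 + ‖a‖) * ((1 + ‖z‖) * decayWeight z) +
      (Metric.ball (0:ℂ) 1).indicator (fun z => ‖z‖⁻¹) (z - a) := by
  have h1 := abs_log_le_add_inv (norm_nonneg (z - a))
  have hw := decayWeight_nonneg z
  have hw1 := decayWeight_le_one z
  have h3 := norm_sub_le z a
  have hz := norm_nonneg z
  have ha := norm_nonneg a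
  by_cases h : z - a ∈ Metric.ball (0:ℂ) 1
  · rw [indicator_of_mem h]
    have hi : 0 ≤ ‖z - a‖⁻¹ := by positivity
    nlinarith [mul_nonneg ha hz, mul_nonneg (mul_nonneg ha hz) hw]
  · rw [indicator_of_notMem h]
    rw [mem_ball_zero_iff, not_lt] at h
    have : |Real.log ‖z - a‖| ≤ ‖z - a‖ := by
      rw [abs_of_nonneg (Real.log_nonneg h)]
      have := Real.log_le_sub_one_of_pos (by linarith : 0 < ‖z - a‖)
      linarith
    nlinarith [mul_nonneg ha hz, mul_nonneg (mul_nonneg ha hz) hw]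

theorem measurable_log_norm_sub (a : ℂ) : Measurable fun z : ℂ => Real.log ‖z - a‖ :=
  Real.measurable_log.comp (by fun_prop)

theorem integrable_abs_log_norm_mul_decayWeight (a : ℂ) :
    Integrable fun z : ℂ => |Real.log ‖z - a‖| * decayWeight z := by
  refine ((integrable_one_add_norm_mul_decayWeight.const_mul (1 + ‖a‖)).add
    (integrable_indicator_norm_inv.comp_sub_right a)).mono'
    (((measurable_log_norm_sub a).abs.mul continuous_decayWeight.measurable).aestronglyMeasurable)
    (Eventually.of_forall fun z => ?_)
  rw [Real.norm_of_nonneg (mul_nonneg (abs_nonneg _) (decayWeight_nonneg z))]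
  exact abs_log_norm_mul_decayWeight_le a z

theorem locallyIntegrable_log_norm_sub (a : ℂ) :
    LocallyIntegrable fun z : ℂ => Real.log ‖z - a‖ := by
  rw [locallyIntegrable_iff]
  intro K hK
  obtain ⟨C, hC⟩ := (hK.image (f := fun z => (1 + ‖z‖ ^ 2) ^ 2) (by fun_prop)).bddAbove
  refine ((integrable_abs_log_norm_mul_decayWeight a).const_mul C).integrableOn.mono'
    (measurable_log_norm_sub a).aestronglyMeasurable ?_
  filter_upwards [ae_restrict_mem hK.measurableSet] with z hz
  have h1 : (1 + ‖z‖ ^ 2) ^ 2 ≤ C := hC ⟨z, hz, rfl⟩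
  have h2 : 1 ≤ C * decayWeight z := by
    rw [decayWeight, ← div_eq_mul_inv, one_le_div (by positivity)]
    exact h1
  rw [Real.norm_eq_abs]
  nlinarith [abs_nonneg (Real.log ‖z - a‖)]

/-! ### Green's second identity on rectangles -/

theorem fderiv_fderiv_apply {f : ℂ → ℝ} {w : ℂ} (hf : ContDiffAt ℝ 2 f w) (v : ℂ) :
    fderiv ℝ (fun z => fderiv ℝ f z v) w v = fderiv ℝ (fderiv ℝ f) w v v := by
  have h : DifferentiableAt ℝ (fderiv ℝ f) w :=
    (hf.fderiv_right (m := 1) (by norm_num)).differentiableAt (by norm_num)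
  rw [fderiv_clm_apply h (differentiableAt_const v)]
  simp

theorem laplacian_eq_fderiv (f : ℂ → ℝ) (w : ℂ) :
    Laplacian.laplacian f w =
      fderiv ℝ (fderiv ℝ f) w 1 1 + fderiv ℝ (fderiv ℝ f) w Complex.I Complex.I := by
  rw [InnerProductSpace.laplacian_eq_iteratedFDeriv_complexPlane]
  simp [iteratedFDeriv_two_apply]

/-- The directional part `V ∂ᵥΦ - Φ ∂ᵥV` of the Green vector field. -/
noncomputable def greenField (V Φ : ℂ → ℝ) (v w : ℂ) : ℝ :=
  V w * fderiv ℝ Φ w v - Φ w * fderiv ℝ V w v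

theorem contDiffAt_greenField {V Φ : ℂ → ℝ} {w : ℂ} (hV : ContDiffAt ℝ 2 V w)
    (hΦ : ContDiffAt ℝ 2 Φ w) (v : ℂ) : ContDiffAt ℝ 1 (greenField V Φ v) w := by
  have h1 : ContDiffAt ℝ 1 (fderiv ℝ V) w := hV.fderiv_right (by norm_num)
  have h2 : ContDiffAt ℝ 1 (fderiv ℝ Φ) w := hΦ.fderiv_right (by norm_num)
  exact ((hV.of_le (by norm_num)).mul (h2.clm_apply contDiffAt_const)).sub
    ((hΦ.of_le (by norm_num)).mul (h1.clm_apply contDiffAt_const))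

/-- The products of first derivatives cancel, so summing over the directions 1 and I leaves V ΔΦ - Φ
ΔV. -/
theorem fderiv_greenField {V Φ : ℂ → ℝ} {w : ℂ} (hV : ContDiffAt ℝ 2 V w)
    (hΦ : ContDiffAt ℝ 2 Φ w) (v : ℂ) :
    fderiv ℝ (greenField V Φ v) w v =
      V w * fderiv ℝ (fderiv ℝ Φ) w v v - Φ w * fderiv ℝ (fderiv ℝ V) w v v := by
  have h1 : ContDiffAt ℝ 1 (fderiv ℝ V) w := hV.fderiv_right (by norm_num)
  have h2 : ContDiffAt ℝ 1 (fderiv ℝ Φ) w := hΦ.fderiv_right (by norm_num)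
  have d1 : DifferentiableAt ℝ (fun z => fderiv ℝ V z v) w :=
    (h1.clm_apply contDiffAt_const).differentiableAt (by norm_num)
  have d2 : DifferentiableAt ℝ (fun z => fderiv ℝ Φ z v) w :=
    (h2.clm_apply contDiffAt_const).differentiableAt (by norm_num)
  have e1 : DifferentiableAt ℝ V w := hV.differentiableAt (by norm_num)
  have e2 : DifferentiableAt ℝ Φ w := hΦ.differentiableAt (by norm_num)
  unfold greenField
  rw [fderiv_fun_sub (e1.fun_mul d2) (e2.fun_mul d1), fderiv_fun_mul e1 d2, fderiv_fun_mul e2 d1]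
  simp only [sub_apply, add_apply,
    smul_apply, smul_eq_mul, fderiv_fderiv_apply hV, fderiv_fderiv_apply hΦ]
  ring

/-- The divergence theorem for the field with components `greenField V Φ 1` and `greenField V Φ
Complex.I`. -/
theorem green_rectangle {V Φ : ℂ → ℝ} {x₁ x₂ y₁ y₂ : ℝ}
    (hV : ∀ x ∈ uIcc x₁ x₂, ∀ y ∈ uIcc y₁ y₂, ContDiffAt ℝ 2 V (x + y * Complex.I))
    (hΦ : ∀ x ∈ uIcc x₁ x₂, ∀ y ∈ uIcc y₁ y₂, ContDiffAt ℝ 2 Φ (x + y * Complex.I)) :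
    ∫ x in x₁..x₂, ∫ y in y₁..y₂,
      (V (x + y * Complex.I) * Laplacian.laplacian Φ (x + y * Complex.I) -
        Φ (x + y * Complex.I) * Laplacian.laplacian V (x + y * Complex.I)) =
      (∫ x in x₁..x₂, greenField V Φ Complex.I (x + y₂ * Complex.I)) -
      (∫ x in x₁..x₂, greenField V Φ Complex.I (x + y₁ * Complex.I)) +
      (∫ y in y₁..y₂, greenField V Φ 1 (x₂ + y * Complex.I)) -
      ∫ y in y₁..y₂, greenField V Φ 1 (x₁ + y * Complex.I) := by
  set L : ℝ × ℝ →L[ℝ] ℂ := (Complex.equivRealProdCLM.symm : ℝ × ℝ →L[ℝ] ℂ) with hL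
  have hLv : ∀ p : ℝ × ℝ, L p = p.1 + p.2 * Complex.I := fun p => by
    apply Complex.ext <;> simp [hL]
  have hcd : ∀ v : ℂ, ∀ p ∈ uIcc x₁ x₂ ×ˢ uIcc y₁ y₂, ContDiffAt ℝ 1 (greenField V Φ v) (L p) :=
    fun v p hp => by
      rw [hLv]
      exact contDiffAt_greenField (hV _ hp.1 _ hp.2) (hΦ _ hp.1 _ hp.2) v
  have hcont : ∀ v : ℂ, ContinuousOn (fun p => greenField V Φ v (L p))
      (uIcc x₁ x₂ ×ˢ uIcc y₁ y₂) := fun v p hp =>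
    (ContinuousAt.comp (hcd v p hp).continuousAt L.continuous.continuousAt).continuousWithinAt
  have hder : ∀ v : ℂ, ∀ p ∈ uIcc x₁ x₂ ×ˢ uIcc y₁ y₂,
      HasFDerivAt (fun p => greenField V Φ v (L p)) ((fderiv ℝ (greenField V Φ v) (L p)).comp L) p :=
    fun v p hp =>
      ((hcd v p hp).differentiableAt (by norm_num)).hasFDerivAt.comp p L.hasFDerivAt
  have hsub : Ioo (min x₁ x₂) (max x₁ x₂) ×ˢ Ioo (min y₁ y₂) (max y₁ y₂) ⊆
      uIcc x₁ x₂ ×ˢ uIcc y₁ y₂ := prod_mono Ioo_subset_Icc_self Ioo_subset_Icc_self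
  have hL1 : L (1, 0) = 1 := by rw [hLv]; simp
  have hL2 : L (0, 1) = Complex.I := by rw [hLv]; simp
  have hdc : ∀ v : ℂ, ContinuousOn (fun p => fderiv ℝ (greenField V Φ v) (L p) v)
      (uIcc x₁ x₂ ×ˢ uIcc y₁ y₂) := fun v p hp => by
    have h : ContDiffAt ℝ 0 (fderiv ℝ (greenField V Φ v)) (L p) :=
      (hcd v p hp).fderiv_right (by norm_num)
    have h2 : ContinuousAt (fun p => fderiv ℝ (greenField V Φ v) (L p)) p :=
      ContinuousAt.comp h.continuousAt L.continuous.continuousAt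
    exact (h2.clm_apply continuousAt_const).continuousWithinAt
  have key := integral2_divergence_prod_of_hasFDerivAt_off_countable
    (fun p => greenField V Φ 1 (L p)) (fun p => greenField V Φ Complex.I (L p))
    (fun p => (fderiv ℝ (greenField V Φ 1) (L p)).comp L)
    (fun p => (fderiv ℝ (greenField V Φ Complex.I) (L p)).comp L) x₁ y₁ x₂ y₂ ∅ countable_empty
    (hcont 1) (hcont Complex.I) (fun p hp => hder 1 p (hsub hp.1))
    (fun p hp => hder Complex.I p (hsub hp.1)) (by
      simp only [ContinuousLinearMap.comp_apply, hL1, hL2]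
      exact ((hdc 1).add (hdc Complex.I)).integrableOn_compact
        (isCompact_uIcc.prod isCompact_uIcc))
  simp only [ContinuousLinearMap.comp_apply, hL1, hL2, hLv] at key
  rw [← key]
  refine intervalIntegral.integral_congr fun x hx => intervalIntegral.integral_congr fun y hy => ?_
  rw [fderiv_greenField (hV x hx y hy) (hΦ x hx y hy),
    fderiv_greenField (hV x hx y hy) (hΦ x hx y hy), laplacian_eq_fderiv, laplacian_eq_fderiv]
  ring

/-! ### Composition with the exponential function -/

theorem hasFDerivAt_comp_exp {φ : ℂ → ℝ} {w : ℂ} (hφ : DifferentiableAt ℝ φ (Complex.exp w)) (v : ℂ) :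
    fderiv ℝ (fun w => φ (Complex.exp w)) w v = fderiv ℝ φ (Complex.exp w) (Complex.exp w * v) := by
  have h := (Complex.hasDerivAt_exp w).hasFDerivAt.restrictScalars ℝ
  have := (hφ.hasFDerivAt.comp w h).fderiv
  change fderiv ℝ (φ ∘ Complex.exp) w v = _
  rw [this]
  simp [mul_comm]

theorem contDiff_exp_real {n : WithTop ℕ∞} : ContDiff ℝ n Complex.exp :=
  Complex.contDiff_exp

theorem fderiv_fderiv_comp_exp {φ : ℂ → ℝ} (hφ : ContDiff ℝ 2 φ) (w v : ℂ) :
    fderiv ℝ (fderiv ℝ (fun w => φ (Complex.exp w))) w v v =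
      fderiv ℝ (fderiv ℝ φ) (Complex.exp w) (Complex.exp w * v) (Complex.exp w * v) +
        fderiv ℝ φ (Complex.exp w) (Complex.exp w * v * v) := by
  have hΦ : ContDiff ℝ 2 fun w => φ (Complex.exp w) := hφ.comp contDiff_exp_real
  have hd : Differentiable ℝ φ := hφ.differentiable (by norm_num)
  have hd2 : Differentiable ℝ (fderiv ℝ φ) :=
    (hφ.fderiv_right (m := 1) (by norm_num)).differentiable (by norm_num)
  rw [← fderiv_fderiv_apply hΦ.contDiffAt]
  have e : (fun z => fderiv ℝ (fun w => φ (Complex.exp w)) z v) =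
      fun z => fderiv ℝ φ (Complex.exp z) (Complex.exp z * v) :=
    funext fun z => hasFDerivAt_comp_exp (hd _) v
  have hexp := (Complex.hasDerivAt_exp w).hasFDerivAt.restrictScalars ℝ
  have h1 : HasFDerivAt (fun z => fderiv ℝ φ (Complex.exp z)) _ w :=
    ((hd2 (Complex.exp w)).hasFDerivAt).comp w hexp
  have h2 := hexp.mul_const' v
  rw [e, (h1.clm_apply h2).fderiv]
  simp [mul_comm]
  ring

/-- Conformality of exp: the first-order terms cancel because e^w·1·1 + e^w·I·I = 0, and the Hessian
is evaluated on the orthogonal vectors e^w and e^w I, both of length |e^w|. -/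
theorem laplacian_comp_exp {φ : ℂ → ℝ} (hφ : ContDiff ℝ 2 φ) (w : ℂ) :
    Laplacian.laplacian (fun w => φ (Complex.exp w)) w =
      ‖Complex.exp w‖ ^ 2 * Laplacian.laplacian φ (Complex.exp w) := by
  rw [laplacian_eq_fderiv, laplacian_eq_fderiv, fderiv_fderiv_comp_exp hφ,
    fderiv_fderiv_comp_exp hφ]
  set z := Complex.exp w
  set B := fderiv ℝ (fderiv ℝ φ) z
  set D := fderiv ℝ φ z
  have hz : z = z.re • (1:ℂ) + z.im • Complex.I := by simp
  have hzI : z * Complex.I = (-z.im) • (1:ℂ) + z.re • Complex.I := by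
    apply Complex.ext <;> simp
  have hD : D (z * Complex.I * Complex.I) = - D z := by
    rw [mul_assoc, Complex.I_mul_I, mul_neg_one, map_neg]
  rw [hD, mul_one, mul_one, hzI, ← Complex.normSq_eq_norm_sq, Complex.normSq_apply]
  have hBz : B z z = B (z.re • (1:ℂ) + z.im • Complex.I) (z.re • (1:ℂ) + z.im • Complex.I) := by
    rw [← hz]
  rw [hBz]
  simp only [map_add, map_smul, add_apply, smul_apply,
    smul_eq_mul]
  ring

/-! ### Logarithms of moduli of holomorphic functions -/

theorem fderiv_log_norm {f : ℂ → ℂ} {w : ℂ} (hf : DifferentiableAt ℂ f w) (h : f w ≠ 0) (v : ℂ) :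
    fderiv ℝ (fun z => Real.log ‖f z‖) w v = (deriv f w * v / f w).re := by
  have h1 : HasFDerivAt f _ w := hf.hasDerivAt.hasFDerivAt.restrictScalars ℝ
  have hne : ‖f w‖ ^ 2 ≠ 0 := by positivity
  have h2 := (h1.norm_sq.log hne).const_mul (1 / 2 : ℝ)
  have e : (fun z => Real.log ‖f z‖) = fun z => 1 / 2 * Real.log (‖f z‖ ^ 2) := by
    funext z
    rw [Real.log_pow]; push_cast; ring
  rw [e, h2.fderiv]
  simp only [Complex.div_re, smul_apply, ContinuousLinearMap.comp_apply, smul_eq_mul,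
    innerSL_apply_apply, Complex.inner, Complex.normSq_eq_norm_sq]
  simp
  field_simp
  ring

theorem norm_fderiv_log_norm_le {f : ℂ → ℂ} {w : ℂ} (hf : DifferentiableAt ℂ f w) (h : f w ≠ 0) :
    |fderiv ℝ (fun z => Real.log ‖f z‖) w 1| ≤ ‖deriv f w / f w‖ := by
  rw [fderiv_log_norm hf h, mul_one]
  exact Complex.abs_re_le_norm _

/-- Division of an entire function by two simple zeros. -/
theorem exists_eq_mul_of_simple_zeros {f : ℂ → ℂ} (hf : Differentiable ℂ f) {p q : ℂ} (hpq : p ≠ q)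
    (hp : f p = 0) (hq : f q = 0) (hp' : deriv f p ≠ 0) (hq' : deriv f q ≠ 0) :
    ∃ g : ℂ → ℂ, Differentiable ℂ g ∧ (∀ w, f w = (w - p) * (w - q) * g w) ∧ g p ≠ 0 ∧ g q ≠ 0 := by
  have hds : ∀ {f : ℂ → ℂ} (c : ℂ), Differentiable ℂ f → Differentiable ℂ (dslope f c) :=
    fun c hf => differentiableOn_univ.1
      ((Complex.differentiableOn_dslope univ_mem).2 hf.differentiableOn)
  have h1 := hds p hf
  have e1 : ∀ w, f w = (w - p) * dslope f p w := fun w => by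
    have := sub_smul_dslope f p w
    rw [hp, sub_zero, smul_eq_mul] at this
    exact this.symm
  have hq1 : dslope f p q = 0 := by
    have := e1 q
    rw [hq] at this
    exact (mul_eq_zero.1 this.symm).resolve_left (sub_ne_zero.2 hpq.symm)
  have h2 := hds q h1
  have e2 : ∀ w, dslope f p w = (w - q) * dslope (dslope f p) q w := fun w => by
    have := sub_smul_dslope (dslope f p) q w
    rw [hq1, sub_zero, smul_eq_mul] at this
    exact this.symm
  have e : ∀ w, f w = (w - p) * (w - q) * dslope (dslope f p) q w := fun w => by
    rw [e1, e2]; ring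
  have hd : ∀ w, HasDerivAt f ((1 * (w - q) + (w - p) * 1) * dslope (dslope f p) q w +
      (w - p) * (w - q) * deriv (dslope (dslope f p) q) w) w := fun w => by
    have := ((((hasDerivAt_id w).sub_const p).mul ((hasDerivAt_id w).sub_const q)).mul
      (h2 w).hasDerivAt)
    refine this.congr_of_eventuallyEq (Eventually.of_forall fun z => ?_)
    simp [e z]
  refine ⟨_, h2, e, fun h0 => hp' ?_, fun h0 => hq' ?_⟩
  · rw [(hd p).deriv, h0]; ring
  · rw [(hd q).deriv, h0]; ring

/-- Once |t| ≥ 1, the distance from c to the unit circle is comparable to max(1, e^t) within a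
factor 2. It is applied with c = e^w and b = e^{±iα}, and with c = e^{kw} and b = -1, to control the
vertical edges of the rectangles. -/
theorem norm_sub_unit_bounds {c b : ℂ} {t : ℝ} (hc : ‖c‖ = Real.exp t) (hb : ‖b‖ = 1)
    (ht : 1 ≤ |t|) :
    |Real.log ‖c - b‖| ≤ 1 + max t 0 ∧ c - b ≠ 0 ∧ ‖c / (c - b)‖ ≤ 2 * min 1 (Real.exp t) := by
  have hup : ‖c - b‖ ≤ Real.exp t + 1 := by
    have := norm_sub_le c b; rwa [hc, hb] at this
  have hlow : |Real.exp t - 1| ≤ ‖c - b‖ := by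
    have := abs_norm_sub_norm_le c b; rwa [hc, hb] at this
  have he1 : Real.exp (-1) < 0.3678794412 := Real.exp_neg_one_lt_d9
  have he2 : 2.7182818283 < Real.exp 1 := Real.exp_one_gt_d9
  have hl2 := Real.log_two_lt_d9
  have hhalf : (1/2 : ℝ) ≤ ‖c - b‖ ∧ Real.exp t ≤ 2 * ‖c - b‖ ∧
      ‖c - b‖ ≤ 2 * Real.exp (max t 0) ∧ 1 ≤ 2 * ‖c - b‖ := by
    rcases le_abs.1 ht with h | h
    · have h3 : Real.exp 1 ≤ Real.exp t := Real.exp_le_exp.2 h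
      rw [abs_of_nonneg (by linarith)] at hlow
      rw [max_eq_left (by linarith)]
      refine ⟨by linarith, by linarith, by linarith, by linarith⟩
    · have h3 : Real.exp t ≤ Real.exp (-1) := Real.exp_le_exp.2 (by linarith)
      have h4 := Real.exp_pos t
      rw [abs_of_nonpos (by linarith)] at hlow
      rw [max_eq_right (by linarith), Real.exp_zero]
      refine ⟨by linarith, by linarith, by linarith, by linarith⟩
  obtain ⟨h1, h2, h3, h4⟩ := hhalf
  have hpos : 0 < ‖c - b‖ := by linarith
  refine ⟨?_, norm_pos_iff.1 hpos, ?_⟩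
  · rw [abs_le]
    constructor
    · have := Real.log_le_log (by norm_num) h1
      rw [one_div, Real.log_inv] at this
      have := le_max_right t 0
      linarith
    · have := Real.log_le_log hpos h3
      rw [Real.log_mul (by norm_num) (Real.exp_pos _).ne', Real.log_exp] at this
      linarith
  · rw [norm_div, hc, div_le_iff₀ hpos]
    have := Real.exp_pos t
    rcases min_cases 1 (Real.exp t) with h | h <;> rw [h.1] <;> nlinarith

/-! ### Decaying test functions -/

/-- Test functions with enough decay at infinity for Green's identity on the plane. -/
structure IsDecayingTest (φ : ℂ → ℝ) : Prop where
  contDiff : ContDiff ℝ 2 φ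
  decay : ∃ C, ∀ z : ℂ, 1 ≤ ‖z‖ → |φ z| ≤ C / ‖z‖
  decay_fderiv : ∃ C, ∀ z : ℂ, 1 ≤ ‖z‖ → ‖fderiv ℝ φ z‖ ≤ C / ‖z‖ ^ 2
  decay_laplacian : ∃ C, ∀ z : ℂ, |Laplacian.laplacian φ z| ≤ C * decayWeight z

theorem IsDecayingTest.bounds {φ : ℂ → ℝ} (hφ : IsDecayingTest φ) :
    ∃ M, 0 ≤ M ∧ (∀ z, |φ z| ≤ M ∧ ‖fderiv ℝ φ z‖ ≤ M) ∧
      ∀ z, 1 ≤ ‖z‖ → |φ z| ≤ M / ‖z‖ ∧ ‖fderiv ℝ φ z‖ ≤ M / ‖z‖ ^ 2 := by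
  obtain ⟨C1, h1⟩ := hφ.decay
  obtain ⟨C2, h2⟩ := hφ.decay_fderiv
  obtain ⟨C3, h3⟩ := (isCompact_closedBall (0:ℂ) 1).exists_bound_of_continuousOn
    hφ.contDiff.continuous.continuousOn
  obtain ⟨C4, h4⟩ := (isCompact_closedBall (0:ℂ) 1).exists_bound_of_continuousOn
    (hφ.contDiff.continuous_fderiv (by norm_num)).continuousOn
  set M := |C1| + |C2| + |C3| + |C4| with hM
  have a1 := abs_nonneg C1
  have a2 := abs_nonneg C2
  have a3 := abs_nonneg C3
  have a4 := abs_nonneg C4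
  have hM0 : 0 ≤ M := by positivity
  have hb : ∀ z, 1 ≤ ‖z‖ → |φ z| ≤ M / ‖z‖ ∧ ‖fderiv ℝ φ z‖ ≤ M / ‖z‖ ^ 2 := fun z hz => by
    have hz0 : 0 < ‖z‖ := by linarith
    refine ⟨(h1 z hz).trans ?_, (h2 z hz).trans ?_⟩
    · have : C1 ≤ M := by linarith [le_abs_self C1]
      gcongr
    · have : C2 ≤ M := by linarith [le_abs_self C2]
      gcongr
  refine ⟨M, hM0, fun z => ?_, hb⟩
  rcases le_or_gt 1 ‖z‖ with h | h
  · obtain ⟨b1, b2⟩ := hb z h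
    refine ⟨b1.trans (div_le_self hM0 h), b2.trans (div_le_self hM0 (one_le_pow₀ h))⟩
  · have hz : z ∈ Metric.closedBall (0:ℂ) 1 := by simpa using h.le
    have b3 := h3 z hz
    have b4 := h4 z hz
    rw [Real.norm_eq_abs] at b3
    exact ⟨b3.trans (by linarith [le_abs_self C3]), b4.trans (by linarith [le_abs_self C4])⟩

/-- On the right edge the decay of φ and its derivative gives e^{-S} against the linear growth of V.
On the left edge φ is merely bounded, and the factor e^{-S} comes from the chain rule for φ ∘ exp
and from the assumed decay of ∂V. -/
theorem IsDecayingTest.exists_greenField_bound {φ : ℂ → ℝ} (hφ : IsDecayingTest φ) (K : ℝ)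
    (hK : 0 ≤ K) : ∃ A, ∀ (V : ℂ → ℝ) (w : ℂ) (S : ℝ), 1 ≤ S → |w.re| = S →
      |V w| ≤ K * (1 + max w.re 0) → |fderiv ℝ V w 1| ≤ K * min 1 (Real.exp w.re) →
      |greenField V (fun w => φ (Complex.exp w)) 1 w| ≤ A * ((1 + S) * Real.exp (-S)) := by
  obtain ⟨M, hM, hb1, hb2⟩ := hφ.bounds
  refine ⟨2 * K * M, fun V w S hS hw hV hdV => ?_⟩
  have hd : fderiv ℝ (fun w => φ (Complex.exp w)) w 1 = fderiv ℝ φ (Complex.exp w) (Complex.exp w) := by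
    rw [hasFDerivAt_comp_exp (hφ.contDiff.differentiable (by norm_num) _), mul_one]
  have hn : ‖Complex.exp w‖ = Real.exp w.re := Complex.norm_exp w
  have hle : |fderiv ℝ φ (Complex.exp w) (Complex.exp w)| ≤
      ‖fderiv ℝ φ (Complex.exp w)‖ * Real.exp w.re := by
    rw [← hn, ← Real.norm_eq_abs]; exact ContinuousLinearMap.le_opNorm _ _
  have hE := Real.exp_pos (-S)
  have hEx := Real.exp_pos w.re
  have key : |fderiv ℝ φ (Complex.exp w) (Complex.exp w)| * (1 + max w.re 0) ≤
        M * ((1 + S) * Real.exp (-S)) ∧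
      |φ (Complex.exp w)| * min 1 (Real.exp w.re) ≤ M * Real.exp (-S) := by
    rcases abs_choice w.re with h | h
    · have hr : w.re = S := by rw [← h, hw]
      have h1 : 1 ≤ ‖Complex.exp w‖ := by rw [hn]; exact Real.one_le_exp (by linarith)
      obtain ⟨c1, c2⟩ := hb2 _ h1
      rw [hn, hr] at c1 c2
      rw [hr] at hle hEx ⊢
      have hinv : Real.exp (-S) = (Real.exp S)⁻¹ := Real.exp_neg S
      rw [max_eq_left (by linarith), hinv]
      constructor
      · have : |fderiv ℝ φ (Complex.exp w) (Complex.exp w)| ≤ M * (Real.exp S)⁻¹ := by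
          refine hle.trans ((mul_le_mul_of_nonneg_right c2 hEx.le).trans_eq ?_)
          field_simp
        calc _ ≤ M * (Real.exp S)⁻¹ * (1 + S) := by gcongr
          _ = _ := by ring
      · calc _ ≤ |φ (Complex.exp w)| * 1 := by gcongr; exact min_le_left _ _
          _ ≤ _ := by rw [mul_one, ← div_eq_mul_inv]; exact c1
    · have hr : w.re = -S := by linarith
      obtain ⟨c1, c2⟩ := hb1 (Complex.exp w)
      rw [hr] at hle ⊢
      rw [max_eq_right (by linarith), add_zero, mul_one]
      constructor
      · refine hle.trans ((mul_le_mul_of_nonneg_right c2 hE.le).trans ?_)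
        gcongr
        nlinarith
      · calc _ ≤ |φ (Complex.exp w)| * Real.exp (-S) := by gcongr; exact min_le_right _ _
          _ ≤ _ := by gcongr
  rw [greenField, hd]
  refine (abs_sub _ _).trans ?_
  rw [abs_mul, abs_mul]
  have k1 : |V w| * |fderiv ℝ φ (Complex.exp w) (Complex.exp w)| ≤
      K * (M * ((1 + S) * Real.exp (-S))) := by
    calc _ ≤ K * (1 + max w.re 0) * |fderiv ℝ φ (Complex.exp w) (Complex.exp w)| := by gcongr
      _ = K * (|fderiv ℝ φ (Complex.exp w) (Complex.exp w)| * (1 + max w.re 0)) := by ring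
      _ ≤ _ := mul_le_mul_of_nonneg_left key.1 hK
  have k2 : |φ (Complex.exp w)| * |fderiv ℝ V w 1| ≤ K * (M * Real.exp (-S)) := by
    calc _ ≤ |φ (Complex.exp w)| * (K * min 1 (Real.exp w.re)) := by gcongr
      _ = K * (|φ (Complex.exp w)| * min 1 (Real.exp w.re)) := by ring
      _ ≤ _ := mul_le_mul_of_nonneg_left key.2 hK
  have : K * (M * Real.exp (-S)) ≤ K * (M * ((1 + S) * Real.exp (-S))) := by
    gcongr; nlinarith
  linarith

theorem tendsto_one_add_mul_exp_neg :
    Tendsto (fun S : ℝ => (1 + S) * Real.exp (-S)) atTop (𝓝 0) := by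
  have h1 := Real.tendsto_pow_mul_exp_neg_atTop_nhds_zero 1
  have h0 := Real.tendsto_pow_mul_exp_neg_atTop_nhds_zero 0
  have := h0.add h1
  simp only [pow_zero, pow_one, add_zero] at this
  refine this.congr fun S => by ring

/-! ### The regular part of the sector function -/

/-- `sectorFun α` with its two logarithmic poles subtracted. -/
noncomputable def regularPart (α : ℝ) (z : ℂ) : ℝ :=
  Real.log (sectorNorm α z) - Real.log ‖z - Complex.exp (α * Complex.I)‖ -
    Real.log ‖z - Complex.exp (-(α * Complex.I))‖

/-- The function `1 + e^{πw/α}`. -/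
noncomputable def sectorExp (α : ℝ) (w : ℂ) : ℂ := 1 + Complex.exp ((π / α : ℝ) * w)

/-- The function `(e^w - e^{iα}) (e^w - e^{-iα})`. -/
noncomputable def poleExp (α : ℝ) (w : ℂ) : ℂ :=
  (Complex.exp w - Complex.exp (α * Complex.I)) * (Complex.exp w - Complex.exp (-(α * Complex.I)))

theorem differentiable_sectorExp (α : ℝ) : Differentiable ℂ (sectorExp α) := by
  unfold sectorExp; fun_prop

theorem differentiable_poleExp (α : ℝ) : Differentiable ℂ (poleExp α) := by
  unfold poleExp; fun_prop

theorem deriv_sectorExp (α : ℝ) (w : ℂ) :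
    deriv (sectorExp α) w = (π / α : ℝ) * Complex.exp ((π / α : ℝ) * w) := by
  have h : HasDerivAt (fun w : ℂ => ((π / α : ℝ) : ℂ) * w) ((π / α : ℝ) : ℂ) w := by
    simpa using (hasDerivAt_id w).const_mul ((π / α : ℝ) : ℂ)
  have := (h.cexp.const_add 1).deriv
  change deriv (fun w => 1 + Complex.exp ((π / α : ℝ) * w)) w = _
  rw [this]; ring

theorem deriv_poleExp (α : ℝ) (w : ℂ) :
    deriv (poleExp α) w = Complex.exp w * (Complex.exp w - Complex.exp (-(α * Complex.I))) +
      (Complex.exp w - Complex.exp (α * Complex.I)) * Complex.exp w := by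
  have h := ((Complex.hasDerivAt_exp w).sub_const (Complex.exp (α * Complex.I))).mul
    ((Complex.hasDerivAt_exp w).sub_const (Complex.exp (-(α * Complex.I))))
  exact h.deriv

theorem norm_exp_neg_mul_I (α : ℝ) : ‖Complex.exp (-(α * Complex.I))‖ = 1 := by
  have := Complex.norm_exp_ofReal_mul_I (-α)
  rwa [Complex.ofReal_neg, neg_mul] at this

theorem exp_eq_exp_mul_I_iff {α : ℝ} (hα : α ∈ Ioo 0 (π / 2)) {w : ℂ} (hw : |w.im| ≤ 2 * α)
    {β : ℝ} (hβ : |β| ≤ α) :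
    Complex.exp w = Complex.exp (β * Complex.I) ↔ w = β * Complex.I := by
  refine ⟨fun h => ?_, fun h => by rw [h]⟩
  have h1 := abs_le.1 hw
  have h2 := abs_le.1 hβ
  have h3 := hα.1
  have h4 := hα.2
  refine Complex.exp_inj_of_neg_pi_lt_of_le_pi ?_ ?_ ?_ ?_ h <;> (try simp) <;> linarith

theorem poleExp_eq_zero_iff {α : ℝ} (hα : α ∈ Ioo 0 (π / 2)) {w : ℂ} (hw : |w.im| ≤ 2 * α) :
    poleExp α w = 0 ↔ w = α * Complex.I ∨ w = -(α * Complex.I) := by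
  have h1 := exp_eq_exp_mul_I_iff hα hw (β := α) (abs_of_pos hα.1).le
  have h2 := exp_eq_exp_mul_I_iff hα hw (β := -α) (by rw [abs_neg]; exact (abs_of_pos hα.1).le)
  rw [Complex.ofReal_neg, neg_mul] at h2
  rw [poleExp, mul_eq_zero, sub_eq_zero, sub_eq_zero, h1, h2]

theorem poleExp_ne_zero_of_outer {α : ℝ} (hα : α ∈ Ioo 0 (π / 2)) {w : ℂ}
    (hw : w.im ∈ Icc (2 * α) (2 * π - 2 * α)) : poleExp α w ≠ 0 := by
  have h3 := hα.1
  have h4 := hα.2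
  have h1 := hw.1
  have h2 := hw.2
  have aux : ∀ β : ℝ, |β| ≤ α → Complex.exp w ≠ Complex.exp (β * Complex.I) := fun β hβ h => by
    have hβ' := abs_le.1 hβ
    have := @injOn_exp_periodStrip (-(2 * α)) w
      ⟨by linarith, by linarith⟩ (β * Complex.I)
      ⟨by simp; linarith, by simp; linarith⟩ h
    rw [this] at h1
    simp at h1
    linarith
  rw [poleExp]
  refine mul_ne_zero (sub_ne_zero.2 (aux α (abs_of_pos hα.1).le)) (sub_ne_zero.2 ?_)
  have := aux (-α) (by rw [abs_neg]; exact (abs_of_pos hα.1).le)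
  rwa [Complex.ofReal_neg, neg_mul] at this

theorem sectorExp_zero {α : ℝ} (hα : 0 < α) : sectorExp α (α * Complex.I) = 0 ∧
    sectorExp α (-(α * Complex.I)) = 0 := by
  have hα' : (α : ℂ) ≠ 0 := by exact_mod_cast hα.ne'
  have h : ((π / α : ℝ) : ℂ) * (α * Complex.I) = π * Complex.I := by
    push_cast; field_simp
  constructor
  · rw [sectorExp, h, Complex.exp_pi_mul_I]; ring
  · rw [sectorExp, mul_neg, h, Complex.exp_neg, Complex.exp_pi_mul_I]; norm_num

/-- In the inner strip `sectorExp` and `poleExp` have the same (simple) zeros. -/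
theorem sectorExp_eq_zero_imp {α : ℝ} (hα : α ∈ Ioo 0 (π / 2)) {w : ℂ} (hw : |w.im| ≤ 2 * α)
    (h : sectorExp α w = 0) : w = α * Complex.I ∨ w = -(α * Complex.I) := by
  have h0 := hα.1
  have hpi := Real.pi_pos
  have h1 : Complex.exp ((π / α : ℝ) * w) = Complex.exp (π * Complex.I) := by
    rw [Complex.exp_pi_mul_I]; rw [sectorExp] at h; linear_combination h
  obtain ⟨n, hn⟩ := Complex.exp_eq_exp_iff_exists_int.1 h1
  have hα' : (α : ℂ) ≠ 0 := by exact_mod_cast h0.ne'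
  have hpi' : (π : ℂ) ≠ 0 := by exact_mod_cast hpi.ne'
  have hw' : w = ((2 * n + 1 : ℝ) * α : ℝ) * Complex.I := by
    push_cast at hn ⊢
    field_simp at hn
    linear_combination hn
  have him : w.im = (2 * n + 1) * α := by rw [hw']; simp
  rw [him, abs_mul, abs_of_pos h0] at hw
  have hn2 : |(2 * n + 1 : ℝ)| ≤ 2 := le_of_mul_le_mul_right hw h0
  obtain ⟨b1, b2⟩ := abs_le.1 hn2
  have c1 : -2 ≤ 2 * n + 1 := by exact_mod_cast b1
  have c2 : 2 * n + 1 ≤ 2 := by exact_mod_cast b2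
  have : n = 0 ∨ n = -1 := by omega
  rcases this with rfl | rfl
  · left; rw [hw']; push_cast; ring
  · right; rw [hw']; push_cast; ring

/-- The regular part extends harmonically to the closed inner strip. -/
theorem exists_harmonic_extension {α : ℝ} (hα : α ∈ Ioo 0 (π / 2)) :
    ∃ V : ℂ → ℝ, (∀ w, |w.im| ≤ 2 * α → InnerProductSpace.HarmonicAt V w) ∧
      ∀ w, w ≠ α * Complex.I → w ≠ -(α * Complex.I) →
        sectorExp α w ≠ 0 → poleExp α w ≠ 0 →
        V w = Real.log ‖sectorExp α w‖ - Real.log ‖poleExp α w‖ := by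
  have h0 := hα.1
  have hα' : (α : ℂ) ≠ 0 := by exact_mod_cast h0.ne'
  have hpi' : (π : ℂ) ≠ 0 := by exact_mod_cast Real.pi_ne_zero
  have hpq : (α : ℂ) * Complex.I ≠ -(α * Complex.I) := by
    intro h
    have := congrArg Complex.im h
    simp at this
    linarith
  have hexp : Complex.exp (α * Complex.I) ≠ Complex.exp (-(α * Complex.I)) := fun h => hpq <| by
    have := (exp_eq_exp_mul_I_iff hα (w := α * Complex.I) (β := -α) (by
      simp [abs_of_pos h0]; linarith) (by rw [abs_neg]; exact (abs_of_pos h0).le)).1 (by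
      rw [Complex.ofReal_neg, neg_mul]; exact h)
    rwa [Complex.ofReal_neg, neg_mul] at this
  have hderiv : ∀ w, deriv (sectorExp α) w ≠ 0 := fun w => by
    rw [deriv_sectorExp]
    refine mul_ne_zero ?_ (Complex.exp_ne_zero _)
    push_cast
    exact div_ne_zero hpi' hα'
  obtain ⟨f, hf, hfe, hfp, hfq⟩ := exists_eq_mul_of_simple_zeros (differentiable_sectorExp α) hpq
    (sectorExp_zero h0).1 (sectorExp_zero h0).2 (hderiv _) (hderiv _)
  obtain ⟨g, hg, hge, hgp, hgq⟩ := exists_eq_mul_of_simple_zeros (differentiable_poleExp α) hpq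
    (by simp [poleExp]) (by simp [poleExp])
    (by rw [deriv_poleExp, sub_self, zero_mul, add_zero]
        exact mul_ne_zero (Complex.exp_ne_zero _) (sub_ne_zero.2 hexp))
    (by rw [deriv_poleExp, sub_self, mul_zero, zero_add]
        exact mul_ne_zero (sub_ne_zero.2 hexp.symm) (Complex.exp_ne_zero _))
  -- Here f and g are the two functions divided by the same factor (w - iα)(w + iα). That factor
  -- drops out of the difference of logarithms, and neither f nor g vanishes in the closed strip.
  refine ⟨fun w => Real.log ‖f w‖ - Real.log ‖g w‖, fun w hw => ?_, fun w hp hq h1 h2 => ?_⟩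
  · have hf0 : f w ≠ 0 := fun h => by
      have : sectorExp α w = 0 := by rw [hfe, h, mul_zero]
      rcases sectorExp_eq_zero_imp hα hw this with e | e
      · exact hfp (e ▸ h)
      · exact hfq (e ▸ h)
    have hg0 : g w ≠ 0 := fun h => by
      have : poleExp α w = 0 := by rw [hge, h, mul_zero]
      rcases (poleExp_eq_zero_iff hα hw).1 this with e | e
      · exact hgp (e ▸ h)
      · exact hgq (e ▸ h)
    exact ((hf.analyticAt w).harmonicAt_log_norm hf0).sub ((hg.analyticAt w).harmonicAt_log_norm hg0)
  · have hf0 : f w ≠ 0 := fun h => h1 (by rw [hfe, h, mul_zero])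
    have hg0 : g w ≠ 0 := fun h => h2 (by rw [hge, h, mul_zero])
    have n1 := norm_ne_zero_iff.2 (mul_ne_zero (sub_ne_zero.2 hp) (sub_ne_zero.2 hq))
    simp only
    rw [hfe, hge, norm_mul _ (f w), norm_mul _ (g w), Real.log_mul n1 (norm_ne_zero_iff.2 hf0),
      Real.log_mul n1 (norm_ne_zero_iff.2 hg0)]
    ring

theorem log_norm_poleExp {α : ℝ} {w : ℂ} (h : poleExp α w ≠ 0) :
    Real.log ‖poleExp α w‖ = Real.log ‖Complex.exp w - Complex.exp (α * Complex.I)‖ +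
      Real.log ‖Complex.exp w - Complex.exp (-(α * Complex.I))‖ := by
  have := mul_ne_zero_iff.1 h
  rw [poleExp, norm_mul, Real.log_mul (norm_ne_zero_iff.2 this.1) (norm_ne_zero_iff.2 this.2)]

theorem arg_exp {w : ℂ} (h : w.im ∈ Ioc (-π) π) : (Complex.exp w).arg = w.im := by
  rw [← Complex.log_im, Complex.log_exp h.1 h.2]

theorem sectorNorm_exp_inner {α : ℝ} (hα : α ∈ Ioo 0 (π / 2)) {w : ℂ} (hw : |w.im| ≤ 2 * α) :
    sectorNorm α (Complex.exp w) = ‖sectorExp α w‖ := by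
  obtain ⟨h1, h2⟩ := abs_le.1 hw
  have h3 := hα.2
  have hm : w.im ∈ Ioc (-π) π := ⟨by linarith, by linarith⟩
  rw [← norm_cpow_add_one hα.1 (by rw [arg_exp hm]; exact hw),
    Complex.cpow_def_of_ne_zero (Complex.exp_ne_zero _), Complex.log_exp hm.1 hm.2, sectorExp,
    add_comm, mul_comm w]

theorem abs_arg_exp_outer {α : ℝ} (hα : α ∈ Ioo 0 (π / 2)) {w : ℂ}
    (hw : w.im ∈ Icc (2 * α) (2 * π - 2 * α)) : 2 * α ≤ |(Complex.exp w).arg| := by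
  have h3 := hα.1
  have h4 := hα.2
  have h1 := hw.1
  have h2 := hw.2
  rcases le_or_gt w.im π with h | h
  · rw [arg_exp ⟨by linarith [Real.pi_pos], h⟩]
    exact h1.trans (le_abs_self _)
  · have e : Complex.exp w = Complex.exp (w - 2 * π * Complex.I) := by
      rw [Complex.exp_sub, Complex.exp_two_pi_mul_I, div_one]
    have him : (w - 2 * π * Complex.I).im = w.im - 2 * π := by simp
    rw [e, arg_exp (by rw [him]; constructor <;> linarith), him]
    exact le_trans (by linarith) (neg_le_abs _)

theorem norm_exp_rpow (k : ℝ) (w : ℂ) : ‖Complex.exp w‖ ^ k = Real.exp (k * w.re) := by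
  rw [Complex.norm_exp, ← Real.exp_mul, mul_comm]

theorem regularPart_exp_inner {α : ℝ} (hα : α ∈ Ioo 0 (π / 2)) {w : ℂ} (hw : |w.im| ≤ 2 * α)
    (h : poleExp α w ≠ 0) :
    regularPart α (Complex.exp w) = Real.log ‖sectorExp α w‖ - Real.log ‖poleExp α w‖ := by
  rw [regularPart, sectorNorm_exp_inner hα hw, log_norm_poleExp h]; ring

theorem regularPart_exp_outer {α : ℝ} (hα : α ∈ Ioo 0 (π / 2)) {w : ℂ}
    (hw : w.im ∈ Icc (2 * α) (2 * π - 2 * α)) :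
    regularPart α (Complex.exp w) =
      Real.log (1 + Real.exp (π / α * w.re)) - Real.log ‖poleExp α w‖ := by
  rw [regularPart, sectorNorm_of_le hα.1 (abs_arg_exp_outer hα hw), norm_exp_rpow,
    log_norm_poleExp (poleExp_ne_zero_of_outer hα hw)]
  ring

theorem sectorExp_ne_zero {α : ℝ} (hα : α ∈ Ioo 0 (π / 2)) {w : ℂ} (hw : |w.im| ≤ 2 * α)
    (h : poleExp α w ≠ 0) : sectorExp α w ≠ 0 := fun h' =>
  h ((poleExp_eq_zero_iff hα hw).2 (sectorExp_eq_zero_imp hα hw h'))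

/-! ### The outer radial function -/

/-- The regular part in the outer strip. -/
noncomputable def outerFun (α : ℝ) (w : ℂ) : ℝ :=
  Real.log (1 + Real.exp (π / α * w.re)) - Real.log ‖poleExp α w‖

theorem hasDerivAt_log_one_add_exp (k s : ℝ) :
    HasDerivAt (fun s => Real.log (1 + Real.exp (k * s)))
      (k * Real.exp (k * s) / (1 + Real.exp (k * s))) s := by
  have h : HasDerivAt (fun s => 1 + Real.exp (k * s)) (k * Real.exp (k * s)) s := by
    have := (((hasDerivAt_id s).const_mul k).exp).const_add 1
    simpa [mul_comm] using this
  exact h.log (by positivity)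

theorem hasDerivAt_logistic (k s : ℝ) :
    HasDerivAt (fun s => k * Real.exp (k * s) / (1 + Real.exp (k * s)))
      (k ^ 2 * Real.exp (k * s) / (1 + Real.exp (k * s)) ^ 2) s := by
  have h : HasDerivAt (fun s => Real.exp (k * s)) (k * Real.exp (k * s)) s := by
    have := ((hasDerivAt_id s).const_mul k).exp
    simpa [mul_comm] using this
  have h2 := (h.const_mul k).div (h.const_add 1) (by positivity)
  refine h2.congr_deriv ?_
  congr 1
  ring

theorem contDiff_log_one_add_exp (k : ℝ) :
    ContDiff ℝ 2 fun w : ℂ => Real.log (1 + Real.exp (k * w.re)) := by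
  refine ContDiff.log ?_ fun w => by positivity
  exact contDiff_const.add ((contDiff_const.mul Complex.reCLM.contDiff).exp)

theorem hasFDerivAt_comp_re {g : ℝ → ℝ} {g' : ℝ} {w : ℂ} (h : HasDerivAt g g' w.re) :
    HasFDerivAt (fun w : ℂ => g w.re) (g' • Complex.reCLM) w :=
  h.comp_hasFDerivAt w Complex.reCLM.hasFDerivAt

theorem fderiv_log_one_add_exp (k : ℝ) (w v : ℂ) :
    fderiv ℝ (fun w : ℂ => Real.log (1 + Real.exp (k * w.re))) w v =
      k * Real.exp (k * w.re) / (1 + Real.exp (k * w.re)) * v.re := by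
  rw [(hasFDerivAt_comp_re (hasDerivAt_log_one_add_exp k w.re)).fderiv]
  simp

theorem laplacian_log_one_add_exp (k : ℝ) (w : ℂ) :
    Laplacian.laplacian (fun w : ℂ => Real.log (1 + Real.exp (k * w.re))) w =
      k ^ 2 * Real.exp (k * w.re) / (1 + Real.exp (k * w.re)) ^ 2 := by
  have hc := (contDiff_log_one_add_exp k).contDiffAt (x := w)
  rw [laplacian_eq_fderiv, ← fderiv_fderiv_apply hc, ← fderiv_fderiv_apply hc]
  simp only [fderiv_log_one_add_exp, Complex.one_re, Complex.I_re, mul_one, mul_zero]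
  rw [(hasFDerivAt_comp_re (hasDerivAt_logistic k w.re)).fderiv]
  simp

theorem harmonicAt_log_norm_poleExp {α : ℝ} {w : ℂ} (h : poleExp α w ≠ 0) :
    InnerProductSpace.HarmonicAt (fun w => Real.log ‖poleExp α w‖) w :=
  ((differentiable_poleExp α).analyticAt w).harmonicAt_log_norm h

theorem contDiffAt_outerFun {α : ℝ} {w : ℂ} (h : poleExp α w ≠ 0) :
    ContDiffAt ℝ 2 (outerFun α) w :=
  (contDiff_log_one_add_exp _).contDiffAt.sub (harmonicAt_log_norm_poleExp h).1

theorem laplacian_outerFun {α : ℝ} {w : ℂ} (h : poleExp α w ≠ 0) :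
    Laplacian.laplacian (outerFun α) w =
      (π / α) ^ 2 * Real.exp (π / α * w.re) / (1 + Real.exp (π / α * w.re)) ^ 2 := by
  have h1 := (contDiff_log_one_add_exp (π / α)).contDiffAt (x := w)
  have h2 := harmonicAt_log_norm_poleExp h
  have := h1.laplacian_sub h2.1
  rw [h2.2.eq_of_nhds] at this
  rw [← laplacian_log_one_add_exp]
  rwa [Pi.zero_apply, sub_zero] at this

/-! ### Matching of normal derivatives along the rays -/

/-- On these lines k·Im w = ±2π, so the modulus at height Im w + t depends on t only through
cos(kt). -/
theorem norm_sectorExp_symm {α : ℝ} (hα : 0 < α) {w : ℂ} (hw : |w.im| = 2 * α) (t : ℝ) :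
    ‖sectorExp α (w + (-t) * Complex.I)‖ = ‖sectorExp α (w + t * Complex.I)‖ := by
  have hk : 0 < π / α := by positivity
  have key : ∀ s : ℝ, ‖sectorExp α (w + s * Complex.I)‖ =
      √(1 + 2 * Real.exp (π / α * w.re) * Real.cos (π / α * s) + Real.exp (π / α * w.re) ^ 2) := by
    intro s
    have e : sectorExp α (w + s * Complex.I) = (Real.exp (π / α * w.re) : ℂ) *
        Complex.exp ((π / α * (w.im + s) : ℝ) * Complex.I) + 1 := by
      rw [sectorExp, Complex.ofReal_exp, ← Complex.exp_add, add_comm]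
      congr 2
      conv_lhs => rw [← Complex.re_add_im w]
      push_cast; ring
    rw [e, norm_one_add_mul_exp]
    congr 4
    have h2 : π / α * (2 * α) = 2 * π := by field_simp
    rcases abs_choice w.im with h | h
    · have : w.im = 2 * α := by rw [← h, hw]
      rw [this, mul_add, h2, add_comm, Real.cos_add_two_pi]
    · have : w.im = -(2 * α) := by linarith
      rw [this, mul_add, mul_neg, h2, add_comm, ← sub_eq_add_neg, Real.cos_sub_two_pi]
  have k1 := key (-t)
  have k2 := key t
  rw [mul_neg, Real.cos_neg, ← k2] at k1
  simpa using k1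

/-- An even function has zero derivative at 0. This is why the rays |Arg z| = 2α carry no singular
mass. -/
theorem fderiv_log_norm_sectorExp_I {α : ℝ} (hα : 0 < α) {w : ℂ} (hw : |w.im| = 2 * α)
    (h : sectorExp α w ≠ 0) :
    fderiv ℝ (fun z => Real.log ‖sectorExp α z‖) w Complex.I = 0 := by
  set G : ℝ → ℝ := fun t => Real.log ‖sectorExp α (w + t * Complex.I)‖ with hG
  have hd : HasDerivAt G (fderiv ℝ (fun z => Real.log ‖sectorExp α z‖) w Complex.I) 0 := by
    have h1 : HasDerivAt (fun t : ℝ => w + t * Complex.I) Complex.I 0 := by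
      have := ((hasDerivAt_id (0:ℝ)).ofReal_comp.mul_const Complex.I).const_add w
      simpa using this
    have h2 : DifferentiableAt ℝ (fun z => Real.log ‖sectorExp α z‖) (w + (0:ℝ) * Complex.I) := by
      have := (((differentiable_sectorExp α).analyticAt w).harmonicAt_log_norm h).1
      simpa using this.differentiableAt (by norm_num)
    have := h2.hasFDerivAt.comp_hasDerivAt (0:ℝ) h1
    rw [Complex.ofReal_zero, zero_mul, add_zero] at this
    exact this
  have heven : (fun t => G (-t)) = G := funext fun t => by
    have := norm_sectorExp_symm hα hw t
    simp only [hG, Complex.ofReal_neg, this]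
  have h3 := deriv_comp_neg G 0
  rw [heven, neg_zero, hd.deriv] at h3
  linarith

/-! ### The density -/

theorem two_lt_pi_div {α : ℝ} (hα : α ∈ Ioo 0 (π / 2)) : 2 < π / α := by
  rw [lt_div_iff₀ hα.1]; linarith [hα.2]

theorem sectorDensity_eq {α : ℝ} {z : ℂ} (hz : z ≠ 0) :
    sectorDensity α z = 1 / (2 * α * ‖z‖) *
      (π / α * ‖z‖ ^ (π / α - 1) / (1 + ‖z‖ ^ (π / α)) ^ 2) := by
  have hr : 0 < ‖z‖ := norm_pos_iff.2 hz
  have h := Real.hasDerivAt_rpow_const (x := ‖z‖) (p := π / α) (Or.inl hr.ne')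
  have hp : 0 < ‖z‖ ^ (π / α) := Real.rpow_pos_of_pos hr _
  have h2 := h.div (h.const_add 1) (by positivity)
  rw [sectorDensity]
  congr 1
  refine h2.deriv.trans ?_
  congr 1
  ring

/-- Identifies 2πρ, multiplied by the Jacobian |e^w|², with the Laplacian of log(1 + e^{k Re w});
the radial density has its origin here. -/
theorem sectorDensity_exp {α : ℝ} (hα : 0 < α) (w : ℂ) :
    ‖Complex.exp w‖ ^ 2 * (2 * π * sectorDensity α (Complex.exp w)) =
      (π / α) ^ 2 * Real.exp (π / α * w.re) / (1 + Real.exp (π / α * w.re)) ^ 2 := by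
  have hr : 0 < ‖Complex.exp w‖ := norm_pos_iff.2 (Complex.exp_ne_zero w)
  rw [sectorDensity_eq (Complex.exp_ne_zero w), Real.rpow_sub_one hr.ne', norm_exp_rpow]
  field_simp

theorem sectorDensity_zero (α : ℝ) : sectorDensity α 0 = 0 := by simp [sectorDensity]

theorem sectorDensity_nonneg {α : ℝ} (hα : 0 < α) (z : ℂ) : 0 ≤ sectorDensity α z := by
  rcases eq_or_ne z 0 with rfl | hz
  · rw [sectorDensity_zero]
  · rw [sectorDensity_eq hz]
    positivity

/-- The density has order r^{k-2} at 0 and r^{-k-2} at infinity. Since k > 2, it is bounded at 0 and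
O(r⁻⁴) at infinity, hence dominated by the weight. -/
theorem sectorDensity_le {α : ℝ} (hα : α ∈ Ioo 0 (π / 2)) (z : ℂ) :
    sectorDensity α z ≤ 2 * π / α ^ 2 * decayWeight z := by
  have h0 := hα.1
  have hk := two_lt_pi_div hα
  rcases eq_or_ne z 0 with rfl | hz
  · rw [sectorDensity_zero]
    exact mul_nonneg (by positivity) (decayWeight_nonneg _)
  have hr : 0 < ‖z‖ := norm_pos_iff.2 hz
  rw [sectorDensity_eq hz, decayWeight, Real.rpow_sub_one hr.ne']
  set r := ‖z‖
  set k := π / α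
  set q := r ^ k with hq
  have hq0 : 0 < q := Real.rpow_pos_of_pos hr _
  have key : q * (1 + r ^ 2) ^ 2 ≤ 4 * r ^ 2 * (1 + q) ^ 2 := by
    rcases le_or_gt r 1 with h | h
    · have h1 : q ≤ r ^ 2 := by
        rw [hq, ← Real.rpow_natCast r 2]
        exact Real.rpow_le_rpow_of_exponent_ge hr h (by push_cast; exact hk.le)
      have h2 : (1 + r ^ 2) ^ 2 ≤ 4 := by nlinarith [pow_le_one₀ (n := 2) hr.le h, sq_nonneg r]
      calc q * (1 + r ^ 2) ^ 2 ≤ r ^ 2 * 4 := by gcongr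
        _ = 4 * r ^ 2 * 1 := by ring
        _ ≤ 4 * r ^ 2 * (1 + q) ^ 2 := by gcongr; nlinarith
    · have h1 : r ^ 2 ≤ q := by
        rw [hq, ← Real.rpow_natCast r 2]
        exact Real.rpow_le_rpow_of_exponent_le h.le (by push_cast; exact hk.le)
      have h2 : 1 ≤ r ^ 2 := one_le_pow₀ h.le
      calc q * (1 + r ^ 2) ^ 2 ≤ q * (2 * r ^ 2) ^ 2 := by gcongr; linarith
        _ = 4 * r ^ 2 * (q * r ^ 2) := by ring
        _ ≤ 4 * r ^ 2 * (q * q) := by gcongr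
        _ ≤ 4 * r ^ 2 * (1 + q) ^ 2 := by gcongr; nlinarith
  have e1 : 1 / (2 * α * r) * (k * (q / r) / (1 + q) ^ 2) = k / (2 * α) * (q / (r ^ 2 * (1 + q) ^ 2)) := by
    field_simp
  have e2 : 2 * π / α ^ 2 * ((1 + r ^ 2) ^ 2)⁻¹ = k / (2 * α) * (4 / (1 + r ^ 2) ^ 2) := by
    simp only [k]
    field_simp
    ring
  rw [e1, e2]
  have hk0 : 0 < k := by linarith
  refine mul_le_mul_of_nonneg_left ?_ (by positivity)
  rw [div_le_div_iff₀ (by positivity) (by positivity)]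
  linarith

theorem measurableSet_outerSector (α : ℝ) : MeasurableSet (outerSector α) :=
  measurableSet_le measurable_const Complex.measurable_arg.abs

theorem measurable_sectorDensity (α : ℝ) : Measurable (sectorDensity α) := by
  have : sectorDensity α = fun z : ℂ => 1 / (2 * α * ‖z‖) *
      (π / α * ‖z‖ ^ (π / α - 1) / (1 + ‖z‖ ^ (π / α)) ^ 2) := by
    funext z
    rcases eq_or_ne z 0 with rfl | hz
    · simp [sectorDensity_zero]
    · exact sectorDensity_eq hz
  rw [this]
  fun_prop

/-! ### Bounds for the regular part -/

theorem min_exp_mul_le {k x : ℝ} (hk : 1 ≤ k) :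
    min 1 (Real.exp (k * x)) ≤ min 1 (Real.exp x) := by
  rcases le_total x 0 with h | h
  · exact min_le_min_left _ (Real.exp_le_exp.2 (by nlinarith))
  · exact (min_le_left _ _).trans (le_min le_rfl (Real.one_le_exp h))

theorem poleExp_bounds (α : ℝ) {w : ℂ} (hw : 1 ≤ |w.re|) :
    |Real.log ‖poleExp α w‖| ≤ 2 * (1 + max w.re 0) ∧ poleExp α w ≠ 0 ∧
      ‖deriv (poleExp α) w / poleExp α w‖ ≤ 4 * min 1 (Real.exp w.re) := by
  obtain ⟨a1, a2, a3⟩ := norm_sub_unit_bounds (Complex.norm_exp w)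
    (Complex.norm_exp_ofReal_mul_I α) hw
  obtain ⟨b1, b2, b3⟩ := norm_sub_unit_bounds (Complex.norm_exp w) (norm_exp_neg_mul_I α) hw
  have h : poleExp α w ≠ 0 := mul_ne_zero a2 b2
  refine ⟨?_, h, ?_⟩
  · rw [log_norm_poleExp h]
    exact (abs_add_le _ _).trans (by linarith)
  · have e : deriv (poleExp α) w / poleExp α w =
        Complex.exp w / (Complex.exp w - Complex.exp (α * Complex.I)) +
        Complex.exp w / (Complex.exp w - Complex.exp (-(α * Complex.I))) := by
      rw [deriv_poleExp, poleExp]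
      field_simp
    rw [e]
    exact (norm_add_le _ _).trans (by linarith)

theorem sectorExp_bounds {α : ℝ} (hα : α ∈ Ioo 0 (π / 2)) {w : ℂ} (hw : 1 ≤ |w.re|) :
    |Real.log ‖sectorExp α w‖| ≤ 1 + π / α * max w.re 0 ∧ sectorExp α w ≠ 0 ∧
      ‖deriv (sectorExp α) w / sectorExp α w‖ ≤ 2 * (π / α) * min 1 (Real.exp w.re) := by
  have hk := two_lt_pi_div hα
  have hk0 : 0 < π / α := by linarith
  have hn : ‖Complex.exp ((π / α : ℝ) * w)‖ = Real.exp (π / α * w.re) := by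
    rw [Complex.norm_exp, Complex.re_ofReal_mul]
  have hw2 : 1 ≤ |π / α * w.re| := by
    rw [abs_mul, abs_of_pos hk0]; nlinarith
  obtain ⟨a1, a2, a3⟩ := norm_sub_unit_bounds (b := -1) hn (by simp) hw2
  have e : Complex.exp ((π / α : ℝ) * w) - (-1) = sectorExp α w := by rw [sectorExp]; ring
  rw [e] at a1 a2 a3
  refine ⟨?_, a2, ?_⟩
  · rwa [mul_max_of_nonneg _ _ hk0.le, mul_zero]
  · rw [deriv_sectorExp, mul_div_assoc, norm_mul, Complex.norm_real, Real.norm_of_nonneg hk0.le]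
    have := min_exp_mul_le (x := w.re) (by linarith : 1 ≤ π / α)
    calc _ ≤ π / α * (2 * min 1 (Real.exp (π / α * w.re))) := by gcongr
      _ ≤ π / α * (2 * min 1 (Real.exp w.re)) := by gcongr
      _ = _ := by ring

theorem log_one_add_exp_bounds {k x : ℝ} (hk : 1 ≤ k) :
    |Real.log (1 + Real.exp (k * x))| ≤ 1 + k * max x 0 ∧
      |k * Real.exp (k * x) / (1 + Real.exp (k * x))| ≤ 2 * k * min 1 (Real.exp x) := by
  have hE := Real.exp_pos (k * x)
  constructor
  · rw [abs_of_nonneg (Real.log_nonneg (by linarith)), mul_max_of_nonneg _ _ (by linarith), mul_zero]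
    have h1 : 1 + Real.exp (k * x) ≤ 2 * Real.exp (max (k * x) 0) := by
      have := Real.exp_le_exp.2 (le_max_left (k * x) 0)
      have := Real.one_le_exp (le_max_right (k * x) 0)
      linarith
    have := Real.log_le_log (by linarith) h1
    rw [Real.log_mul (by norm_num) (Real.exp_pos _).ne', Real.log_exp] at this
    linarith [Real.log_two_lt_d9]
  · rw [abs_of_nonneg (by positivity), div_le_iff₀ (by linarith)]
    have h := min_exp_mul_le (x := x) hk
    have h2 : Real.exp (k * x) ≤ 2 * min 1 (Real.exp (k * x)) * (1 + Real.exp (k * x)) := by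
      rcases min_cases 1 (Real.exp (k * x)) with h | h <;> rw [h.1] <;> nlinarith
    calc k * Real.exp (k * x) ≤ k * (2 * min 1 (Real.exp (k * x)) * (1 + Real.exp (k * x))) := by
          gcongr
      _ ≤ k * (2 * min 1 (Real.exp x) * (1 + Real.exp (k * x))) := by gcongr
      _ = _ := by ring

/-- The constant 2k + 4 collects 2k from the radial term and 4 from the two poles. It also serves
the inner strip, so a single estimate covers the vertical edges of both rectangles. -/
theorem outerFun_bounds {α : ℝ} (hα : α ∈ Ioo 0 (π / 2)) {w : ℂ} (hw : 1 ≤ |w.re|) :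
    |outerFun α w| ≤ (2 * (π / α) + 4) * (1 + max w.re 0) ∧
      |fderiv ℝ (outerFun α) w 1| ≤ (2 * (π / α) + 4) * min 1 (Real.exp w.re) := by
  have hk := two_lt_pi_div hα
  obtain ⟨a1, a2, a3⟩ := poleExp_bounds α hw
  obtain ⟨b1, b2⟩ := log_one_add_exp_bounds (x := w.re) (by linarith : 1 ≤ π / α)
  have hm := le_max_right w.re 0
  constructor
  · refine (abs_sub _ _).trans ?_
    nlinarith
  · have e : fderiv ℝ (outerFun α) w 1 = fderiv ℝ (fun w : ℂ =>
        Real.log (1 + Real.exp (π / α * w.re))) w 1 -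
        fderiv ℝ (fun w => Real.log ‖poleExp α w‖) w 1 := by
      rw [← sub_apply, ← fderiv_sub
        (((contDiff_log_one_add_exp _).contDiffAt).differentiableAt (by norm_num))
        ((harmonicAt_log_norm_poleExp a2).1.differentiableAt (by norm_num))]
      rfl
    rw [e, fderiv_log_one_add_exp, Complex.one_re, mul_one]
    have := norm_fderiv_log_norm_le (differentiable_poleExp α w) a2
    refine (abs_sub _ _).trans ?_
    linarith

/-- `V` is the harmonic extension of the regular part to the inner strip. -/
structure IsInnerExtension (α : ℝ) (V : ℂ → ℝ) : Prop where
  harmonicAt : ∀ w, |w.im| ≤ 2 * α → InnerProductSpace.HarmonicAt V w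
  eq : ∀ w, sectorExp α w ≠ 0 → poleExp α w ≠ 0 →
    V w = Real.log ‖sectorExp α w‖ - Real.log ‖poleExp α w‖

theorem exists_isInnerExtension {α : ℝ} (hα : α ∈ Ioo 0 (π / 2)) : ∃ V, IsInnerExtension α V := by
  obtain ⟨V, h1, h2⟩ := exists_harmonic_extension hα
  exact ⟨V, h1, fun w hs hp => h2 w (fun h => hp (by rw [h, poleExp, sub_self, zero_mul]))
    (fun h => hp (by rw [h, poleExp, sub_self, mul_zero])) hs hp⟩

theorem IsInnerExtension.fderiv_eq {α : ℝ} {V : ℂ → ℝ} (hV : IsInnerExtension α V) {w : ℂ}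
    (hs : sectorExp α w ≠ 0) (hp : poleExp α w ≠ 0) (v : ℂ) :
    fderiv ℝ V w v = fderiv ℝ (fun w => Real.log ‖sectorExp α w‖) w v -
      fderiv ℝ (fun w => Real.log ‖poleExp α w‖) w v := by
  have h : V =ᶠ[𝓝 w] (fun w => Real.log ‖sectorExp α w‖) - fun w => Real.log ‖poleExp α w‖ := by
    filter_upwards [(differentiable_sectorExp α).continuous.continuousAt.eventually_ne hs,
      (differentiable_poleExp α).continuous.continuousAt.eventually_ne hp] with z h1 h2
    exact hV.eq z h1 h2
  rw [h.fderiv_eq, fderiv_sub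
    ((((differentiable_sectorExp α).analyticAt w).harmonicAt_log_norm hs).1.differentiableAt
      (by norm_num))
    ((harmonicAt_log_norm_poleExp hp).1.differentiableAt (by norm_num))]
  rfl

theorem IsInnerExtension.bounds {α : ℝ} (hα : α ∈ Ioo 0 (π / 2)) {V : ℂ → ℝ}
    (hV : IsInnerExtension α V) {w : ℂ} (hw : 1 ≤ |w.re|) :
    |V w| ≤ (2 * (π / α) + 4) * (1 + max w.re 0) ∧
      |fderiv ℝ V w 1| ≤ (2 * (π / α) + 4) * min 1 (Real.exp w.re) := by
  have hk := two_lt_pi_div hα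
  obtain ⟨a1, a2, a3⟩ := poleExp_bounds α hw
  obtain ⟨b1, b2, b3⟩ := sectorExp_bounds hα hw
  have hm := le_max_right w.re 0
  constructor
  · rw [hV.eq w b2 a2]
    refine (abs_sub _ _).trans ?_
    nlinarith
  · rw [hV.fderiv_eq b2 a2]
    have := norm_fderiv_log_norm_le (differentiable_poleExp α w) a2
    have := norm_fderiv_log_norm_le (differentiable_sectorExp α w) b2
    refine (abs_sub _ _).trans ?_
    linarith

/-- Compactness handles |Re w| ≤ 1 in each strip and the asymptotic bounds handle the rest. The
poles are left out because the convention `Real.log 0 = 0` makes the value there differ from the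
harmonic extension. -/
theorem exists_regularPart_bound {α : ℝ} (hα : α ∈ Ioo 0 (π / 2)) :
    ∃ C, 0 ≤ C ∧ ∀ z, z ≠ Complex.exp (α * Complex.I) → z ≠ Complex.exp (-(α * Complex.I)) →
      |regularPart α z| ≤ C * (1 + ‖z‖) := by
  obtain ⟨V, hV⟩ := exists_isInnerExtension hα
  have hk := two_lt_pi_div hα
  have h0 := hα.1
  obtain ⟨C1, h1⟩ := ((isCompact_Icc (a := (-1:ℝ)) (b := 1)).reProdIm
    (isCompact_Icc (a := -(2 * α)) (b := 2 * α))).exists_bound_of_continuousOn (f := V)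
    (fun w hw => (hV.harmonicAt w (abs_le.2 hw.2)).1.continuousAt.continuousWithinAt)
  obtain ⟨C2, h2⟩ := ((isCompact_Icc (a := (-1:ℝ)) (b := 1)).reProdIm
    (isCompact_Icc (a := 2 * α) (b := 2 * π - 2 * α))).exists_bound_of_continuousOn
    (f := outerFun α) (fun w hw =>
      (contDiffAt_outerFun (poleExp_ne_zero_of_outer hα hw.2)).continuousAt.continuousWithinAt)
  set C := (2 * (π / α) + 4) + |C1| + |C2| with hC
  have a1 := abs_nonneg C1
  have a2 := abs_nonneg C2
  have hC0 : 0 ≤ C := by linarith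
  refine ⟨C, hC0, fun z hz1 hz2 => ?_⟩
  rcases eq_or_ne z 0 with rfl | hz
  · have : regularPart α 0 = 0 := by
      simp [regularPart, sectorNorm_zero h0, norm_exp_neg_mul_I, Complex.norm_exp_ofReal_mul_I]
    rw [this, abs_zero]
    positivity
  have hzmem : z ∈ Complex.exp '' periodStrip (-(2 * α)) := by
    rw [exp_image_periodStrip]; exact hz
  obtain ⟨w, hw, rfl⟩ := hzmem
  have hp : poleExp α w ≠ 0 := mul_ne_zero (sub_ne_zero.2 hz1) (sub_ne_zero.2 hz2)
  -- This maximum is log⁺|z|. The logarithmic growth is weakened to linear growth, which the decay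
  -- weight still absorbs.
  have hmax : max w.re 0 ≤ ‖Complex.exp w‖ := by
    rw [Complex.norm_exp]
    exact max_le (by linarith [Real.add_one_le_exp w.re]) (Real.exp_pos _).le
  have hfin : ∀ v : ℝ, (1 ≤ |w.re| → |v| ≤ (2 * (π / α) + 4) * (1 + max w.re 0)) →
      (|w.re| ≤ 1 → |v| ≤ |C1| + |C2|) → |v| ≤ C * (1 + ‖Complex.exp w‖) := by
    intro v hv1 hv2
    have hn := norm_nonneg (Complex.exp w)
    rcases le_total 1 |w.re| with h | h
    · refine (hv1 h).trans ?_
      gcongr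
      linarith
    · refine (hv2 h).trans ?_
      nlinarith
  rcases le_total w.im (2 * α) with h | h
  · have him : |w.im| ≤ 2 * α := abs_le.2 ⟨hw.1.le, h⟩
    have hs := sectorExp_ne_zero hα him hp
    rw [regularPart_exp_inner hα him hp, ← hV.eq w hs hp]
    refine hfin _ (fun hw1 => (hV.bounds hα hw1).1) fun hw1 => ?_
    have := h1 w ⟨abs_le.1 hw1, abs_le.1 him⟩
    rw [Real.norm_eq_abs] at this
    linarith [le_abs_self C1]
  · have him : w.im ∈ Icc (2 * α) (2 * π - 2 * α) := ⟨h, by linarith [hw.2]⟩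
    rw [regularPart_exp_outer hα him]
    refine hfin _ (fun hw1 => (outerFun_bounds hα hw1).1) fun hw1 => ?_
    have := h2 w ⟨abs_le.1 hw1, him⟩
    rw [Real.norm_eq_abs] at this
    rw [outerFun] at this
    linarith [le_abs_self C2]

theorem measurable_regularPart {α : ℝ} (hα : 0 < α) : Measurable (regularPart α) :=
  ((Real.measurable_log.comp (continuous_sectorNorm hα).measurable).sub
    (measurable_log_norm_sub _)).sub (measurable_log_norm_sub _)

theorem ae_ne_poles (α : ℝ) : ∀ᵐ z : ℂ, z ≠ Complex.exp (α * Complex.I) ∧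
    z ≠ Complex.exp (-(α * Complex.I)) :=
  (Measure.ae_ne volume _).and (Measure.ae_ne volume _)

theorem integrable_regularPart_mul {α : ℝ} (hα : α ∈ Ioo 0 (π / 2)) {g : ℂ → ℝ}
    (hg : Measurable g) {C : ℝ} (hC : ∀ z, |g z| ≤ C * decayWeight z) :
    Integrable fun z => regularPart α z * g z := by
  obtain ⟨B, hB0, hB⟩ := exists_regularPart_bound hα
  refine (integrable_one_add_norm_mul_decayWeight.const_mul (B * C)).mono'
    ((measurable_regularPart hα.1).mul hg).aestronglyMeasurable ?_
  filter_upwards [ae_ne_poles α] with z hz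
  rw [Real.norm_eq_abs, abs_mul]
  have h1 := hB z hz.1 hz.2
  calc |regularPart α z| * |g z| ≤ B * (1 + ‖z‖) * (C * decayWeight z) :=
        mul_le_mul h1 (hC z) (abs_nonneg _) (by positivity)
    _ = _ := by ring

/-! ### The distributional Laplacian of the regular part -/

theorem IsDecayingTest.continuous_laplacian {φ : ℂ → ℝ} (hφ : IsDecayingTest φ) :
    Continuous (Laplacian.laplacian φ) := by
  have h1 : ContDiff ℝ 1 (fderiv ℝ φ) := hφ.contDiff.fderiv_right (by norm_num)
  have h2 := h1.continuous_fderiv (by norm_num)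
  rw [funext (laplacian_eq_fderiv φ)]
  fun_prop

theorem integrable_sectorDensity_mul {α : ℝ} (hα : α ∈ Ioo 0 (π / 2)) {g : ℂ → ℝ}
    (hg : Measurable g) (hi : Integrable fun z => |g z| * decayWeight z) :
    Integrable fun z => sectorDensity α z * g z := by
  have h0 := hα.1
  refine (hi.const_mul (2 * π / α ^ 2)).mono'
    ((measurable_sectorDensity α).mul hg).aestronglyMeasurable (Eventually.of_forall fun z => ?_)
  rw [Real.norm_eq_abs, abs_mul, abs_of_nonneg (sectorDensity_nonneg h0 z)]
  calc sectorDensity α z * |g z| ≤ 2 * π / α ^ 2 * decayWeight z * |g z| := by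
        gcongr; exact sectorDensity_le hα z
    _ = _ := by ring

theorem IsDecayingTest.integrable_sectorDensity_mul {α : ℝ} (hα : α ∈ Ioo 0 (π / 2)) {φ : ℂ → ℝ}
    (hφ : IsDecayingTest φ) : Integrable fun z => sectorDensity α z * φ z := by
  obtain ⟨M, hM, hb, -⟩ := hφ.bounds
  refine _root_.integrable_sectorDensity_mul hα hφ.contDiff.continuous.measurable ?_
  refine (integrable_decayWeight.const_mul M).mono'
    (hφ.contDiff.continuous.abs.mul continuous_decayWeight).aestronglyMeasurable
    (Eventually.of_forall fun z => ?_)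
  rw [Real.norm_of_nonneg (mul_nonneg (abs_nonneg _) (decayWeight_nonneg z))]
  exact mul_le_mul_of_nonneg_right (hb z).1 (decayWeight_nonneg z)

/-! ### Vertical slices of the two strips and matching along the rays. -/

section slices

variable {α : ℝ} {φ : ℂ → ℝ} {V : ℂ → ℝ}

/-- The poles lie on Re w = 0, so `s ≠ 0` keeps the slice away from them; there V coincides with the
regular part and its Laplacian vanishes. -/
theorem integral_inner_slice (hα : α ∈ Ioo 0 (π / 2)) (hφ : ContDiff ℝ 2 φ)
    (hV : IsInnerExtension α V) {s : ℝ} (hs : s ≠ 0) :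
    ∫ θ in -(2 * α)..(-(2 * α) + 2 * π), ‖Complex.exp (s + θ * Complex.I)‖ ^ 2 *
      (outerSector α)ᶜ.indicator (fun z => regularPart α z * Laplacian.laplacian φ z)
        (Complex.exp (s + θ * Complex.I)) =
    ∫ θ in -(2 * α)..(2 * α),
      (V (s + θ * Complex.I) *
        Laplacian.laplacian (fun w => φ (Complex.exp w)) (s + θ * Complex.I) -
      φ (Complex.exp (s + θ * Complex.I)) * Laplacian.laplacian V (s + θ * Complex.I)) := by
  have h0 := hα.1
  have h1 := hα.2
  -- The open interval is needed because the bounding rays belong to `outerSector α`.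
  rw [intervalIntegral.integral_of_le (by linarith [Real.pi_pos]),
    intervalIntegral.integral_of_le (by linarith), integral_Ioc_eq_integral_Ioo (y := 2 * α)]
  have him : ∀ θ : ℝ, ((s : ℂ) + θ * Complex.I).im = θ := fun θ => by simp
  have hre : ∀ θ : ℝ, ((s : ℂ) + θ * Complex.I).re = s := fun θ => by simp
  rw [setIntegral_eq_of_subset_of_forall_sdiff_eq_zero (s := Ioo (-(2 * α)) (2 * α))
    measurableSet_Ioc (fun θ hθ => ⟨hθ.1, by linarith [hθ.2]⟩)]
  · refine setIntegral_congr_fun measurableSet_Ioo fun θ hθ => ?_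
    have hle : |((s : ℂ) + θ * Complex.I).im| ≤ 2 * α := by
      rw [him]; exact abs_le.2 ⟨hθ.1.le, hθ.2.le⟩
    have hp : poleExp α (s + θ * Complex.I) ≠ 0 := fun h => by
      rcases (poleExp_eq_zero_iff hα hle).1 h with e | e
      · have := congrArg Complex.re e
        rw [hre] at this
        simp at this
        exact hs this
      · have := congrArg Complex.re e
        rw [hre] at this
        simp at this
        exact hs this
    have hsec := sectorExp_ne_zero hα hle hp
    have hmem : Complex.exp (s + θ * Complex.I) ∈ (outerSector α)ᶜ := by
      simp only [outerSector, mem_compl_iff, mem_ofPred_eq, not_le]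
      rw [arg_exp (by rw [him]; constructor <;> linarith [hθ.1, hθ.2]), him]
      exact abs_lt.2 hθ
    have hharm := (hV.harmonicAt _ hle).2.eq_of_nhds
    rw [indicator_of_mem hmem, regularPart_exp_inner hα hle hp, ← hV.eq _ hsec hp, hharm,
      laplacian_comp_exp hφ, Pi.zero_apply]
    ring
  · intro θ hθ
    have hθ1 : 2 * α ≤ θ := by
      by_contra h
      exact hθ.2 ⟨hθ.1.1, not_le.1 h⟩
    have hmem : Complex.exp (s + θ * Complex.I) ∉ (outerSector α)ᶜ := by
      rw [notMem_compl_iff]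
      exact abs_arg_exp_outer hα (by rw [him]; exact ⟨hθ1, by linarith [hθ.1.2]⟩)
    rw [indicator_of_notMem hmem, mul_zero]

/-- By `sectorDensity_exp`, the subtracted density term is precisely the term containing the
Laplacian of `outerFun α` in Green's identity. -/
theorem integral_outer_slice (hα : α ∈ Ioo 0 (π / 2)) (hφ : ContDiff ℝ 2 φ) (s : ℝ) :
    ∫ θ in -(2 * α)..(-(2 * α) + 2 * π), ‖Complex.exp (s + θ * Complex.I)‖ ^ 2 *
      (outerSector α).indicator (fun z => regularPart α z * Laplacian.laplacian φ z -
        2 * π * (sectorDensity α z * φ z)) (Complex.exp (s + θ * Complex.I)) =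
    ∫ θ in (2 * α)..(2 * π - 2 * α),
      (outerFun α (s + θ * Complex.I) *
        Laplacian.laplacian (fun w => φ (Complex.exp w)) (s + θ * Complex.I) -
      φ (Complex.exp (s + θ * Complex.I)) *
        Laplacian.laplacian (outerFun α) (s + θ * Complex.I)) := by
  have h0 := hα.1
  have h1 := hα.2
  rw [intervalIntegral.integral_of_le (by linarith [Real.pi_pos]),
    intervalIntegral.integral_of_le (by linarith), ← integral_Icc_eq_integral_Ioc (x := 2 * α)]
  have him : ∀ θ : ℝ, ((s : ℂ) + θ * Complex.I).im = θ := fun θ => by simp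
  rw [setIntegral_eq_of_subset_of_forall_sdiff_eq_zero (s := Icc (2 * α) (2 * π - 2 * α))
    measurableSet_Ioc (fun θ hθ => ⟨by linarith [hθ.1], by linarith [hθ.2]⟩)]
  · refine setIntegral_congr_fun measurableSet_Icc fun θ hθ => ?_
    have hle : ((s : ℂ) + θ * Complex.I).im ∈ Icc (2 * α) (2 * π - 2 * α) := by
      rw [him]; exact hθ
    have hp := poleExp_ne_zero_of_outer hα hle
    have hmem : Complex.exp (s + θ * Complex.I) ∈ outerSector α := abs_arg_exp_outer hα hle
    rw [indicator_of_mem hmem, regularPart_exp_outer hα hle, laplacian_comp_exp hφ,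
      laplacian_outerFun hp, ← sectorDensity_exp h0, outerFun]
    ring
  · intro θ hθ
    have hθ1 : θ < 2 * α := by
      by_contra h
      exact hθ.2 ⟨not_lt.1 h, by linarith [hθ.1.2]⟩
    have hmem : Complex.exp (s + θ * Complex.I) ∉ outerSector α := by
      simp only [outerSector, mem_ofPred_eq, not_le]
      rw [arg_exp (by rw [him]; constructor <;> linarith [hθ.1.1, hθ1]), him]
      exact abs_lt.2 ⟨hθ.1.1, hθ1⟩
    rw [indicator_of_notMem hmem, mul_zero]

/-- The values agree by the common formula for the regular part. Both numerators have zero normal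
derivative on the line, so only the normal derivative of the common term log‖poleExp‖ remains. -/
theorem greenField_match_upper (hα : α ∈ Ioo 0 (π / 2)) (hV : IsInnerExtension α V) (Φ : ℂ → ℝ)
    (x : ℝ) : greenField V Φ Complex.I (x + (2 * α : ℝ) * Complex.I) =
      greenField (outerFun α) Φ Complex.I (x + (2 * α : ℝ) * Complex.I) := by
  have h0 := hα.1
  have h1 := hα.2
  set w : ℂ := x + (2 * α : ℝ) * Complex.I with hw
  have him : w.im = 2 * α := by simp [hw]
  have habs : |w.im| = 2 * α := by rw [him, abs_of_pos (by linarith)]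
  have hout : w.im ∈ Icc (2 * α) (2 * π - 2 * α) := by rw [him]; constructor <;> linarith
  have hp := poleExp_ne_zero_of_outer hα hout
  have hs := sectorExp_ne_zero hα habs.le hp
  have hval : V w = outerFun α w := by
    rw [hV.eq w hs hp, ← regularPart_exp_inner hα habs.le hp, regularPart_exp_outer hα hout, outerFun]
  have hder : fderiv ℝ V w Complex.I = fderiv ℝ (outerFun α) w Complex.I := by
    rw [hV.fderiv_eq hs hp, fderiv_log_norm_sectorExp_I h0 habs hs]
    have e : fderiv ℝ (outerFun α) w Complex.I = fderiv ℝ (fun w : ℂ =>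
        Real.log (1 + Real.exp (π / α * w.re))) w Complex.I -
        fderiv ℝ (fun w => Real.log ‖poleExp α w‖) w Complex.I := by
      rw [← sub_apply, ← fderiv_sub
        (((contDiff_log_one_add_exp _).contDiffAt).differentiableAt (by norm_num))
        ((harmonicAt_log_norm_poleExp hp).1.differentiableAt (by norm_num))]
      rfl
    rw [e, fderiv_log_one_add_exp, Complex.I_re, mul_zero]
  rw [greenField, greenField, hval, hder]

theorem fderiv_comp_add_period (f : ℂ → ℝ) (hf : ∀ w, f (w + 2 * π * Complex.I) = f w) (w v : ℂ) :
    fderiv ℝ f (w + 2 * π * Complex.I) v = fderiv ℝ f w v := by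
  rw [← fderiv_comp_add_right (2 * π * Complex.I)]
  simp only [hf]

theorem poleExp_period (w : ℂ) : poleExp α (w + 2 * π * Complex.I) = poleExp α w := by
  rw [poleExp, poleExp, Complex.exp_add, Complex.exp_two_pi_mul_I, mul_one]

theorem outerFun_period (w : ℂ) : outerFun α (w + 2 * π * Complex.I) = outerFun α w := by
  rw [outerFun, outerFun, poleExp_period]
  simp

/-- The lines Im w = -2α and Im w = 2π - 2α cover the same ray; the matching takes place on the
first and is carried to the second by 2πi-periodicity. -/
theorem greenField_match_lower (hα : α ∈ Ioo 0 (π / 2)) (hV : IsInnerExtension α V) (φ : ℂ → ℝ)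
    (x : ℝ) : greenField V (fun w => φ (Complex.exp w)) Complex.I
        (x + (-(2 * α) : ℝ) * Complex.I) =
      greenField (outerFun α) (fun w => φ (Complex.exp w)) Complex.I
        (x + (2 * π - 2 * α : ℝ) * Complex.I) := by
  have h0 := hα.1
  have h1 := hα.2
  set w : ℂ := x + (-(2 * α) : ℝ) * Complex.I with hw
  have e : (x + (2 * π - 2 * α : ℝ) * Complex.I : ℂ) = w + 2 * π * Complex.I := by
    rw [hw]; push_cast; ring
  have him : w.im = -(2 * α) := by simp [hw]
  have habs : |w.im| = 2 * α := by rw [him, abs_neg, abs_of_pos (by linarith)]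
  have hout : (w + 2 * π * Complex.I).im ∈ Icc (2 * α) (2 * π - 2 * α) := by
    have : (w + 2 * π * Complex.I).im = w.im + 2 * π := by simp
    rw [this, him]; constructor <;> linarith
  have hp : poleExp α w ≠ 0 := by
    rw [← poleExp_period]; exact poleExp_ne_zero_of_outer hα hout
  have hs := sectorExp_ne_zero hα habs.le hp
  have hexp : Complex.exp (w + 2 * π * Complex.I) = Complex.exp w := by
    rw [Complex.exp_add, Complex.exp_two_pi_mul_I, mul_one]
  have hval : V w = outerFun α w := by
    rw [hV.eq w hs hp, ← regularPart_exp_inner hα habs.le hp, ← hexp,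
      regularPart_exp_outer hα hout, ← outerFun_period, outerFun]
  have hder : fderiv ℝ V w Complex.I = fderiv ℝ (outerFun α) w Complex.I := by
    rw [hV.fderiv_eq hs hp, fderiv_log_norm_sectorExp_I h0 habs hs]
    have e : fderiv ℝ (outerFun α) w Complex.I = fderiv ℝ (fun w : ℂ =>
        Real.log (1 + Real.exp (π / α * w.re))) w Complex.I -
        fderiv ℝ (fun w => Real.log ‖poleExp α w‖) w Complex.I := by
      rw [← sub_apply, ← fderiv_sub
        (((contDiff_log_one_add_exp _).contDiffAt).differentiableAt (by norm_num))
        ((harmonicAt_log_norm_poleExp hp).1.differentiableAt (by norm_num))]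
      rfl
    rw [e, fderiv_log_one_add_exp, Complex.I_re, mul_zero]
  rw [e, greenField, greenField, hval, hder, outerFun_period, hexp,
    fderiv_comp_add_period _ outerFun_period,
    fderiv_comp_add_period _ (fun w => by rw [Complex.exp_add, Complex.exp_two_pi_mul_I, mul_one])]

theorem tendsto_integral_side {f : ℝ → ℝ → ℝ} {A c d : ℝ}
    (hf : ∀ S, 1 ≤ S → ∀ θ, θ ∈ uIcc c d → |f S θ| ≤ A * ((1 + S) * Real.exp (-S))) :
    Tendsto (fun S => ∫ θ in c..d, f S θ) atTop (𝓝 0) := by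
  have h := (tendsto_one_add_mul_exp_neg.const_mul A).mul_const |d - c|
  rw [mul_zero, zero_mul] at h
  refine squeeze_zero_norm' ?_ h
  filter_upwards [eventually_ge_atTop 1] with S hS
  exact intervalIntegral.norm_integral_le_of_norm_le_const fun θ hθ =>
    hf S hS θ (uIoc_subset_uIcc hθ)

/-- Green's identity is summed over the two strips. The shared horizontal edges cancel by the
matching lemmas and the vertical edges vanish in the limit. Decay suffices in place of compact
support, which the potential representation requires. -/
theorem integral_regularPart_mul_laplacian (hα : α ∈ Ioo 0 (π / 2)) (hφ : IsDecayingTest φ) :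
    ∫ z, regularPart α z * Laplacian.laplacian φ z =
      2 * π * ∫ z in outerSector α, sectorDensity α z * φ z := by
  have h0 := hα.1
  have h1 := hα.2
  obtain ⟨V, hV⟩ := exists_isInnerExtension hα
  obtain ⟨C, hC⟩ := hφ.decay_laplacian
  have hk := two_lt_pi_div hα
  have hint1 : Integrable fun z => regularPart α z * Laplacian.laplacian φ z :=
    integrable_regularPart_mul hα hφ.continuous_laplacian.measurable hC
  have hint2 : Integrable fun z => 2 * π * (sectorDensity α z * φ z) :=
    (hφ.integrable_sectorDensity_mul hα).const_mul _
  have hm := measurableSet_outerSector α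
  have T1 := tendsto_integral_exp (-(2 * α)) (hint1.indicator hm.compl)
  have T2 := tendsto_integral_exp (-(2 * α)) ((hint1.sub hint2).indicator hm)
  set Φ : ℂ → ℝ := fun w => φ (Complex.exp w) with hΦ
  have hΦc : ContDiff ℝ 2 Φ := hφ.contDiff.comp contDiff_exp_real
  obtain ⟨A, hA⟩ := hφ.exists_greenField_bound (2 * (π / α) + 4) (by linarith)
  have hre : ∀ x y : ℝ, ((x : ℂ) + y * Complex.I).re = x := fun x y => by simp
  have him : ∀ x y : ℝ, ((x : ℂ) + y * Complex.I).im = y := fun x y => by simp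
  have hVb : ∀ S : ℝ, 1 ≤ S → ∀ x θ : ℝ, |x| = S →
      |greenField V Φ 1 (x + θ * Complex.I)| ≤ A * ((1 + S) * Real.exp (-S)) := by
    intro S hS x θ hx
    have hb := hV.bounds hα (w := x + θ * Complex.I) (by rw [hre, hx]; exact hS)
    exact hA V _ S hS (by rw [hre, hx]) hb.1 hb.2
  have hOb : ∀ S : ℝ, 1 ≤ S → ∀ x θ : ℝ, |x| = S →
      |greenField (outerFun α) Φ 1 (x + θ * Complex.I)| ≤ A * ((1 + S) * Real.exp (-S)) := by
    intro S hS x θ hx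
    have hb := outerFun_bounds hα (w := x + θ * Complex.I) (by rw [hre, hx]; exact hS)
    exact hA _ _ S hS (by rw [hre, hx]) hb.1 hb.2
  have e1 : Tendsto (fun S : ℝ => ∫ θ in -(2 * α)..(2 * α),
      greenField V Φ 1 (S + θ * Complex.I)) atTop (𝓝 0) :=
    tendsto_integral_side fun S hS θ _ => hVb S hS S θ (abs_of_pos (by linarith))
  have e2 : Tendsto (fun S : ℝ => ∫ θ in -(2 * α)..(2 * α),
      greenField V Φ 1 ((-S : ℝ) + θ * Complex.I)) atTop (𝓝 0) :=
    tendsto_integral_side fun S hS θ _ => hVb S hS (-S) θ (by rw [abs_neg, abs_of_pos (by linarith)])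
  have e3 : Tendsto (fun S : ℝ => ∫ θ in (2 * α)..(2 * π - 2 * α),
      greenField (outerFun α) Φ 1 (S + θ * Complex.I)) atTop (𝓝 0) :=
    tendsto_integral_side fun S hS θ _ => hOb S hS S θ (abs_of_pos (by linarith))
  have e4 : Tendsto (fun S : ℝ => ∫ θ in (2 * α)..(2 * π - 2 * α),
      greenField (outerFun α) Φ 1 ((-S : ℝ) + θ * Complex.I)) atTop (𝓝 0) :=
    tendsto_integral_side fun S hS θ _ => hOb S hS (-S) θ (by rw [abs_neg, abs_of_pos (by linarith)])
  have hlim := ((e1.sub e2).add e3).sub e4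
  rw [sub_zero, add_zero, sub_zero] at hlim
  have hsum := T1.add T2
  have huniq := tendsto_nhds_unique hsum (hlim.congr fun S => ?_)
  · rw [← integral_add (hint1.indicator hm.compl) ((hint1.sub hint2).indicator hm)] at huniq
    have e5 : (fun z => (outerSector α)ᶜ.indicator
        (fun z => regularPart α z * Laplacian.laplacian φ z) z +
        (outerSector α).indicator ((fun z => regularPart α z * Laplacian.laplacian φ z) -
          fun z => 2 * π * (sectorDensity α z * φ z)) z) =
        fun z => regularPart α z * Laplacian.laplacian φ z -
          (outerSector α).indicator (fun z => 2 * π * (sectorDensity α z * φ z)) z := by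
      funext z
      by_cases hz : z ∈ outerSector α <;> simp [hz]
    rw [e5, integral_sub hint1 (hint2.indicator hm), integral_indicator hm,
      integral_const_mul] at huniq
    linarith
  · have g1 := green_rectangle (V := V) (Φ := Φ) (x₁ := -S) (x₂ := S) (y₁ := -(2 * α)) (y₂ := 2 * α)
      (fun x _ y hy => (hV.harmonicAt _ (by
        rw [uIcc_of_le (by linarith)] at hy; rw [him]; exact abs_le.2 hy)).1)
      (fun x _ y _ => hΦc.contDiffAt)
    have g2 := green_rectangle (V := outerFun α) (Φ := Φ) (x₁ := -S) (x₂ := S) (y₁ := 2 * α)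
      (y₂ := 2 * π - 2 * α)
      (fun x _ y hy => contDiffAt_outerFun (poleExp_ne_zero_of_outer hα (by
        rw [uIcc_of_le (by linarith)] at hy; rw [him]; exact hy)))
      (fun x _ y _ => hΦc.contDiffAt)
    -- After this rewriting the horizontal edges of the inner rectangle are the negatives of those
    -- of the outer one.
    simp only [greenField_match_upper hα hV, hΦ, greenField_match_lower hα hV] at g1
    have s1 : ∫ s in (-S)..S, ∫ θ in -(2 * α)..(-(2 * α) + 2 * π),
        ‖Complex.exp (s + θ * Complex.I)‖ ^ 2 * (outerSector α)ᶜ.indicator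
          (fun z => regularPart α z * Laplacian.laplacian φ z)
          (Complex.exp (s + θ * Complex.I)) = ∫ s in (-S)..S, ∫ θ in -(2 * α)..(2 * α),
        (V (s + θ * Complex.I) *
          Laplacian.laplacian (fun w => φ (Complex.exp w)) (s + θ * Complex.I) -
        φ (Complex.exp (s + θ * Complex.I)) * Laplacian.laplacian V (s + θ * Complex.I)) := by
      -- The exceptional slice s = 0 contains the poles and has measure zero.
      refine intervalIntegral.integral_congr_ae ?_
      filter_upwards [Measure.ae_ne volume (0:ℝ)] with s hs _
      exact integral_inner_slice hα hφ.contDiff hV hs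
    have s2 : ∫ s in (-S)..S, ∫ θ in -(2 * α)..(-(2 * α) + 2 * π),
        ‖Complex.exp (s + θ * Complex.I)‖ ^ 2 * (outerSector α).indicator
          ((fun z => regularPart α z * Laplacian.laplacian φ z) -
            fun z => 2 * π * (sectorDensity α z * φ z))
          (Complex.exp (s + θ * Complex.I)) = _ :=
      intervalIntegral.integral_congr fun s _ => integral_outer_slice hα hφ.contDiff s
    rw [s1, s2, g1, g2]
    ring

end slices

/-! ### The regularized logarithm -/

/-- The regularization `½ log (|z - a|² + ε²)` of `log |z - a|`. -/
noncomputable def regLog (ε : ℝ) (a z : ℂ) : ℝ := 1 / 2 * Real.log (‖z - a‖ ^ 2 + ε ^ 2)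

theorem regLog_arg_pos {ε : ℝ} (hε : 0 < ε) (a z : ℂ) : 0 < ‖z - a‖ ^ 2 + ε ^ 2 := by positivity

theorem contDiff_norm_sub_sq_add {n : WithTop ℕ∞} (ε : ℝ) (a : ℂ) :
    ContDiff ℝ n fun z : ℂ => ‖z - a‖ ^ 2 + ε ^ 2 :=
  ((contDiff_id.sub contDiff_const).norm_sq ℝ).add contDiff_const

theorem contDiff_regLog {n : WithTop ℕ∞} {ε : ℝ} (hε : 0 < ε) (a : ℂ) :
    ContDiff ℝ n (regLog ε a) :=
  contDiff_const.mul ((contDiff_norm_sub_sq_add ε a).log fun z => (regLog_arg_pos hε a z).ne')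

theorem hasFDerivAt_norm_sub_sq (a z : ℂ) :
    HasFDerivAt (fun z : ℂ => ‖z - a‖ ^ 2) (2 • innerSL ℝ (z - a)) z := by
  simpa using ((hasFDerivAt_id z).sub_const a).norm_sq

theorem fderiv_regLog {ε : ℝ} (hε : 0 < ε) (a z v : ℂ) :
    fderiv ℝ (regLog ε a) z v = inner ℝ (z - a) v / (‖z - a‖ ^ 2 + ε ^ 2) := by
  have h := (((hasFDerivAt_norm_sub_sq a z).add_const (ε ^ 2)).log
    (regLog_arg_pos hε a z).ne').const_mul (1 / 2 : ℝ)
  change fderiv ℝ (fun z => 1 / 2 * Real.log (‖z - a‖ ^ 2 + ε ^ 2)) z v = _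
  rw [h.fderiv]
  simp only [smul_apply, innerSL_apply_apply, smul_eq_mul, nsmul_eq_mul]
  have := (regLog_arg_pos hε a z).ne'
  field_simp
  simp

theorem fderiv_fderiv_regLog {ε : ℝ} (hε : 0 < ε) (a z v : ℂ) :
    fderiv ℝ (fderiv ℝ (regLog ε a)) z v v =
      (‖v‖ ^ 2 * (‖z - a‖ ^ 2 + ε ^ 2) - 2 * inner ℝ (z - a) v ^ 2) /
        (‖z - a‖ ^ 2 + ε ^ 2) ^ 2 := by
  rw [← fderiv_fderiv_apply (contDiff_regLog hε a).contDiffAt,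
    funext fun z => fderiv_regLog hε a z v]
  have hq := (regLog_arg_pos hε a z).ne'
  have h1 : HasFDerivAt (fun z : ℂ => inner ℝ (z - a) v) (innerSL ℝ v) z := by
    have := (innerSL ℝ v).hasFDerivAt.comp z ((hasFDerivAt_id z).sub_const a)
    simp only [Function.comp_def, innerSL_apply_apply, id, ContinuousLinearMap.comp_id] at this
    simpa only [real_inner_comm] using this
  have h2 := (hasFDerivAt_norm_sub_sq a z).add_const (ε ^ 2)
  have h3 := h1.mul ((hasDerivAt_inv hq).comp_hasFDerivAt z h2)
  have h4 : HasFDerivAt (fun z : ℂ => inner ℝ (z - a) v / (‖z - a‖ ^ 2 + ε ^ 2)) _ z :=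
    h3.congr_of_eventuallyEq (Eventually.of_forall fun z => div_eq_mul_inv _ _)
  rw [h4.fderiv]
  simp only [smul_apply, add_apply, innerSL_apply_apply, smul_eq_mul, nsmul_eq_mul,
    real_inner_self_eq_norm_sq, Function.comp]
  push_cast
  field_simp
  ring

/-- Equal to 2ε⁻² `decayWeight` ((z - a)/ε): a rescaled kernel of total mass 2π, concentrating at a
as ε → 0. -/
theorem laplacian_regLog {ε : ℝ} (hε : 0 < ε) (a z : ℂ) :
    Laplacian.laplacian (regLog ε a) z = 2 * ε ^ 2 / (‖z - a‖ ^ 2 + ε ^ 2) ^ 2 := by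
  have hq := (regLog_arg_pos hε a z).ne'
  rw [laplacian_eq_fderiv, fderiv_fderiv_regLog hε, fderiv_fderiv_regLog hε, ← add_div]
  congr 1
  simp only [Complex.inner, norm_one, Complex.norm_I, ← Complex.normSq_eq_norm_sq,
    Complex.normSq_apply]
  simp
  ring

theorem continuous_laplacian_regLog {ε : ℝ} (hε : 0 < ε) (a : ℂ) :
    Continuous (Laplacian.laplacian (regLog ε a)) := by
  rw [funext (laplacian_regLog hε a)]
  exact continuous_const.div (by fun_prop) fun z => by have := regLog_arg_pos hε a z; positivity

/-- The denominators of the regularized logarithm dominate `|z|²`. -/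
theorem norm_sq_le_mul_regLog_arg {ε : ℝ} (hε : 0 < ε) (a z : ℂ) :
    ‖z‖ ^ 2 ≤ (2 + 2 * ‖a‖ ^ 2 / ε ^ 2) * (‖z - a‖ ^ 2 + ε ^ 2) := by
  have h1 : ‖z‖ ≤ ‖z - a‖ + ‖a‖ := by simpa using norm_add_le (z - a) a
  have h2 : ‖z‖ ^ 2 ≤ 2 * ‖z - a‖ ^ 2 + 2 * ‖a‖ ^ 2 := by
    nlinarith [sq_nonneg (‖z - a‖ - ‖a‖), norm_nonneg z, norm_nonneg (z - a), norm_nonneg a]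
  have h3 : 2 * ‖a‖ ^ 2 / ε ^ 2 * ε ^ 2 = 2 * ‖a‖ ^ 2 := by field_simp
  have h4 : 0 ≤ 2 * ‖a‖ ^ 2 / ε ^ 2 * ‖z - a‖ ^ 2 := by positivity
  nlinarith [sq_nonneg ε]

theorem exists_laplacian_regLog_le {ε : ℝ} (hε : 0 < ε) (a : ℂ) :
    ∃ C, ∀ z, |Laplacian.laplacian (regLog ε a) z| ≤ C * decayWeight z := by
  set B := (2 + 2 * ‖a‖ ^ 2 / ε ^ 2) + 1 / ε ^ 2 with hB
  have hB0 : 0 < B := by positivity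
  refine ⟨2 * ε ^ 2 * B ^ 2, fun z => ?_⟩
  have hq := regLog_arg_pos hε a z
  rw [laplacian_regLog hε, abs_of_nonneg (by positivity), decayWeight, ← div_eq_mul_inv]
  rw [div_le_div_iff₀ (by positivity) (by positivity)]
  have h1 := norm_sq_le_mul_regLog_arg hε a z
  have h2 : 1 ≤ 1 / ε ^ 2 * (‖z - a‖ ^ 2 + ε ^ 2) := by
    rw [div_mul_eq_mul_div, one_mul, one_le_div (by positivity)]
    nlinarith [sq_nonneg ‖z - a‖]
  have h3 : 1 + ‖z‖ ^ 2 ≤ B * (‖z - a‖ ^ 2 + ε ^ 2) := by rw [hB, add_mul]; linarith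
  calc 2 * ε ^ 2 * (1 + ‖z‖ ^ 2) ^ 2 ≤ 2 * ε ^ 2 * (B * (‖z - a‖ ^ 2 + ε ^ 2)) ^ 2 := by gcongr
    _ = _ := by ring

theorem abs_log_sub_log_le {x y m : ℝ} (hm : 0 < m) (hx : m ≤ x) (hy : m ≤ y) :
    |Real.log x - Real.log y| ≤ |x - y| / m := by
  wlog h : y ≤ x generalizing x y
  · rw [abs_sub_comm, abs_sub_comm x]
    exact this hy hx (not_le.1 h).le
  have hx0 : 0 < x := by linarith
  have hy0 : 0 < y := by linarith
  rw [abs_of_nonneg (sub_nonneg.2 (Real.log_le_log hy0 h)), abs_of_nonneg (sub_nonneg.2 h),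
    ← Real.log_div hx0.ne' hy0.ne']
  have h1 := Real.log_le_sub_one_of_pos (div_pos hx0 hy0)
  have h2 : x / y - 1 = (x - y) / y := by field_simp
  rw [h2] at h1
  exact h1.trans (div_le_div_of_nonneg_left (sub_nonneg.2 h) hm hy)

/-- Each regularized logarithm grows at infinity. The two quantities under the logarithms are of
order |z|² and differ by O(|z|), so the difference gains a factor |z|⁻¹, and likewise for its
gradient. -/
theorem isDecayingTest_regLog_sub {ε : ℝ} (hε : 0 < ε) (a : ℂ) :
    IsDecayingTest (regLog ε a - regLog ε 0) := by
  set B := 2 + 2 * ‖a‖ ^ 2 / ε ^ 2 with hB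
  have hB1 : 1 ≤ B := by
    have : 0 ≤ 2 * ‖a‖ ^ 2 / ε ^ 2 := by positivity
    linarith
  set K := ‖a‖ * (2 + ‖a‖) with hK
  have hK0 : 0 ≤ K := by positivity
  have hq : ∀ z : ℂ, ‖z‖ ^ 2 ≤ B * (‖z - a‖ ^ 2 + ε ^ 2) := norm_sq_le_mul_regLog_arg hε a
  have hdiff : ∀ z : ℂ, 1 ≤ ‖z‖ →
      |(‖z - a‖ ^ 2 + ε ^ 2) - (‖z - 0‖ ^ 2 + ε ^ 2)| ≤ K * ‖z‖ := fun z hz => by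
    rw [sub_zero, add_sub_add_right_eq_sub, sq_sub_sq, abs_mul]
    have h1 : |‖z - a‖ - ‖z‖| ≤ ‖a‖ := by
      have := abs_norm_sub_norm_le (z - a) z
      rwa [sub_sub_cancel_left, norm_neg] at this
    have h2 : |‖z - a‖ + ‖z‖| ≤ (2 + ‖a‖) * ‖z‖ := by
      rw [abs_of_nonneg (by positivity)]
      have := norm_sub_le z a
      nlinarith [norm_nonneg a]
    calc |‖z - a‖ + ‖z‖| * |‖z - a‖ - ‖z‖| ≤ (2 + ‖a‖) * ‖z‖ * ‖a‖ := by gcongr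
      _ = _ := by rw [hK]; ring
  refine ⟨(contDiff_regLog hε a).sub (contDiff_regLog hε 0), ⟨K * B / 2, fun z hz => ?_⟩,
    ⟨(K + ‖a‖) * B, fun z hz => ?_⟩, ?_⟩
  · have hz0 : 0 < ‖z‖ := by linarith
    have h1 : ‖z‖ ^ 2 / B ≤ ‖z - a‖ ^ 2 + ε ^ 2 := by
      rw [div_le_iff₀ (by linarith)]; linarith [hq z]
    have h2 : ‖z‖ ^ 2 / B ≤ ‖z - 0‖ ^ 2 + ε ^ 2 := by
      rw [sub_zero]
      exact (div_le_self (by positivity) hB1).trans (by nlinarith [sq_nonneg ε])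
    have h3 := abs_log_sub_log_le (by positivity) h1 h2
    have h4 := h3.trans (div_le_div_of_nonneg_right (hdiff z hz) (by positivity))
    rw [Pi.sub_apply, regLog, regLog, ← mul_sub, abs_mul, abs_of_pos (by norm_num : (0:ℝ) < 1 / 2)]
    calc _ ≤ 1 / 2 * (K * ‖z‖ / (‖z‖ ^ 2 / B)) := by gcongr
      _ = _ := by field_simp
  · have hz0 : 0 < ‖z‖ := by linarith
    have hq1 := regLog_arg_pos hε a z
    have hq0 := regLog_arg_pos hε 0 z
    refine ContinuousLinearMap.opNorm_le_bound _ (by positivity) fun v => ?_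
    -- Over the common denominator the leading terms cancel, leaving a numerator bounded by a
    -- multiple of ‖z‖² + ε².
    have e : fderiv ℝ (regLog ε a - regLog ε 0) z v = inner ℝ (((‖z - 0‖ ^ 2 + ε ^ 2) -
        (‖z - a‖ ^ 2 + ε ^ 2)) • z - (‖z - 0‖ ^ 2 + ε ^ 2) • a) v /
        ((‖z - a‖ ^ 2 + ε ^ 2) * (‖z - 0‖ ^ 2 + ε ^ 2)) := by
      rw [fderiv_sub ((contDiff_regLog (n := 1) hε a).differentiable (by norm_num) z)
        ((contDiff_regLog (n := 1) hε 0).differentiable (by norm_num) z), sub_apply,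
        fderiv_regLog hε, fderiv_regLog hε, div_sub_div _ _ hq1.ne' hq0.ne']
      congr 1
      simp only [inner_sub_left, real_inner_smul_left, inner_zero_left]
      ring
    have hnum : ‖((‖z - 0‖ ^ 2 + ε ^ 2) - (‖z - a‖ ^ 2 + ε ^ 2)) • z - (‖z - 0‖ ^ 2 + ε ^ 2) • a‖ ≤
        (K + ‖a‖) * (‖z - 0‖ ^ 2 + ε ^ 2) := by
      refine (norm_sub_le _ _).trans ?_
      rw [norm_smul, norm_smul, Real.norm_eq_abs, Real.norm_of_nonneg hq0.le, abs_sub_comm]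
      have h5 : K * ‖z‖ * ‖z‖ ≤ K * (‖z - 0‖ ^ 2 + ε ^ 2) := by
        rw [sub_zero, mul_assoc]
        gcongr
        nlinarith [sq_nonneg ε]
      have := mul_le_mul_of_nonneg_right (hdiff z hz) hz0.le
      nlinarith
    rw [e, Real.norm_eq_abs, abs_div, abs_of_pos (mul_pos hq1 hq0), div_le_iff₀ (by positivity)]
    refine (abs_real_inner_le_norm _ _).trans ?_
    refine (mul_le_mul_of_nonneg_right hnum (norm_nonneg v)).trans ?_
    have h6 : 1 ≤ B / ‖z‖ ^ 2 * (‖z - a‖ ^ 2 + ε ^ 2) := by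
      rw [div_mul_eq_mul_div, one_le_div (by positivity)]; exact hq z
    have h7 : 0 ≤ (K + ‖a‖) * (‖z - 0‖ ^ 2 + ε ^ 2) * ‖v‖ := by positivity
    calc (K + ‖a‖) * (‖z - 0‖ ^ 2 + ε ^ 2) * ‖v‖
        ≤ (K + ‖a‖) * (‖z - 0‖ ^ 2 + ε ^ 2) * ‖v‖ * (B / ‖z‖ ^ 2 * (‖z - a‖ ^ 2 + ε ^ 2)) :=
          le_mul_of_one_le_right h7 h6
      _ = _ := by ring
  · obtain ⟨C1, h1⟩ := exists_laplacian_regLog_le hε a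
    obtain ⟨C2, h2⟩ := exists_laplacian_regLog_le hε 0
    refine ⟨C1 + C2, fun z => ?_⟩
    rw [(contDiff_regLog hε a).contDiffAt.laplacian_sub (contDiff_regLog hε 0).contDiffAt, add_mul]
    exact (abs_sub _ _).trans (add_le_add (h1 z) (h2 z))

/-- Bounds uniform in ε ≤ 1: log|z - a| lies below, and (1 + |z - a|)² dominates the argument of the
logarithm. They provide the majorant for ε → 0. -/
theorem abs_regLog_le {ε : ℝ} (hε : ε ∈ Ioc 0 1) {a z : ℂ} (hz : z ≠ a) :
    |regLog ε a z| ≤ |Real.log ‖z - a‖| + ‖z - a‖ := by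
  have hp : 0 < ‖z - a‖ := norm_pos_iff.2 (sub_ne_zero.2 hz)
  have h1 : Real.log ‖z - a‖ ≤ regLog ε a z := by
    have e : Real.log ‖z - a‖ = 1 / 2 * Real.log (‖z - a‖ ^ 2) := by
      rw [Real.log_pow]; push_cast; ring
    rw [e, regLog]
    gcongr
    linarith [sq_nonneg ε]
  have h2 : regLog ε a z ≤ ‖z - a‖ := by
    have e : Real.log ((1 + ‖z - a‖) ^ 2) = 2 * Real.log (1 + ‖z - a‖) := by
      rw [Real.log_pow]; push_cast; ring
    have h3 : Real.log (‖z - a‖ ^ 2 + ε ^ 2) ≤ Real.log ((1 + ‖z - a‖) ^ 2) := by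
      refine Real.log_le_log (regLog_arg_pos hε.1 a z) ?_
      nlinarith [hε.1, hε.2]
    have := Real.log_le_sub_one_of_pos (by linarith : 0 < 1 + ‖z - a‖)
    rw [regLog]
    linarith
  rw [abs_le]
  have := neg_abs_le (Real.log ‖z - a‖)
  have := abs_nonneg (Real.log ‖z - a‖)
  constructor <;> linarith

theorem tendsto_regLog {a z : ℂ} (hz : z ≠ a) :
    Tendsto (fun ε => regLog ε a z) (𝓝[>] 0) (𝓝 (Real.log ‖z - a‖)) := by
  have hp : 0 < ‖z - a‖ := norm_pos_iff.2 (sub_ne_zero.2 hz)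
  have h : ContinuousAt (fun ε : ℝ => regLog ε a z) 0 := by
    unfold regLog
    refine continuousAt_const.mul (ContinuousAt.log (by fun_prop) ?_)
    positivity
  have e : regLog 0 a z = Real.log ‖z - a‖ := by
    rw [regLog, zero_pow two_ne_zero, add_zero, Real.log_pow]; push_cast; ring
  rw [← e]
  exact h.tendsto.mono_left nhdsWithin_le_nhds

/-- An integrable majorant of the regularized logarithms times a decaying function. -/
theorem integrable_regLog_majorant (a : ℂ) (C : ℝ) :
    Integrable fun z : ℂ => (|Real.log ‖z - a‖| * decayWeight z +
      (1 + ‖a‖) * ((1 + ‖z‖) * decayWeight z)) * |C| :=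
  ((integrable_abs_log_norm_mul_decayWeight a).add
    (integrable_one_add_norm_mul_decayWeight.const_mul (1 + ‖a‖))).mul_const |C|

theorem norm_regLog_mul_le {ε : ℝ} (hε : ε ∈ Ioc 0 1) {a : ℂ} {g : ℂ → ℝ} {C : ℝ}
    (hC : ∀ z, |g z| ≤ C * decayWeight z) {z : ℂ} (hz : z ≠ a) :
    ‖regLog ε a z * g z‖ ≤ (|Real.log ‖z - a‖| * decayWeight z +
      (1 + ‖a‖) * ((1 + ‖z‖) * decayWeight z)) * |C| := by
  have hw := decayWeight_nonneg z
  have h1 := abs_regLog_le hε hz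
  have h2 := norm_sub_le z a
  have h3 : |g z| ≤ |C| * decayWeight z := (hC z).trans (by gcongr; exact le_abs_self C)
  have h4 : |regLog ε a z| ≤ |Real.log ‖z - a‖| + (1 + ‖a‖) * (1 + ‖z‖) := by
    nlinarith [mul_nonneg (norm_nonneg a) (norm_nonneg z)]
  rw [Real.norm_eq_abs, abs_mul]
  calc |regLog ε a z| * |g z|
      ≤ (|Real.log ‖z - a‖| + (1 + ‖a‖) * (1 + ‖z‖)) * (|C| * decayWeight z) := by gcongr
    _ = _ := by ring

theorem measurable_regLog (ε : ℝ) (a : ℂ) : Measurable (regLog ε a) := by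
  unfold regLog
  exact (Real.measurable_log.comp (by fun_prop)).const_mul _

theorem integrable_regLog_mul {ε : ℝ} (hε : ε ∈ Ioc 0 1) (a : ℂ) {g : ℂ → ℝ} (hg : Measurable g)
    {C : ℝ} (hC : ∀ z, |g z| ≤ C * decayWeight z) : Integrable fun z => regLog ε a z * g z := by
  refine (integrable_regLog_majorant a C).mono' ((measurable_regLog ε a).mul hg).aestronglyMeasurable ?_
  filter_upwards [Measure.ae_ne volume a] with z hz
  exact norm_regLog_mul_le hε hC hz

theorem tendsto_integral_regLog_mul (a : ℂ) {g : ℂ → ℝ} (hg : Measurable g) {C : ℝ}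
    (hC : ∀ z, |g z| ≤ C * decayWeight z) :
    Tendsto (fun ε => ∫ z, regLog ε a z * g z) (𝓝[>] 0) (𝓝 (∫ z, Real.log ‖z - a‖ * g z)) := by
  refine tendsto_integral_filter_of_dominated_convergence _ ?_ ?_ (integrable_regLog_majorant a C) ?_
  · exact Eventually.of_forall fun ε => ((measurable_regLog ε a).mul hg).aestronglyMeasurable
  · filter_upwards [Ioc_mem_nhdsGT (zero_lt_one' ℝ)] with ε hε
    filter_upwards [Measure.ae_ne volume a] with z hz
    exact norm_regLog_mul_le hε hC hz
  · filter_upwards [Measure.ae_ne volume a] with z hz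
    exact (tendsto_regLog hz).mul_const _

/-! ### The regularized logarithm as an approximate fundamental solution -/

/-- Polar coordinates with the radial antiderivative -½(1 + r²)⁻¹. This value fixes the constant 2π
of the fundamental solution. -/
theorem integral_decayWeight : ∫ z, decayWeight z = π := by
  have h := integral_fun_norm_addHaar (E := ℂ) volume (fun r : ℝ => ((1 + r ^ 2) ^ 2)⁻¹)
  have hd : ∀ y : ℝ, HasDerivAt (fun y : ℝ => -(1 / 2) * (1 + y ^ 2)⁻¹) (y * ((1 + y ^ 2) ^ 2)⁻¹) y := by
    intro y
    have h1 : HasDerivAt (fun y : ℝ => 1 + y ^ 2) (2 * y) y := by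
      simpa using (hasDerivAt_pow 2 y).const_add 1
    have h2 := (h1.fun_inv (by positivity)).const_mul (-(1 / 2) : ℝ)
    refine h2.congr_deriv ?_
    field_simp
  have ht : Tendsto (fun y : ℝ => -(1 / 2) * (1 + y ^ 2)⁻¹) atTop (𝓝 0) := by
    have : Tendsto (fun y : ℝ => 1 + y ^ 2) atTop atTop :=
      tendsto_atTop_add_const_left _ _ (tendsto_pow_atTop two_ne_zero)
    simpa using this.inv_tendsto_atTop.const_mul (-(1 / 2) : ℝ)
  have hi := integral_Ioi_of_hasDerivAt_of_nonneg' (a := 0) (fun y _ => hd y)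
    (fun y hy => by have := mem_Ioi.1 hy; positivity) ht
  rw [Complex.finrank_real_complex] at h
  simp only [Nat.add_one_sub_one, pow_one, smul_eq_mul, hi] at h
  have hv : (volume : Measure ℂ).real (Metric.ball 0 1) = π := by
    rw [Measure.real, Complex.volume_ball]
    simp
  rw [hv] at h
  change ∫ z : ℂ, ((1 + ‖z‖ ^ 2) ^ 2)⁻¹ = π
  rw [h]
  norm_num
  ring

theorem integral_mul_laplacian_regLog (V : ℂ → ℝ) (a : ℂ) {ε : ℝ} (hε : 0 < ε) :
    ∫ z, V z * Laplacian.laplacian (regLog ε a) z = ∫ v, V (a + ε • v) * (2 * decayWeight v) := by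
  have h1 := integral_add_left_eq_self (μ := (volume : Measure ℂ))
    (fun z => V z * Laplacian.laplacian (regLog ε a) z) a
  have h2 := Measure.integral_comp_smul (volume : Measure ℂ)
    (fun z => V (a + z) * Laplacian.laplacian (regLog ε a) (a + z)) ε
  rw [Complex.finrank_real_complex, h1, abs_of_pos (by positivity), smul_eq_mul] at h2
  have hε2 : ε ^ 2 ≠ 0 := by positivity
  rw [eq_comm, inv_mul_eq_iff_eq_mul₀ hε2] at h2
  rw [h2, ← integral_const_mul]
  refine integral_congr_ae (Eventually.of_forall fun v => ?_)
  simp only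
  rw [laplacian_regLog hε, decayWeight, add_sub_cancel_left, norm_smul, Real.norm_of_nonneg hε.le]
  have e : (ε * ‖v‖) ^ 2 + ε ^ 2 = ε ^ 2 * (1 + ‖v‖ ^ 2) := by ring
  rw [e]
  field_simp

/-- An approximate identity with polynomial tails: after rescaling, linear growth of V is integrable
against the kernel, and dominated convergence needs continuity only at a. -/
theorem tendsto_integral_mul_laplacian_regLog {V : ℂ → ℝ} (hV : Measurable V) {C : ℝ}
    (hC0 : 0 ≤ C) (hC : ∀ z, |V z| ≤ C * (1 + ‖z‖)) {a : ℂ} (ha : ContinuousAt V a) :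
    Tendsto (fun ε => ∫ z, V z * Laplacian.laplacian (regLog ε a) z) (𝓝[>] 0)
      (𝓝 (2 * π * V a)) := by
  have hlim : Tendsto (fun ε : ℝ => ∫ v, V (a + ε • v) * (2 * decayWeight v)) (𝓝[>] 0)
      (𝓝 (∫ v, V a * (2 * decayWeight v))) := by
    refine tendsto_integral_filter_of_dominated_convergence
      (fun v => 2 * C * (1 + ‖a‖) * ((1 + ‖v‖) * decayWeight v)) ?_ ?_
      (integrable_one_add_norm_mul_decayWeight.const_mul _) ?_
    · exact Eventually.of_forall fun ε => ((hV.comp (by fun_prop)).mul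
        (continuous_decayWeight.measurable.const_mul 2)).aestronglyMeasurable
    · filter_upwards [Ioc_mem_nhdsGT (zero_lt_one' ℝ)] with ε hε
      refine Eventually.of_forall fun v => ?_
      have hw := decayWeight_nonneg v
      have hn : ‖a + ε • v‖ ≤ ‖a‖ + ‖v‖ := by
        refine (norm_add_le _ _).trans ?_
        rw [norm_smul, Real.norm_of_nonneg hε.1.le]
        nlinarith [hε.2, norm_nonneg v]
      rw [Real.norm_eq_abs, abs_mul, abs_of_nonneg (by positivity : 0 ≤ 2 * decayWeight v)]
      calc |V (a + ε • v)| * (2 * decayWeight v)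
          ≤ C * (1 + ‖a + ε • v‖) * (2 * decayWeight v) := by gcongr; exact hC _
        _ ≤ C * ((1 + ‖a‖) * (1 + ‖v‖)) * (2 * decayWeight v) := by
          gcongr; nlinarith [mul_nonneg (norm_nonneg a) (norm_nonneg v)]
        _ = _ := by ring
    · refine Eventually.of_forall fun v => Tendsto.mul_const _ ?_
      have h1 : Tendsto (fun ε : ℝ => a + ε • v) (𝓝 0) (𝓝 a) := by
        have : Continuous fun ε : ℝ => a + ε • v := by fun_prop
        simpa using this.tendsto 0
      exact ha.tendsto.comp (h1.mono_left nhdsWithin_le_nhds)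
  rw [integral_const_mul, integral_const_mul, integral_decayWeight] at hlim
  have e : V a * (2 * π) = 2 * π * V a := by ring
  rw [e] at hlim
  refine hlim.congr' ?_
  filter_upwards [self_mem_nhdsWithin] with ε hε
  exact (integral_mul_laplacian_regLog V a hε).symm

/-! ### Compactly supported test functions -/

theorem integral_mul_laplacian_comm {f φ : ℂ → ℝ} (hf : ContDiff ℝ 2 f) (hφ : ContDiff ℝ 2 φ)
    (hc : HasCompactSupport φ) :
    ∫ z, f z * Laplacian.laplacian φ z = ∫ z, φ z * Laplacian.laplacian f z := by
  have hf1 : ContDiff ℝ 1 (fderiv ℝ f) := hf.fderiv_right (by norm_num)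
  have hφ1 : ContDiff ℝ 1 (fderiv ℝ φ) := hφ.fderiv_right (by norm_num)
  have c1 : ∀ v, ContDiff ℝ 1 fun z => fderiv ℝ f z v := fun v => hf1.clm_apply contDiff_const
  have c2 : ∀ v, ContDiff ℝ 1 fun z => fderiv ℝ φ z v := fun v => hφ1.clm_apply contDiff_const
  have s1 : ∀ v, HasCompactSupport fun z => fderiv ℝ φ z v := fun v =>
    hc.fderiv_apply ℝ v
  have s2 : ∀ v, HasCompactSupport fun z => fderiv ℝ (fun z => fderiv ℝ φ z v) z v := fun v =>
    (s1 v).fderiv_apply ℝ v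
  have k1 : ∀ v, Continuous fun z => fderiv ℝ (fun z => fderiv ℝ f z v) z v := fun v =>
    ((c1 v).continuous_fderiv (by norm_num)).clm_apply continuous_const
  have k2 : ∀ v, Continuous fun z => fderiv ℝ (fun z => fderiv ℝ φ z v) z v := fun v =>
    ((c2 v).continuous_fderiv (by norm_num)).clm_apply continuous_const
  have hint : ∀ {g h : ℂ → ℝ}, Continuous g → Continuous h → HasCompactSupport h →
      Integrable fun z => g z * h z := fun hg hh hs =>
    (hg.mul hh).integrable_of_hasCompactSupport hs.mul_left
  have key : ∀ v : ℂ, ∫ z, f z * fderiv ℝ (fun z => fderiv ℝ φ z v) z v =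
      ∫ z, fderiv ℝ (fun z => fderiv ℝ f z v) z v * φ z := by
    intro v
    have e1 := integral_mul_fderiv_eq_neg_fderiv_mul_of_integrable (μ := (volume : Measure ℂ))
      (f := f) (g := fun z => fderiv ℝ φ z v) (v := v)
      (hint (c1 v).continuous (c2 v).continuous (s1 v))
      (hint hf.continuous (k2 v) (s2 v)) (hint hf.continuous (c2 v).continuous (s1 v))
      (fun z _ => hf.differentiable (by norm_num) z)
      (fun z _ => (c2 v).differentiable (by norm_num) z)
    have e2 := integral_mul_fderiv_eq_neg_fderiv_mul_of_integrable (μ := (volume : Measure ℂ))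
      (f := fun z => fderiv ℝ f z v) (g := φ) (v := v)
      (hint (k1 v) hφ.continuous hc)
      (hint (c1 v).continuous (c2 v).continuous (s1 v)) (hint (c1 v).continuous hφ.continuous hc)
      (fun z _ => (c1 v).differentiable (by norm_num) z)
      (fun z _ => hφ.differentiable (by norm_num) z)
    rw [e1, e2, neg_neg]
  simp only [laplacian_eq_fderiv, ← fderiv_fderiv_apply hf.contDiffAt,
    ← fderiv_fderiv_apply hφ.contDiffAt, mul_add]
  rw [integral_add (hint hf.continuous (k2 1) (s2 1))
    (hint hf.continuous (k2 Complex.I) (s2 Complex.I)), key, key, integral_add]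
  · simp only [mul_comm]
  · simpa only [mul_comm] using hint (k1 1) hφ.continuous hc
  · simpa only [mul_comm] using hint (k1 Complex.I) hφ.continuous hc

theorem hasCompactSupport_laplacian {φ : ℂ → ℝ} (hc : HasCompactSupport φ) :
    HasCompactSupport (Laplacian.laplacian φ) := by
  refine ((hc.fderiv ℝ).fderiv ℝ).mono' fun z hz => ?_
  refine subset_tsupport _ fun h => hz ?_
  rw [laplacian_eq_fderiv, h]
  simp

theorem exists_abs_mul_le_of_hasCompactSupport {p g : ℂ → ℝ} (hp : Continuous p)
    (hg : Continuous g) (hc : HasCompactSupport g) : ∃ C, ∀ z, |p z * g z| ≤ C := by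
  have h : HasCompactSupport fun z => p z * g z := hc.mul_left
  exact (hp.mul hg).bounded_above_of_compact_support h

theorem isDecayingTest_of_hasCompactSupport {φ : ℂ → ℝ} (hφ : ContDiff ℝ 2 φ)
    (hc : HasCompactSupport φ) : IsDecayingTest φ := by
  have h1 : ContDiff ℝ 1 (fderiv ℝ φ) := hφ.fderiv_right (by norm_num)
  have hL : Continuous (Laplacian.laplacian φ) := by
    have h2 := h1.continuous_fderiv (by norm_num)
    rw [funext (laplacian_eq_fderiv φ)]
    fun_prop
  refine ⟨hφ, ?_, ?_, ?_⟩
  · obtain ⟨C, hC⟩ := exists_abs_mul_le_of_hasCompactSupport continuous_norm hφ.continuous hc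
    refine ⟨C, fun z hz => ?_⟩
    have := hC z
    rw [abs_mul, abs_norm] at this
    rw [le_div_iff₀ (by linarith)]
    linarith
  · obtain ⟨C, hC⟩ := exists_abs_mul_le_of_hasCompactSupport (by fun_prop : Continuous fun z : ℂ => ‖z‖ ^ 2)
      h1.continuous.norm (hc.fderiv ℝ).norm
    refine ⟨C, fun z hz => ?_⟩
    have := hC z
    rw [abs_mul, abs_norm, abs_of_nonneg (by positivity)] at this
    rw [le_div_iff₀ (by positivity)]
    linarith
  · obtain ⟨C, hC⟩ := exists_abs_mul_le_of_hasCompactSupport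
      (by fun_prop : Continuous fun z : ℂ => (1 + ‖z‖ ^ 2) ^ 2) hL (hasCompactSupport_laplacian hc)
    refine ⟨C, fun z => ?_⟩
    have := hC z
    rw [abs_mul, abs_of_nonneg (by positivity)] at this
    rw [decayWeight, ← div_eq_mul_inv, le_div_iff₀ (by positivity)]
    linarith

/-- `(1 / 2π) log |z - a|` is a fundamental solution of the Laplace operator. -/
theorem integral_log_norm_sub_mul_laplacian {φ : ℂ → ℝ} (hφ : ContDiff ℝ 2 φ)
    (hc : HasCompactSupport φ) (a : ℂ) :
    ∫ z, Real.log ‖z - a‖ * Laplacian.laplacian φ z = 2 * π * φ a := by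
  have hd := isDecayingTest_of_hasCompactSupport hφ hc
  obtain ⟨C, hC⟩ := hd.decay_laplacian
  obtain ⟨M, hM, hb, -⟩ := hd.bounds
  have t1 := tendsto_integral_regLog_mul a hd.continuous_laplacian.measurable hC
  have t2 := tendsto_integral_mul_laplacian_regLog hφ.continuous.measurable hM
    (fun z => (hb z).1.trans (le_mul_of_one_le_right hM (by linarith [norm_nonneg z])))
    hφ.continuous.continuousAt (a := a)
  refine tendsto_nhds_unique t1 (t2.congr' ?_)
  filter_upwards [self_mem_nhdsWithin] with ε hε
  exact (integral_mul_laplacian_comm (contDiff_regLog hε a) hφ hc).symm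

/-! ### Representation of the regular part -/

/-- The values at the two poles are finite by convention and are absorbed into the constant, making
the bound valid everywhere. -/
theorem exists_regularPart_bound' {α : ℝ} (hα : α ∈ Ioo 0 (π / 2)) :
    ∃ C, 0 ≤ C ∧ ∀ z, |regularPart α z| ≤ C * (1 + ‖z‖) := by
  obtain ⟨C, hC0, hC⟩ := exists_regularPart_bound hα
  set a := Complex.exp (α * Complex.I)
  set b := Complex.exp (-(α * Complex.I))
  have ha := abs_nonneg (regularPart α a)
  have hb := abs_nonneg (regularPart α b)
  refine ⟨C + |regularPart α a| + |regularPart α b|, by positivity, fun z => ?_⟩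
  have hz := norm_nonneg z
  by_cases h1 : z = a
  · rw [h1]; nlinarith [norm_nonneg a]
  by_cases h2 : z = b
  · rw [h2]; nlinarith [norm_nonneg b]
  nlinarith [hC z h1 h2]

theorem sectorNorm_pos {α : ℝ} (hα : α ∈ Ioo 0 (π / 2)) {z : ℂ}
    (h1 : z ≠ Complex.exp (α * Complex.I)) (h2 : z ≠ Complex.exp (-(α * Complex.I))) :
    0 < sectorNorm α z := by
  rcases eq_or_ne z 0 with rfl | hz
  · rw [sectorNorm_zero hα.1]; exact one_pos
  rcases le_or_gt |z.arg| (2 * α) with h | h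
  · have e := Complex.exp_log hz
    have him : |(Complex.log z).im| ≤ 2 * α := by rwa [Complex.log_im]
    have hp : poleExp α (Complex.log z) ≠ 0 := by
      rw [poleExp, e]
      exact mul_ne_zero (sub_ne_zero.2 h1) (sub_ne_zero.2 h2)
    rw [← e, sectorNorm_exp_inner hα him]
    exact norm_pos_iff.2 (sectorExp_ne_zero hα him hp)
  · rw [sectorNorm_of_le hα.1 h.le]; positivity

theorem continuousAt_regularPart {α : ℝ} (hα : α ∈ Ioo 0 (π / 2)) {z : ℂ}
    (h1 : z ≠ Complex.exp (α * Complex.I)) (h2 : z ≠ Complex.exp (-(α * Complex.I))) :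
    ContinuousAt (regularPart α) z := by
  refine ((continuous_sectorNorm hα.1).continuousAt.log (sectorNorm_pos hα h1 h2).ne').sub ?_ |>.sub ?_
  · exact ContinuousAt.log (by fun_prop) (norm_ne_zero_iff.2 (sub_ne_zero.2 h1))
  · exact ContinuousAt.log (by fun_prop) (norm_ne_zero_iff.2 (sub_ne_zero.2 h2))

theorem regularPart_zero {α : ℝ} (hα : 0 < α) : regularPart α 0 = 0 := by
  simp [regularPart, sectorNorm_zero hα, norm_exp_neg_mul_I, Complex.norm_exp_ofReal_mul_I]

theorem integrable_sectorDensity_mul_log {α : ℝ} (hα : α ∈ Ioo 0 (π / 2)) (a : ℂ) :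
    Integrable fun z => sectorDensity α z * Real.log ‖z - a‖ :=
  integrable_sectorDensity_mul hα (measurable_log_norm_sub a)
    (integrable_abs_log_norm_mul_decayWeight a)

/-- Test with `regLog ε z - regLog ε 0` and let ε → 0. The approximate identities yield 2π times the
difference of the regular part at z and at 0, where it vanishes. On the density side, the
regularized logarithms converge to the true ones. Taking a difference is what makes the test
function decay. -/
theorem regularPart_eq_integral {α : ℝ} (hα : α ∈ Ioo 0 (π / 2)) {z : ℂ}
    (h1 : z ≠ Complex.exp (α * Complex.I)) (h2 : z ≠ Complex.exp (-(α * Complex.I))) :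
    regularPart α z = (∫ ζ in outerSector α, sectorDensity α ζ * Real.log ‖ζ - z‖) -
      ∫ ζ in outerSector α, sectorDensity α ζ * Real.log ‖ζ‖ := by
  have h0 := hα.1
  have hm := measurableSet_outerSector α
  obtain ⟨C, hC0, hC⟩ := exists_regularPart_bound' hα
  have hV := measurable_regularPart h0
  have t1 := tendsto_integral_mul_laplacian_regLog hV hC0 hC (continuousAt_regularPart hα h1 h2)
  have t2 := tendsto_integral_mul_laplacian_regLog hV hC0 hC (continuousAt_regularPart hα
    (Complex.exp_ne_zero _).symm (Complex.exp_ne_zero _).symm)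
  set g : ℂ → ℝ := (outerSector α).indicator (sectorDensity α) with hg
  have hgm : Measurable g := (measurable_sectorDensity α).indicator hm
  have hgb : ∀ z, |g z| ≤ 2 * π / α ^ 2 * decayWeight z := fun z => by
    rw [hg]
    by_cases h : z ∈ outerSector α
    · rw [indicator_of_mem h, abs_of_nonneg (sectorDensity_nonneg h0 z)]
      exact sectorDensity_le hα z
    · rw [indicator_of_notMem h, abs_zero]
      exact mul_nonneg (by positivity) (decayWeight_nonneg z)
  have t3 := tendsto_integral_regLog_mul z hgm hgb
  have t4 := tendsto_integral_regLog_mul 0 hgm hgb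
  have hind : ∀ f : ℂ → ℝ, ∫ ζ, f ζ * g ζ = ∫ ζ in outerSector α, sectorDensity α ζ * f ζ := by
    intro f
    rw [← integral_indicator hm]
    refine integral_congr_ae (Eventually.of_forall fun ζ => ?_)
    by_cases h : ζ ∈ outerSector α <;> simp [hg, h, mul_comm]
  have hlim := ((t3.sub t4).const_mul (2 * π)).congr' (f₂ := fun ε =>
    (∫ ζ, regularPart α ζ * Laplacian.laplacian (regLog ε z) ζ) -
    ∫ ζ, regularPart α ζ * Laplacian.laplacian (regLog ε 0) ζ) (by
    filter_upwards [Ioc_mem_nhdsGT (zero_lt_one' ℝ)] with ε hε1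
    have hε := hε1.1
    have hi : ∀ a, Integrable fun ζ => regularPart α ζ * Laplacian.laplacian (regLog ε a) ζ :=
      fun a => by
        obtain ⟨C, hC⟩ := exists_laplacian_regLog_le hε a
        exact integrable_regularPart_mul hα (continuous_laplacian_regLog hε a).measurable hC
    have key := integral_regularPart_mul_laplacian hα (isDecayingTest_regLog_sub hε z)
    rw [← integral_sub (hi z) (hi 0)]
    have e1 : ∀ ζ, regularPart α ζ * Laplacian.laplacian (regLog ε z) ζ -
        regularPart α ζ * Laplacian.laplacian (regLog ε 0) ζ =
        regularPart α ζ * Laplacian.laplacian (regLog ε z - regLog ε 0) ζ := fun ζ => by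
      rw [(contDiff_regLog hε z).contDiffAt.laplacian_sub (contDiff_regLog hε 0).contDiffAt,
        mul_sub]
    simp only [e1]
    rw [key]
    congr 1
    have hir : ∀ a : ℂ, Integrable fun ζ => regLog ε a ζ * g ζ :=
      fun a => integrable_regLog_mul hε1 a hgm hgb
    rw [← integral_sub (hir z) (hir 0), ← hind]
    refine integral_congr_ae (Eventually.of_forall fun ζ => ?_)
    simp only [Pi.sub_apply]
    ring)
  have hu := tendsto_nhds_unique hlim (t1.sub t2)
  rw [regularPart_zero h0, hind, hind] at hu
  simp only [sub_zero] at hu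
  have hpi : (2 * π) ≠ 0 := by positivity
  have := mul_left_cancel₀ hpi (hu.trans (by ring : 2 * π * regularPart α z - 2 * π * 0 = 2 * π * regularPart α z))
  exact this.symm

/-! ### The Riesz measure -/

/-- The absolutely continuous part of the Riesz measure. -/
noncomputable def outerMeasureAC (α : ℝ) : Measure ℂ :=
  (volume.restrict (outerSector α)).withDensity fun z => ENNReal.ofReal (sectorDensity α z)

/-- The Riesz measure of `sectorFun α`. -/
noncomputable def sectorMeasure (α : ℝ) : Measure ℂ :=
  Measure.dirac (Complex.exp (α * Complex.I)) + Measure.dirac (Complex.exp (-(α * Complex.I))) +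
    outerMeasureAC α

section

variable {α : ℝ}

theorem measurable_ofReal_sectorDensity (α : ℝ) :
    Measurable fun z => ENNReal.ofReal (sectorDensity α z) :=
  (measurable_sectorDensity α).ennreal_ofReal

theorem outerMeasureAC_eq_zero {s : Set ℂ} (h : volume (s ∩ outerSector α) = 0) :
    outerMeasureAC α s = 0 := by
  refine withDensity_absolutelyContinuous _ _ ?_
  rwa [Measure.restrict_apply' (measurableSet_outerSector α)]

theorem integrable_sectorDensity (hα : α ∈ Ioo 0 (π / 2)) : Integrable (sectorDensity α) := by
  refine (integrable_decayWeight.const_mul (2 * π / α ^ 2)).mono'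
    (measurable_sectorDensity α).aestronglyMeasurable (Eventually.of_forall fun z => ?_)
  rw [Real.norm_of_nonneg (sectorDensity_nonneg hα.1 z)]
  exact sectorDensity_le hα z

/-- The integrand does not depend on θ on the outer arc; the prefactor is the arc length 2π - 4α
divided by 2π. -/
theorem integral_sectorDensity_slice (hα : α ∈ Ioo 0 (π / 2)) (s : ℝ) :
    ∫ θ in -(2 * α)..(-(2 * α) + 2 * π), ‖Complex.exp (s + θ * Complex.I)‖ ^ 2 *
      (outerSector α).indicator (sectorDensity α) (Complex.exp (s + θ * Complex.I)) =
    (π - 2 * α) / π * ((π / α) ^ 2 * Real.exp (π / α * s) / (1 + Real.exp (π / α * s)) ^ 2) := by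
  have h0 := hα.1
  have h1 := hα.2
  have him : ∀ θ : ℝ, ((s : ℂ) + θ * Complex.I).im = θ := fun θ => by simp
  have hre : ∀ θ : ℝ, ((s : ℂ) + θ * Complex.I).re = s := fun θ => by simp
  rw [intervalIntegral.integral_of_le (by linarith [Real.pi_pos])]
  rw [setIntegral_eq_of_subset_of_forall_sdiff_eq_zero (s := Icc (2 * α) (2 * π - 2 * α))
    measurableSet_Ioc (fun θ hθ => ⟨by linarith [hθ.1], by linarith [hθ.2]⟩)]
  · rw [setIntegral_congr_fun (g := fun _ => (2 * π)⁻¹ *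
      ((π / α) ^ 2 * Real.exp (π / α * s) / (1 + Real.exp (π / α * s)) ^ 2)) measurableSet_Icc]
    · rw [setIntegral_const, Real.volume_real_Icc_of_le (by linarith), smul_eq_mul, ← mul_assoc]
      congr 1
      field_simp
      ring
    · intro θ hθ
      have hmem : Complex.exp (s + θ * Complex.I) ∈ outerSector α :=
        abs_arg_exp_outer hα (by rw [him]; exact hθ)
      have := sectorDensity_exp h0 (s + θ * Complex.I)
      rw [hre] at this
      simp only
      rw [indicator_of_mem hmem, ← this]
      field_simp
  · intro θ hθ
    have hθ1 : θ < 2 * α := by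
      by_contra h
      exact hθ.2 ⟨not_lt.1 h, by linarith [hθ.1.2]⟩
    have hmem : Complex.exp (s + θ * Complex.I) ∉ outerSector α := by
      simp only [outerSector, mem_ofPred_eq, not_le]
      rw [arg_exp (by rw [him]; constructor <;> linarith [hθ.1.1, hθ1]), him]
      exact abs_lt.2 ⟨hθ.1.1, hθ1⟩
    rw [indicator_of_notMem hmem, mul_zero]

/-- In s = log r the integrand is a constant multiple of the derivative of k e^{ks}/(1 + e^{ks}),
which increases from 0 to k = π/α. -/
theorem integral_sectorDensity (hα : α ∈ Ioo 0 (π / 2)) :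
    ∫ z in outerSector α, sectorDensity α z = (π - 2 * α) / α := by
  have h0 := hα.1
  have hk : 0 < π / α := by positivity
  have hm := measurableSet_outerSector α
  have T := tendsto_integral_exp (-(2 * α)) ((integrable_sectorDensity hα).indicator hm)
  rw [integral_indicator hm] at T
  simp only [integral_sectorDensity_slice hα, intervalIntegral.integral_const_mul] at T
  have hint : ∀ S : ℝ, ∫ s in (-S)..S,
      (π / α) ^ 2 * Real.exp (π / α * s) / (1 + Real.exp (π / α * s)) ^ 2 =
      π / α * Real.exp (π / α * S) / (1 + Real.exp (π / α * S)) -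
        π / α * Real.exp (π / α * -S) / (1 + Real.exp (π / α * -S)) := fun S => by
    refine intervalIntegral.integral_eq_sub_of_hasDerivAt
      (f := fun s => π / α * Real.exp (π / α * s) / (1 + Real.exp (π / α * s)))
      (fun s _ => hasDerivAt_logistic (π / α) s) (Continuous.intervalIntegrable ?_ _ _)
    exact Continuous.div (by fun_prop) (by fun_prop) fun s => by positivity
  simp only [hint] at T
  have hneg : Tendsto (fun S : ℝ => Real.exp (π / α * -S)) atTop (𝓝 0) := by
    refine Real.tendsto_exp_atBot.comp ?_
    exact tendsto_neg_atTop_atBot.const_mul_atBot hk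
  have t2 : Tendsto (fun S : ℝ => π / α * Real.exp (π / α * -S) / (1 + Real.exp (π / α * -S)))
      atTop (𝓝 0) := by
    have := (hneg.const_mul (π / α)).div (hneg.const_add 1) (by norm_num)
    rw [mul_zero, add_zero, zero_div] at this
    exact this
  have t1 : Tendsto (fun S : ℝ => π / α * Real.exp (π / α * S) / (1 + Real.exp (π / α * S)))
      atTop (𝓝 (π / α)) := by
    have := (tendsto_const_nhds (x := π / α)).div (hneg.const_add 1) (by norm_num)
    rw [add_zero, div_one] at this
    refine this.congr fun S => ?_
    have e : Real.exp (π / α * -S) = (Real.exp (π / α * S))⁻¹ := by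
      rw [mul_neg, Real.exp_neg]
    have := Real.exp_pos (π / α * S)
    rw [Pi.div_apply, e]
    field_simp
    ring
  have := tendsto_nhds_unique T ((t1.sub t2).const_mul ((π - 2 * α) / π))
  rw [this]
  field_simp
  ring

theorem outerMeasureAC_outerSector (hα : α ∈ Ioo 0 (π / 2)) :
    outerMeasureAC α (outerSector α) = ENNReal.ofReal ((π - 2 * α) / α) := by
  rw [outerMeasureAC, withDensity_apply _ (measurableSet_outerSector α),
    Measure.restrict_restrict (measurableSet_outerSector α), inter_self,
    ← integral_sectorDensity hα,
    ofReal_integral_eq_lintegral_ofReal (integrable_sectorDensity hα).integrableOn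
      (Eventually.of_forall (sectorDensity_nonneg hα.1))]

theorem arg_exp_mul_I (hα : α ∈ Ioo 0 (π / 2)) : (Complex.exp (α * Complex.I)).arg = α := by
  have h0 := hα.1
  have h1 := hα.2
  have := arg_exp (w := α * Complex.I) (by simp; constructor <;> linarith)
  simpa using this

theorem arg_exp_neg_mul_I (hα : α ∈ Ioo 0 (π / 2)) :
    (Complex.exp (-(α * Complex.I))).arg = -α := by
  have h0 := hα.1
  have h1 := hα.2
  have := arg_exp (w := -(α * Complex.I)) (by simp; constructor <;> linarith)
  simpa using this

theorem exp_mul_I_ne_exp_neg (hα : α ∈ Ioo 0 (π / 2)) :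
    Complex.exp (α * Complex.I) ≠ Complex.exp (-(α * Complex.I)) := fun h => by
  have := congrArg Complex.arg h
  rw [arg_exp_mul_I hα, arg_exp_neg_mul_I hα] at this
  linarith [hα.1]

theorem exp_mul_I_notMem (hα : α ∈ Ioo 0 (π / 2)) :
    Complex.exp (α * Complex.I) ∉ outerSector α := by
  have h0 := hα.1
  simp only [outerSector, mem_ofPred_eq, not_le, arg_exp_mul_I hα, abs_of_pos h0]
  linarith

theorem exp_neg_mul_I_notMem (hα : α ∈ Ioo 0 (π / 2)) :
    Complex.exp (-(α * Complex.I)) ∉ outerSector α := by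
  have h0 := hα.1
  simp only [outerSector, mem_ofPred_eq, not_le, arg_exp_neg_mul_I hα, abs_neg, abs_of_pos h0]
  linarith

theorem outerMeasureAC_singleton (z : ℂ) : outerMeasureAC α {z} = 0 :=
  outerMeasureAC_eq_zero (measure_mono_null inter_subset_left (by simp))

theorem outerMeasureAC_univ (hα : α ∈ Ioo 0 (π / 2)) :
    outerMeasureAC α univ = ENNReal.ofReal ((π - 2 * α) / α) := by
  rw [← measure_add_measure_compl (measurableSet_outerSector α), outerMeasureAC_outerSector hα,
    outerMeasureAC_eq_zero (by simp), add_zero]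

theorem sectorMeasure_univ (hα : α ∈ Ioo 0 (π / 2)) :
    sectorMeasure α univ = ENNReal.ofReal (π / α) := by
  have h0 := hα.1
  have h1 := hα.2
  rw [sectorMeasure, Measure.add_apply, Measure.add_apply, outerMeasureAC_univ hα, measure_univ,
    measure_univ, ← ENNReal.ofReal_one, ← ENNReal.ofReal_add (by norm_num) (by norm_num),
    ← ENNReal.ofReal_add (by norm_num) (div_nonneg (by linarith) h0.le)]
  congr 1
  field_simp
  ring

theorem sectorMeasure_pole (hα : α ∈ Ioo 0 (π / 2)) :
    sectorMeasure α {Complex.exp (α * Complex.I)} = 1 := by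
  rw [sectorMeasure, Measure.add_apply, Measure.add_apply, outerMeasureAC_singleton,
    Measure.dirac_apply' _ (measurableSet_singleton _),
    Measure.dirac_apply' _ (measurableSet_singleton _), indicator_of_mem (mem_singleton _),
    indicator_of_notMem (by simpa using (exp_mul_I_ne_exp_neg hα).symm)]
  simp

theorem sectorMeasure_pole_neg (hα : α ∈ Ioo 0 (π / 2)) :
    sectorMeasure α {Complex.exp (-(α * Complex.I))} = 1 := by
  rw [sectorMeasure, Measure.add_apply, Measure.add_apply, outerMeasureAC_singleton,
    Measure.dirac_apply' _ (measurableSet_singleton _),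
    Measure.dirac_apply' _ (measurableSet_singleton _), indicator_of_mem (mem_singleton _),
    indicator_of_notMem (by simpa using exp_mul_I_ne_exp_neg hα)]
  simp

theorem sectorMeasure_outerSector (hα : α ∈ Ioo 0 (π / 2)) :
    sectorMeasure α (outerSector α) = ENNReal.ofReal ((π - 2 * α) / α) := by
  have hm := measurableSet_outerSector α
  rw [sectorMeasure, Measure.add_apply, Measure.add_apply, outerMeasureAC_outerSector hα,
    Measure.dirac_apply' _ hm, Measure.dirac_apply' _ hm, indicator_of_notMem (exp_mul_I_notMem hα),
    indicator_of_notMem (exp_neg_mul_I_notMem hα), zero_add, zero_add]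

theorem sectorMeasure_restrict (hα : α ∈ Ioo 0 (π / 2)) :
    (sectorMeasure α).restrict (outerSector α) = outerMeasureAC α := by
  classical
  have hm := measurableSet_outerSector α
  rw [sectorMeasure, Measure.restrict_add, Measure.restrict_add, restrict_dirac' hm, restrict_dirac' hm,
    if_neg (exp_mul_I_notMem hα), if_neg (exp_neg_mul_I_notMem hα),
    zero_add, zero_add, outerMeasureAC, restrict_withDensity hm, Measure.restrict_restrict hm,
    inter_self]

theorem sectorMeasure_compl :
    sectorMeasure α (outerSector α ∪
      {Complex.exp (α * Complex.I), Complex.exp (-(α * Complex.I))})ᶜ = 0 := by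
  have hm : MeasurableSet (outerSector α ∪
      {Complex.exp (α * Complex.I), Complex.exp (-(α * Complex.I))})ᶜ :=
    ((measurableSet_outerSector α).union (by measurability)).compl
  rw [sectorMeasure, Measure.add_apply, Measure.add_apply, Measure.dirac_apply' _ hm,
    Measure.dirac_apply' _ hm, indicator_of_notMem (by simp), indicator_of_notMem (by simp),
    outerMeasureAC_eq_zero, add_zero, add_zero]
  rw [compl_union, inter_assoc, inter_comm {_, _}ᶜ, ← inter_assoc, compl_inter_self, empty_inter,
    measure_empty]

theorem sectorMeasure_innerSector (hα : α ∈ Ioo 0 (π / 2)) :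
    sectorMeasure α {z : ℂ | z ≠ 0 ∧ |z.arg| ≤ α} = 2 := by
  have h0 := hα.1
  have hm : MeasurableSet {z : ℂ | z ≠ 0 ∧ |z.arg| ≤ α} :=
    (measurableSet_singleton (0:ℂ)).compl.inter
      (measurableSet_le Complex.measurable_arg.abs measurable_const)
  have m1 : Complex.exp (α * Complex.I) ∈ {z : ℂ | z ≠ 0 ∧ |z.arg| ≤ α} :=
    ⟨Complex.exp_ne_zero _, by rw [arg_exp_mul_I hα, abs_of_pos h0]⟩
  have m2 : Complex.exp (-(α * Complex.I)) ∈ {z : ℂ | z ≠ 0 ∧ |z.arg| ≤ α} :=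
    ⟨Complex.exp_ne_zero _, by rw [arg_exp_neg_mul_I hα, abs_neg, abs_of_pos h0]⟩
  rw [sectorMeasure, Measure.add_apply, Measure.add_apply, Measure.dirac_apply' _ hm,
    Measure.dirac_apply' _ hm, indicator_of_mem m1, indicator_of_mem m2,
    outerMeasureAC_eq_zero, add_zero]
  · simp only [Pi.one_apply]; norm_num
  · refine measure_mono_null (t := ∅) (fun z hz => ?_) measure_empty
    have h1 := hz.1.2
    have h2 : 2 * α ≤ |z.arg| := hz.2
    linarith

theorem isFiniteMeasure_sectorMeasure (hα : α ∈ Ioo 0 (π / 2)) :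
    IsFiniteMeasure (sectorMeasure α) :=
  ⟨by rw [sectorMeasure_univ hα]; exact ENNReal.ofReal_lt_top⟩

/-! ### Integration against the Riesz measure. -/

theorem integrable_outerMeasureAC (hα : α ∈ Ioo 0 (π / 2)) {f : ℂ → ℝ}
    (hf : Integrable fun z => sectorDensity α z * f z) : Integrable f (outerMeasureAC α) := by
  rw [outerMeasureAC, integrable_withDensity_iff_integrable_smul' (measurable_ofReal_sectorDensity α)
    (Eventually.of_forall fun z => ENNReal.ofReal_lt_top)]
  simp only [ENNReal.toReal_ofReal (sectorDensity_nonneg hα.1 _), smul_eq_mul]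
  exact hf.integrableOn

theorem integral_outerMeasureAC (hα : α ∈ Ioo 0 (π / 2)) (f : ℂ → ℝ) :
    ∫ z, f z ∂(outerMeasureAC α) = ∫ z in outerSector α, sectorDensity α z * f z := by
  rw [outerMeasureAC, integral_withDensity_eq_integral_toReal_smul (measurable_ofReal_sectorDensity α)
    (Eventually.of_forall fun z => ENNReal.ofReal_lt_top)]
  simp only [ENNReal.toReal_ofReal (sectorDensity_nonneg hα.1 _), smul_eq_mul]

theorem integrable_sectorMeasure (hα : α ∈ Ioo 0 (π / 2)) {f : ℂ → ℝ} (hfm : Measurable f)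
    (hf : Integrable fun z => sectorDensity α z * f z) : Integrable f (sectorMeasure α) :=
  ((integrable_dirac' hfm.stronglyMeasurable (by simp)).add_measure
    (integrable_dirac' hfm.stronglyMeasurable (by simp))).add_measure
    (integrable_outerMeasureAC hα hf)

theorem integral_sectorMeasure (hα : α ∈ Ioo 0 (π / 2)) {f : ℂ → ℝ} (hfm : Measurable f)
    (hf : Integrable fun z => sectorDensity α z * f z) :
    ∫ z, f z ∂(sectorMeasure α) = f (Complex.exp (α * Complex.I)) +
      f (Complex.exp (-(α * Complex.I))) + ∫ z in outerSector α, sectorDensity α z * f z := by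
  have i1 : Integrable f (Measure.dirac (Complex.exp (α * Complex.I))) :=
    integrable_dirac' hfm.stronglyMeasurable (by simp)
  have i2 : Integrable f (Measure.dirac (Complex.exp (-(α * Complex.I)))) :=
    integrable_dirac' hfm.stronglyMeasurable (by simp)
  rw [sectorMeasure, integral_add_measure (i1.add_measure i2) (integrable_outerMeasureAC hα hf),
    integral_add_measure i1 i2, integral_dirac, integral_dirac, integral_outerMeasureAC hα]

theorem log_sectorNorm_eq (z : ℂ) :
    Real.log (sectorNorm α z) = regularPart α z + Real.log ‖z - Complex.exp (α * Complex.I)‖ +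
      Real.log ‖z - Complex.exp (-(α * Complex.I))‖ := by
  rw [regularPart]; ring

/-- Splitting off the two logarithmic poles, the regular part produces the absolutely continuous
measure and each fundamental solution produces one unit atom. -/
theorem isRieszMeasure_sectorMeasure (hα : α ∈ Ioo 0 (π / 2)) :
    IsRieszMeasure (sectorFun α) (sectorMeasure α) where
  locallyFinite := by
    have := isFiniteMeasure_sectorMeasure hα
    infer_instance
  ae_finite := by
    filter_upwards [ae_ne_poles α] with z hz
    rw [sectorFun_eq_coe hα.1 (sectorNorm_pos hα hz.1 hz.2)]
    exact ⟨EReal.coe_ne_bot _, EReal.coe_ne_top _⟩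
  locallyIntegrable := by
    simp only [toReal_sectorFun hα.1, log_sectorNorm_eq]
    refine (LocallyIntegrable.add ?_ (locallyIntegrable_log_norm_sub _)).add
      (locallyIntegrable_log_norm_sub _)
    obtain ⟨C, hC0, hC⟩ := exists_regularPart_bound' hα
    have hb : LocallyIntegrable fun z : ℂ => C * (1 + ‖z‖) :=
      (by fun_prop : Continuous fun z : ℂ => C * (1 + ‖z‖)).locallyIntegrable
    refine hb.mono (measurable_regularPart hα.1).aestronglyMeasurable (Eventually.of_forall fun z => ?_)
    rw [Real.norm_eq_abs, Real.norm_of_nonneg (by positivity)]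
    exact hC z
  laplacian_eq φ hφ hc := by
    have hφ2 : ContDiff ℝ 2 φ := contDiff_infty.1 hφ 2
    have hd := isDecayingTest_of_hasCompactSupport hφ2 hc
    obtain ⟨C, hC⟩ := hd.decay_laplacian
    have hLm := hd.continuous_laplacian.measurable
    have i1 := integrable_regularPart_mul hα hLm hC
    have i2 : ∀ a : ℂ, Integrable fun z => Real.log ‖z - a‖ * Laplacian.laplacian φ z := fun a => by
      refine ((integrable_abs_log_norm_mul_decayWeight a).mul_const C).mono'
        ((measurable_log_norm_sub a).mul hLm).aestronglyMeasurable (Eventually.of_forall fun z => ?_)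
      rw [Real.norm_eq_abs, abs_mul, mul_assoc, mul_comm _ C]
      exact mul_le_mul_of_nonneg_left (hC z) (abs_nonneg _)
    simp only [toReal_sectorFun hα.1, log_sectorNorm_eq, add_mul]
    have i3 : Integrable fun z => regularPart α z * Laplacian.laplacian φ z +
        Real.log ‖z - Complex.exp (α * Complex.I)‖ * Laplacian.laplacian φ z := i1.add (i2 _)
    rw [integral_add i3 (i2 _), integral_add i1 (i2 _),
      integral_log_norm_sub_mul_laplacian hφ2 hc, integral_log_norm_sub_mul_laplacian hφ2 hc,
      integral_regularPart_mul_laplacian hα hd,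
      integral_sectorMeasure hα hφ.continuous.measurable (hd.integrable_sectorDensity_mul hα)]
    ring

end

/-! ### Symmetry and potential of the normalized measure -/

section

variable {α : ℝ}

theorem conj_exp_mul_I (α : ℝ) : (starRingEnd ℂ) (Complex.exp (α * Complex.I)) =
    Complex.exp (-(α * Complex.I)) := by
  rw [← Complex.exp_conj]; simp

theorem conj_exp_neg_mul_I (α : ℝ) : (starRingEnd ℂ) (Complex.exp (-(α * Complex.I))) =
    Complex.exp (α * Complex.I) := by
  rw [← conj_exp_mul_I, Complex.conj_conj]

theorem measurable_conj : Measurable (starRingEnd ℂ) := Complex.continuous_conj.measurable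

theorem abs_arg_conj (z : ℂ) : |((starRingEnd ℂ) z).arg| = |z.arg| := by
  rw [Complex.arg_conj]
  split_ifs with h
  · rw [h]
  · rw [abs_neg]

/-- Conjugation preserves area, and the outer sector and the density depend only on |arg z| and |z|.
-/
theorem map_conj_outerMeasureAC : (outerMeasureAC α).map (starRingEnd ℂ) = outerMeasureAC α := by
  have hmp : MeasurePreserving (starRingEnd ℂ) (volume.restrict (outerSector α))
      (volume.restrict (outerSector α)) := by
    have := (Complex.conjLIE.measurePreserving).restrict_preimage (measurableSet_outerSector α)
    have e : Complex.conjLIE ⁻¹' outerSector α = outerSector α := by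
      ext z
      exact Iff.of_eq (congrArg (2 * α ≤ ·) (abs_arg_conj z))
    rw [e] at this
    exact this
  ext s hs
  rw [Measure.map_apply measurable_conj hs, outerMeasureAC, withDensity_apply _ hs,
    withDensity_apply _ (measurable_conj hs)]
  rw [← (hmp.restrict_preimage hs).lintegral_comp (measurable_ofReal_sectorDensity α)]
  simp only [sectorDensity, Complex.norm_conj]

theorem map_conj_sectorMeasure : (sectorMeasure α).map (starRingEnd ℂ) = sectorMeasure α := by
  rw [sectorMeasure, Measure.map_add _ _ measurable_conj, Measure.map_add _ _ measurable_conj,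
    map_conj_outerMeasureAC, Measure.map_dirac' measurable_conj, Measure.map_dirac' measurable_conj,
    conj_exp_mul_I, conj_exp_neg_mul_I, add_comm (Measure.dirac _)]

/-- The normalized Riesz measure. -/
noncomputable def sectorProbability (α : ℝ) : Measure ℂ :=
  (sectorMeasure α univ)⁻¹ • sectorMeasure α

theorem sectorProbability_apply (hα : α ∈ Ioo 0 (π / 2)) (s : Set ℂ) :
    sectorProbability α s = ENNReal.ofReal (α / π) * sectorMeasure α s := by
  rw [sectorProbability, Measure.smul_apply, sectorMeasure_univ hα, smul_eq_mul,
    ← ENNReal.ofReal_inv_of_pos (div_pos Real.pi_pos hα.1), inv_div]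

theorem isProbabilityMeasure_sectorProbability (hα : α ∈ Ioo 0 (π / 2)) :
    IsProbabilityMeasure (sectorProbability α) where
  measure_univ := by
    have h0 := hα.1
    rw [sectorProbability_apply hα, sectorMeasure_univ hα, ← ENNReal.ofReal_mul (by positivity),
      ← ENNReal.ofReal_one]
    congr 1
    field_simp

theorem logAbs_eq_coe {w : ℂ} (hw : w ≠ 0) : logAbs w = (Real.log ‖w‖ : ℝ) := by
  rw [logAbs_eq, ENNReal.log_ofReal_of_pos (norm_pos_iff.2 hw)]

/-- If `μ` has no atom at `z`, the logarithmic potential at `z` is a real integral. -/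
theorem logPotential_eq_integral {μ : Measure ℂ} {z : ℂ} (hz : μ {z} = 0)
    (hi : Integrable (fun ζ => Real.log ‖ζ - z‖) μ) (h0 : Integrable (fun ζ => Real.log ‖ζ‖) μ) :
    logPotential μ z = ((∫ ζ, Real.log ‖ζ - z‖ ∂μ -
      ∫ ζ in {ζ : ℂ | 1 < ‖ζ‖}, Real.log ‖ζ‖ ∂μ : ℝ) : EReal) := by
  have hm : MeasurableSet {ζ : ℂ | 1 < ‖ζ‖} := measurableSet_lt measurable_const measurable_norm
  have hc : {ζ : ℂ | ‖ζ‖ ≤ 1} = {ζ : ℂ | 1 < ‖ζ‖}ᶜ := by ext; simp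
  have hne : ∀ᵐ ζ ∂μ, ζ ≠ z := by
    rw [ae_iff]; simpa using hz
  rw [logPotential, extIntegral_eq_integral hi.integrableOn,
    extIntegral_eq_integral (hi.sub h0).integrableOn, ← EReal.coe_add, hc,
    ← integral_add_compl hm hi]
  · congr 1
    simp only [Pi.sub_apply]
    rw [integral_sub hi.integrableOn h0.integrableOn]
    ring
  · filter_upwards [ae_restrict_of_ae hne, ae_restrict_mem hm] with ζ h1 h2
    have hζ : 0 < ‖ζ‖ := lt_trans one_pos h2
    have e : 1 - z / ζ = (ζ - z) / ζ := by
      rw [sub_div, div_self (norm_pos_iff.1 hζ)]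
    have h3 : ζ - z ≠ 0 := sub_ne_zero.2 h1
    rw [e, logAbs_eq_coe (div_ne_zero h3 (norm_pos_iff.1 hζ)), norm_div,
      Real.log_div (norm_ne_zero_iff.2 h3) hζ.ne']
    rfl
  · filter_upwards [ae_restrict_of_ae hne] with ζ h1
    rw [logAbs_eq_coe (sub_ne_zero.2 h1.symm), norm_sub_rev]

/-- The logarithmic potential is `-∞` at the atoms in the closed unit disc. -/
theorem logPotential_eq_bot {μ : Measure ℂ} {z : ℂ} (hz : μ {z} ≠ 0) (h1 : ‖z‖ ≤ 1) :
    logPotential μ z = ⊥ := by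
  have : ∫⁻ ζ, (-logAbs (z - ζ)).toENNReal ∂μ.restrict {ζ : ℂ | ‖ζ‖ ≤ 1} = ⊤ := by
    refine top_unique ?_
    calc (⊤ : ℝ≥0∞) = ∫⁻ ζ in {z}, (-logAbs (z - ζ)).toENNReal ∂μ := by
          rw [lintegral_singleton, sub_self, logAbs, enorm_zero, ENNReal.log_zero, EReal.neg_bot,
            EReal.toENNReal_top, ENNReal.top_mul hz]
      _ ≤ _ := lintegral_mono_set (singleton_subset_iff.2 h1)
  -- Subtracting ⊤ gives ⊥ and adding to ⊥ leaves it ⊥, so no finiteness of the remaining terms is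
  -- required.
  rw [logPotential, extIntegral, this, EReal.coe_ennreal_top, EReal.sub_top, EReal.bot_add]

theorem integrable_sectorProbability (hα : α ∈ Ioo 0 (π / 2)) {f : ℂ → ℝ}
    (hf : Integrable f (sectorMeasure α)) : Integrable f (sectorProbability α) := by
  refine hf.smul_measure ?_
  rw [sectorMeasure_univ hα]
  exact ENNReal.inv_ne_top.2 (ENNReal.ofReal_pos.2 (div_pos Real.pi_pos hα.1)).ne'

theorem integrable_log_norm_sub_sectorMeasure (hα : α ∈ Ioo 0 (π / 2)) (a : ℂ) :
    Integrable (fun ζ => Real.log ‖ζ - a‖) (sectorMeasure α) :=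
  integrable_sectorMeasure hα (measurable_log_norm_sub a) (integrable_sectorDensity_mul_log hα a)

theorem sectorProbability_singleton (hα : α ∈ Ioo 0 (π / 2)) {z : ℂ}
    (h1 : z ≠ Complex.exp (α * Complex.I)) (h2 : z ≠ Complex.exp (-(α * Complex.I))) :
    sectorProbability α {z} = 0 := by
  rw [sectorProbability_apply hα, sectorMeasure, Measure.add_apply, Measure.add_apply,
    outerMeasureAC_singleton, Measure.dirac_apply' _ (measurableSet_singleton _),
    Measure.dirac_apply' _ (measurableSet_singleton _),
    indicator_of_notMem (by simpa using h1.symm), indicator_of_notMem (by simpa using h2.symm)]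
  simp

theorem sectorProbability_pole (hα : α ∈ Ioo 0 (π / 2)) :
    sectorProbability α {Complex.exp (α * Complex.I)} = ENNReal.ofReal (α / π) := by
  rw [sectorProbability_apply hα, sectorMeasure_pole hα, mul_one]

theorem sectorProbability_pole_neg (hα : α ∈ Ioo 0 (π / 2)) :
    sectorProbability α {Complex.exp (-(α * Complex.I))} = ENNReal.ofReal (α / π) := by
  rw [sectorProbability_apply hα, sectorMeasure_pole_neg hα, mul_one]

/-- Away from the poles the potential of the normalized measure is an affine function
of `sectorFun α`. -/
theorem exists_logPotential_sectorProbability (hα : α ∈ Ioo 0 (π / 2)) :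
    ∃ K : ℝ, ∀ z : ℂ, z ≠ Complex.exp (α * Complex.I) → z ≠ Complex.exp (-(α * Complex.I)) →
      logPotential (sectorProbability α) z =
        ((α / π * Real.log (sectorNorm α z) + K : ℝ) : EReal) := by
  have h0 := hα.1
  -- The first constant comes from normalizing the regular part to vanish at 0, the second from
  -- log|1 - z/ζ| = log|ζ - z| - log|ζ| for |ζ| > 1.
  refine ⟨α / π * (∫ ζ in outerSector α, sectorDensity α ζ * Real.log ‖ζ‖) -
    ∫ ζ in {ζ : ℂ | 1 < ‖ζ‖}, Real.log ‖ζ‖ ∂(sectorProbability α), fun z h1 h2 => ?_⟩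
  have i0 := integrable_log_norm_sub_sectorMeasure hα 0
  simp only [sub_zero] at i0
  rw [logPotential_eq_integral (sectorProbability_singleton hα h1 h2)
    (integrable_sectorProbability hα (integrable_log_norm_sub_sectorMeasure hα z))
    (integrable_sectorProbability hα i0), sectorProbability, integral_smul_measure,
    ← sectorProbability, integral_sectorMeasure hα (measurable_log_norm_sub z)
      (integrable_sectorDensity_mul_log hα z), log_sectorNorm_eq, regularPart_eq_integral hα h1 h2,
    sectorMeasure_univ hα, ENNReal.toReal_inv, ENNReal.toReal_ofReal (by positivity), inv_div,
    smul_eq_mul, norm_sub_rev _ z, norm_sub_rev _ z]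
  congr 1
  ring

/-- At the poles the left side is -∞. Elsewhere both sides are the same increasing affine function
of log N, and |z| is never a pole because its argument is 0. -/
theorem logPotential_sectorProbability_le (hα : α ∈ Ioo 0 (π / 2)) (z : ℂ) :
    logPotential (sectorProbability α) z ≤ logPotential (sectorProbability α) (‖z‖ : ℂ) := by
  have h0 := hα.1
  have hpos : ENNReal.ofReal (α / π) ≠ 0 := (ENNReal.ofReal_pos.2 (by positivity)).ne'
  by_cases h1 : z = Complex.exp (α * Complex.I)
  · rw [logPotential_eq_bot (z := z)]
    · exact bot_le
    · rwa [h1, sectorProbability_pole hα]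
    · rw [h1, Complex.norm_exp_ofReal_mul_I]
  by_cases h2 : z = Complex.exp (-(α * Complex.I))
  · rw [logPotential_eq_bot (z := z)]
    · exact bot_le
    · rwa [h2, sectorProbability_pole_neg hα]
    · rw [h2, norm_exp_neg_mul_I]
  obtain ⟨K, hK⟩ := exists_logPotential_sectorProbability hα
  have harg : ((‖z‖ : ℝ) : ℂ).arg = 0 := Complex.arg_ofReal_of_nonneg (norm_nonneg z)
  rw [hK z h1 h2, hK (‖z‖ : ℂ)]
  · rw [EReal.coe_le_coe_iff, sectorNorm_norm h0]
    gcongr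
    · exact sectorNorm_pos hα h1 h2
    · exact sectorNorm_le α z
  · intro h
    rw [h, arg_exp_mul_I hα] at harg
    linarith
  · intro h
    rw [h, arg_exp_neg_mul_I hα] at harg
    linarith

theorem sectorProbability_innerSector (hα : α ∈ Ioo 0 (π / 2)) :
    sectorProbability α {z : ℂ | z ≠ 0 ∧ |z.arg| ≤ α} = ENNReal.ofReal (2 * α / π) := by
  rw [sectorProbability_apply hα, sectorMeasure_innerSector hα, mul_comm,
    ← ENNReal.ofReal_ofNat, ← ENNReal.ofReal_mul (by norm_num), mul_div_assoc]

theorem map_conj_sectorProbability :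
    (sectorProbability α).map (starRingEnd ℂ) = sectorProbability α := by
  rw [sectorProbability, Measure.map_smul, map_conj_sectorMeasure]

end

theorem mainTheorem3 (α : ℝ) (hα : α ∈ Set.Ioo 0 (π / 2)) :
    IsSubharmonic (sectorFun α) ∧
    (∀ z : ℂ, sectorFun α z ≤ sectorFun α (‖z‖ : ℂ)) ∧
    ∃ ν μ : Measure ℂ,
      -- the Riesz measure of the function and its structure
      IsRieszMeasure (sectorFun α) ν ∧
      ν Set.univ = ENNReal.ofReal (π / α) ∧
      ν {Complex.exp (α * Complex.I)} = 1 ∧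
      ν {Complex.exp (-(α * Complex.I))} = 1 ∧
      ν (outerSector α) = ENNReal.ofReal ((π - 2 * α) / α) ∧
      ν.restrict (outerSector α) = (volume.restrict (outerSector α)).withDensity
        (fun z => ENNReal.ofReal (sectorDensity α z)) ∧
      ν (outerSector α ∪
        {Complex.exp (α * Complex.I), Complex.exp (-(α * Complex.I))})ᶜ = 0 ∧
      -- the normalized measure
      μ = (ν Set.univ)⁻¹ • ν ∧
      IsProbabilityMeasure μ ∧
      μ.map (starRingEnd ℂ) = μ ∧
      (∀ z : ℂ, logPotential μ z ≤ logPotential μ (‖z‖ : ℂ)) ∧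
      μ {Complex.exp (α * Complex.I)} = ENNReal.ofReal (α / π) ∧
      μ {Complex.exp (-(α * Complex.I))} = ENNReal.ofReal (α / π) ∧
      μ {z : ℂ | z ≠ 0 ∧ |z.arg| ≤ α} = ENNReal.ofReal (2 * α / π) :=
  ⟨isSubharmonic_sectorFun hα, sectorFun_le_norm hα.1, sectorMeasure α, sectorProbability α,
    isRieszMeasure_sectorMeasure hα, sectorMeasure_univ hα, sectorMeasure_pole hα,
    sectorMeasure_pole_neg hα, sectorMeasure_outerSector hα, sectorMeasure_restrict hα,
    sectorMeasure_compl, rfl, isProbabilityMeasure_sectorProbability hα,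
    map_conj_sectorProbability, logPotential_sectorProbability_le hα, sectorProbability_pole hα,
    sectorProbability_pole_neg hα, sectorProbability_innerSector hα⟩
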